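/- Let $n\ge 1$ and $1<p,q,r<\infty$. Let $\omega$ be a weight on $\mathbb R^n$, i.e. a nonnegative locally integrable function with $\omega>0$ almost everywhere, and write $\omega(E)=\int_E\omega(x)\,dx$. For a measurable function $g$ on $\mathbb R^n$ let $$g^*(t)=\inf\{s>0:\ \omega(\{x:|g(x)|>s\})\le t\},\qquad \|g\|_{L^{p,q}(\omega)}=\Big(\frac qp\int_0^\infty\big[t^{1/p}g^*(t)\big]^q\,\frac{dt}{t}\Big)^{1/q}.$$ For a sequence $\vec f=\{f_k\}_{k\ge1}$ of (complex-valued) measurable functions on $\mathbb R^n$ put $|\vec f(x)|_r=\big(\sum_{k}|f_k(x)|^r\big)^{1/r}$ and $\|\vec f\|_{L^{p,q}(\ell^r,\omega)}=\big\|\,|\vec f|_r\,\big\|_{L^{p,q}(\omega)}$, and let $L^{p,q}(\ell^r,\omega)$ be the set of all such sequences for which this quantity is finite. Suppose that $\omega\in A(p,q)$, i.e. there is a constant $C_0$ such that for every cube $Q$ with sides parallel to the coordinate axes $$\|\chi_Q\|_{L^{p,q}(\omega)}\,\|\chi_Q\,\omega^{-1}\|_{L^{p',q'}(\omega)}\le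 C_0\,|Q|,\qquad \tfrac1p+\tfrac1{p'}=1,\quad \tfrac1q+\tfrac1{q'}=1.$$ Let $Mf(x)=\sup_Q\frac1{|Q|}\int_Q|f(y)|\,dy$ be the Hardy–Littlewood maximal function, where the supremum is taken over all cubes $Q$ centered at $x$ with sides parallel to the coordinate axes, and let $M\vec f=\{Mf_k\}_{k\ge1}$. Then $M$ is bounded on $L^{p,q}(\ell^r,\omega)$: there is a constant $C<\infty$, independent of $\vec f$, such that for every $\vec f\in L^{p,q}(\ell^r,\omega)$ the functions $Mf_k$ are measurable, $M\vec f$ (with values in $[0,\infty]$) has finite $L^{p,q}(\ell^r,\omega)$ norm, and $$\|M\vec f\|_{L^{p,q}(\ell^r,\omega)}\le C\,\|\vec f\|_{L^{p,q}(\ell^r,\omega)}.$$ -/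

import Mathlib

open scoped ENNReal NNReal
open MeasureTheory

noncomputable section

namespace WeightedLorentz

/-- The closed cube in `ℝⁿ` with centre `c`, half side length `h` and sides parallel to the
coordinate axes. -/
def cube {n : ℕ} (c : Fin n → ℝ) (h : ℝ) : Set (Fin n → ℝ) :=
  Set.Icc (fun i => c i - h) (fun i => c i + h)

/-- A weight on `ℝⁿ`: a nonnegative locally integrable function which does not vanish on a set of
positive Lebesgue measure. -/
structure IsWeight {n : ℕ} (ω : (Fin n → ℝ) → ℝ) : Prop where
  nonneg : ∀ x, 0 ≤ ω x
  locallyIntegrable : LocallyIntegrable ω volume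
  ae_pos : ∀ᵐ x ∂(volume : Measure (Fin n → ℝ)), 0 < ω x

/-- The measure `ω(x) dx`. -/
def weightMeasure {n : ℕ} (ω : (Fin n → ℝ) → ℝ) : Measure (Fin n → ℝ) :=
  volume.withDensity (fun x => ENNReal.ofReal (ω x))

section Lorentz

variable {X : Type*} [MeasurableSpace X] {ε : Type*} [ENorm ε]

/-- The distribution function `d_f(s) = μ {x : |f(x)| > s}`. -/
def distribution (μ : Measure X) (f : X → ε) (s : ℝ≥0∞) : ℝ≥0∞ :=
  μ {x | s < ‖f x‖ₑ}

/-- The decreasing rearrangement `f*(t) = inf {s > 0 : d_f(s) ≤ t}` (equal to `∞` if there is no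
finite such `s`). -/
def rearrangement (μ : Measure X) (f : X → ε) (t : ℝ) : ℝ≥0∞ :=
  sInf {s : ℝ≥0∞ | 0 < s ∧ distribution μ f s ≤ ENNReal.ofReal t}

/-- The Lorentz functional `((q/p) ∫₀^∞ (t^{1/p} f*(t))^q dt/t)^{1/q}`, for `0 < p, q < ∞`. -/
def lorentzNorm (μ : Measure X) (p q : ℝ) (f : X → ε) : ℝ≥0∞ :=
  (ENNReal.ofReal (q / p) *
    ∫⁻ t in Set.Ioi (0 : ℝ),
      (ENNReal.ofReal t ^ (1 / p) * rearrangement μ f t) ^ q / ENNReal.ofReal t) ^ (1 / q)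

/-- The pointwise `ℓ^r` norm `|f(x)|_r = (∑ₖ |fₖ(x)|^r)^{1/r}` of a sequence of functions. -/
def seqNorm (r : ℝ) (f : ℕ → X → ε) (x : X) : ℝ≥0∞ :=
  (∑' k, ‖f k x‖ₑ ^ r) ^ (1 / r)

end Lorentz

/-- The norm `‖f‖_{L^{p,q}(ℓ^r, ω)}` of a sequence of functions on `ℝⁿ`. -/
def lorentzSeqNorm {n : ℕ} {ε : Type*} [ENorm ε]
    (ω : (Fin n → ℝ) → ℝ) (p q r : ℝ) (f : ℕ → (Fin n → ℝ) → ε) : ℝ≥0∞ :=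
  lorentzNorm (weightMeasure ω) p q (seqNorm r f)

/-- Membership in `L^{p,q}(ℓ^r, ω)`: every `fₖ` is Lebesgue measurable and the norm is finite. -/
def MemLorentzSeq {n : ℕ} {ε : Type*} [TopologicalSpace ε] [ENorm ε]
    (ω : (Fin n → ℝ) → ℝ) (p q r : ℝ) (f : ℕ → (Fin n → ℝ) → ε) : Prop :=
  (∀ k, AEStronglyMeasurable (f k) volume) ∧ lorentzSeqNorm ω p q r f < ∞

/-- The class `A(p,q)`, for `1 < p, q < ∞`: weights `ω` such that
`‖χ_Q‖_{L^{p,q}(ω)} ‖χ_Q ω⁻¹‖_{L^{p',q'}(ω)} ≤ C |Q|` for all cubes `Q`. -/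
def MemA {n : ℕ} (p q : ℝ) (ω : (Fin n → ℝ) → ℝ) : Prop :=
  IsWeight ω ∧ ∃ C : ℝ≥0, ∀ (c : Fin n → ℝ) (h : ℝ), 0 < h →
    lorentzNorm (weightMeasure ω) p q ((cube c h).indicator fun _ => (1 : ℝ≥0∞)) *
      lorentzNorm (weightMeasure ω) p.conjExponent q.conjExponent
        ((cube c h).indicator fun x => (ENNReal.ofReal (ω x))⁻¹) ≤
    C * volume (cube c h)

/-- The (centred) Hardy–Littlewood maximal function: the supremum of the averages of `|f|` over
the cubes centred at `x`. -/
def maximalFunction {n : ℕ} (f : (Fin n → ℝ) → ℂ) (x : Fin n → ℝ) : ℝ≥0∞ :=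
  ⨆ (h : ℝ) (_ : 0 < h), (volume (cube x h))⁻¹ * ∫⁻ y in cube x h, ‖f y‖ₑ

end WeightedLorentz

end

/-!
The condition `A(p,q)` is used only through an open-ended consequence: `ω` lies in the Muckenhoupt
classes `A_u` for all `u` in a neighbourhood of `p`. Boundedness on `L^{p,q}(ℓ^r, ω)` then follows
by interpolating the vector-valued weighted inequality between two Lebesgue exponents around `p`.
Only cubes of half side length `2^k` are needed, which changes the maximal function by at most a
dimensional factor (`maximalFunction_le`).

*Self-improvement.* By duality, `A(p,q)` bounds averages over a cube `Q` by Lorentz norms with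
respect to `ν = ω dx`. Testing it on a set `E ⊆ Q` gives `|E|^p ν(Q) ≤ K |Q|^p ν(E)`. If `E` has
small density, a stopping-time argument based on the Besicovitch covering theorem
(`ComparableAt.exists_enlargement`) enlarges `E` to sets `U_j`, `j < m`, whose volume exceeds `|E|`
by about `2^j` while `ν(U_j)` exceeds `ν(E)` by at most about `2^{jp}`. Testing `A(p,q)` on
`∑ 2^{-j} 1_{U_j}`, every scale contributes `|E|` to the integral, but the norm grows only
like `m^{1/q}`; since `q > 1`, this gains the factor `m^{-p(1-1/q)}`
(`IsLorentzWeight.exists_comparableAt_gain`). As the comparison bounds are submultiplicative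
(`ComparableAt.mul`), a gain at one density improves the power `p` to some `s < p`
(`IsLorentzWeight.exists_rpow`). Estimating the level sets of `1/ω` on a cube gives `ω ∈ A_u` for
every `u > s` (`exists_isMuckenhouptPair`).

*The inequality for `A_u`.* Lerner's pointwise estimate dominates the maximal function by a
composition of the centred maximal functions with respect to `w` and to its dual weight
(`IsMuckenhouptPair.dyadicMax_rpow_le`), and those are bounded by the Besicovitch theorem for every
measure. The vector-valued inequality follows by extrapolation: Rubio de Francia's algorithm
(`exists_rubioDeFrancia`) produces `A_1` weights `a` and `b` such that the inequality reduces to the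
scalar one with exponent `r` and the weight `a^{1-r} b ∈ A_r`
(`IsMuckenhouptPair.exists_lintegral_seqNorm_le`).

*Interpolation.* A Marcinkiewicz argument over dyadic heights (`exists_lorentzNorm_le_of_split`),
applied to the truncations of the sequence according to the size of its `ℓ^r` norm.
-/

namespace WeightedLorentz

open Set

/-! ### Dyadic sums -/

lemma two_rpow_add (a b : ℝ) : (2 : ℝ≥0∞) ^ (a + b) = 2 ^ a * 2 ^ b :=
  ENNReal.rpow_add _ _ (by norm_num) (by norm_num)

lemma two_rpow_ne_top (a : ℝ) : (2 : ℝ≥0∞) ^ a ≠ ∞ :=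
  ENNReal.rpow_ne_top_of_ne_zero (by norm_num) (by norm_num)

lemma two_rpow_pos (a : ℝ) : 0 < (2 : ℝ≥0∞) ^ a :=
  ENNReal.rpow_pos (by norm_num) (by norm_num)

lemma two_rpow_ne_zero (a : ℝ) : (2 : ℝ≥0∞) ^ a ≠ 0 := (two_rpow_pos a).ne'

lemma two_rpow_le {a b : ℝ} (h : a ≤ b) : (2 : ℝ≥0∞) ^ a ≤ 2 ^ b :=
  ENNReal.rpow_le_rpow_of_exponent_le (by norm_num) h

/-- The two-sided geometric series `∑_{k ∈ ℤ} 2^{-δ|k|}`. -/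
noncomputable def geomSum (δ : ℝ) : ℝ≥0∞ := ∑' k : ℤ, (2 : ℝ≥0∞) ^ (-(δ * |(k : ℝ)|))

lemma geomSum_ne_top {δ : ℝ} (hδ : 0 < δ) : geomSum δ ≠ ∞ := by
  have h2 : Summable fun k : ℕ => (2 : ℝ) ^ (-(δ * (k : ℝ))) := by
    have h1 : ((2 : ℝ) ^ (-δ)) < 1 := Real.rpow_lt_one_of_one_lt_of_neg (by norm_num) (by linarith)
    have := summable_geometric_of_lt_one (by positivity) h1
    refine this.congr fun k => ?_
    rw [← Real.rpow_natCast, ← Real.rpow_mul (by norm_num)]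
    congr 1; ring
  have h : Summable fun k : ℤ => (2 : ℝ) ^ (-(δ * |(k : ℝ)|)) := by
    apply Summable.of_nat_of_neg <;> simpa using h2
  have := h.tsum_ofReal_ne_top
  convert this using 1
  unfold geomSum
  congr 1; ext k
  rw [← ENNReal.ofReal_rpow_of_pos (by norm_num)]
  simp

/-- Translated form of the two-sided geometric series. -/
lemma tsum_two_rpow_abs_sub (δ : ℝ) (j : ℤ) :
    ∑' k : ℤ, (2 : ℝ≥0∞) ^ (-(δ * |(k : ℝ) - j|)) = geomSum δ := by
  rw [geomSum, ← (Equiv.subRight j).tsum_eq fun k : ℤ => (2 : ℝ≥0∞) ^ (-(δ * |(k : ℝ)|))]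
  simp

lemma exists_dyadic {x : ℝ≥0∞} (h0 : x ≠ 0) (ht : x ≠ ∞) :
    ∃ K : ℤ, (2 : ℝ≥0∞) ^ (K : ℝ) < x ∧ x ≤ 2 ^ ((K : ℝ) + 1) := by
  obtain ⟨K, h1, h2⟩ := ENNReal.exists_mem_Ioc_zpow h0 ht (y := 2) (by norm_num) (by norm_num)
  refine ⟨K, by simpa using h1, ?_⟩
  have : ((K : ℝ) + 1) = ((K + 1 : ℤ) : ℝ) := by push_cast; ring
  rw [this, ENNReal.rpow_intCast]; exact h2

/-- The summand `2^{kα} 1_{2^k < x}` of the dyadic decomposition of `x ^ α`. -/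
noncomputable def dyadicTerm (α : ℝ) (k : ℤ) (x : ℝ≥0∞) : ℝ≥0∞ :=
  (Ioi ((2 : ℝ≥0∞) ^ (k : ℝ))).indicator (fun _ => (2 : ℝ≥0∞) ^ (k * α)) x

lemma dyadicTerm_of_lt {α : ℝ} {k : ℤ} {x : ℝ≥0∞} (h : (2 : ℝ≥0∞) ^ (k : ℝ) < x) :
    dyadicTerm α k x = 2 ^ (k * α) := indicator_of_mem (mem_Ioi.2 h) _

lemma dyadicTerm_of_le {α : ℝ} {k : ℤ} {x : ℝ≥0∞} (h : x ≤ (2 : ℝ≥0∞) ^ (k : ℝ)) :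
    dyadicTerm α k x = 0 := indicator_of_notMem (by simpa using h) _

lemma tsum_dyadicTerm_top {α : ℝ} : ∑' k : ℤ, dyadicTerm α k ∞ = ∞ := by
  by_contra hne
  have h1 : ∀ k : ℤ, dyadicTerm α k ∞ = 2 ^ (k * α) := fun k =>
    dyadicTerm_of_lt (two_rpow_ne_top _).lt_top
  simp only [h1] at hne
  rcases le_total 0 α with hα | hα
  · have : ∑' k : ℕ, (1 : ℝ≥0∞) ≤ ∑' k : ℤ, (2 : ℝ≥0∞) ^ (k * α) := by
      calc ∑' k : ℕ, (1 : ℝ≥0∞) ≤ ∑' k : ℕ, (2 : ℝ≥0∞) ^ (((k : ℤ) : ℝ) * α) := by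
            refine ENNReal.tsum_le_tsum fun k => ?_
            simpa using two_rpow_le (a := 0) (b := ((k : ℤ) : ℝ) * α) (by positivity)
        _ ≤ _ := ENNReal.tsum_comp_le_tsum_of_injective
            (f := fun k : ℕ => (k : ℤ)) Nat.cast_injective (fun k : ℤ => (2 : ℝ≥0∞) ^ (k * α))
    simp at this
    exact hne this
  · have : ∑' k : ℕ, (1 : ℝ≥0∞) ≤ ∑' k : ℤ, (2 : ℝ≥0∞) ^ (k * α) := by
      calc ∑' k : ℕ, (1 : ℝ≥0∞) ≤ ∑' k : ℕ, (2 : ℝ≥0∞) ^ (((-(k : ℤ) : ℤ) : ℝ) * α) := by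
            refine ENNReal.tsum_le_tsum fun k => ?_
            have := two_rpow_le (a := 0) (b := ((-(k : ℤ) : ℤ) : ℝ) * α)
              (by push_cast; have : (0 : ℝ) ≤ k := by positivity
                  nlinarith)
            simpa using this
        _ ≤ _ := ENNReal.tsum_comp_le_tsum_of_injective
            (f := fun k : ℕ => -(k : ℤ)) (fun a b h => by simpa using h)
            (fun k : ℤ => (2 : ℝ≥0∞) ^ (k * α))
    simp at this
    exact hne this

lemma rpow_le_tsum_dyadicTerm {α : ℝ} (hα : 0 < α) (x : ℝ≥0∞) :
    x ^ α ≤ 2 ^ α * ∑' k : ℤ, dyadicTerm α k x := by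
  rcases eq_or_ne x 0 with rfl | h0
  · simp [hα]
  rcases eq_or_ne x ∞ with rfl | ht
  · rw [tsum_dyadicTerm_top, ENNReal.mul_top (two_rpow_ne_zero _)]; exact le_top
  obtain ⟨K, h1, h2⟩ := exists_dyadic h0 ht
  calc x ^ α ≤ (2 ^ ((K : ℝ) + 1)) ^ α := ENNReal.rpow_le_rpow h2 hα.le
    _ = 2 ^ α * 2 ^ (K * α) := by rw [← ENNReal.rpow_mul, ← two_rpow_add]; congr 1; ring
    _ = 2 ^ α * dyadicTerm α K x := by rw [dyadicTerm_of_lt h1]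
    _ ≤ _ := by gcongr; exact ENNReal.le_tsum K

lemma tsum_dyadicTerm_le {α : ℝ} (hα : 0 < α) (x : ℝ≥0∞) :
    ∑' k : ℤ, dyadicTerm α k x ≤ geomSum α * x ^ α := by
  rcases eq_or_ne x 0 with rfl | h0
  · have : ∀ k : ℤ, dyadicTerm α k 0 = 0 := fun k => dyadicTerm_of_le (by simp)
    simp [this]
  rcases eq_or_ne x ∞ with rfl | ht
  · rw [ENNReal.top_rpow_of_pos hα, ENNReal.mul_top]
    · exact le_top
    · intro h
      have := ENNReal.tsum_eq_zero.1 h 0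
      simp at this
  obtain ⟨K, h1, h2⟩ := exists_dyadic h0 ht
  rw [← tsum_two_rpow_abs_sub α K, mul_comm, ← ENNReal.tsum_mul_left]
  refine ENNReal.tsum_le_tsum fun k => ?_
  rcases le_or_gt x (2 ^ (k : ℝ)) with h | h
  · rw [dyadicTerm_of_le h]; positivity
  rw [dyadicTerm_of_lt h]
  have hk : (k : ℝ) ≤ K := by
    by_contra hlt
    have h3 : K + 1 ≤ k := by
      have : (K : ℝ) < k := not_le.1 hlt
      exact_mod_cast this
    have h4 : ((K : ℝ) + 1) ≤ k := by exact_mod_cast h3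
    exact absurd (h.trans_le (h2.trans (two_rpow_le h4))) (lt_irrefl _)
  calc (2 : ℝ≥0∞) ^ (k * α) = (2 ^ (K : ℝ)) ^ α * 2 ^ (-(α * |(k : ℝ) - K|)) := by
        rw [← ENNReal.rpow_mul, ← two_rpow_add, abs_of_nonpos (by linarith)]; congr 1; ring
    _ ≤ _ := by gcongr

lemma lintegral_dyadicTerm {X : Type*} [MeasurableSpace X] (μ : Measure X) {f : X → ℝ≥0∞}
    (hf : Measurable f) (α : ℝ) (k : ℤ) :
    ∫⁻ x, dyadicTerm α k (f x) ∂μ = 2 ^ (k * α) * μ {x | (2 : ℝ≥0∞) ^ (k : ℝ) < f x} := by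
  rw [← lintegral_indicator_const (measurableSet_lt measurable_const hf)]
  rfl

lemma measurable_dyadicTerm (α : ℝ) (k : ℤ) : Measurable (dyadicTerm α k) :=
  measurable_const.indicator measurableSet_Ioi

/-- Dyadic layer cake, upper bound. -/
lemma lintegral_rpow_le_tsum {X : Type*} [MeasurableSpace X] (μ : Measure X) {f : X → ℝ≥0∞}
    (hf : Measurable f) {α : ℝ} (hα : 0 < α) :
    ∫⁻ x, f x ^ α ∂μ ≤
      2 ^ α * ∑' k : ℤ, 2 ^ (k * α) * μ {x | (2 : ℝ≥0∞) ^ (k : ℝ) < f x} := by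
  simp only [← lintegral_dyadicTerm μ hf]
  rw [← lintegral_tsum (f := fun k x => dyadicTerm α k (f x))
      fun k => ((measurable_dyadicTerm α k).comp hf).aemeasurable,
    ← lintegral_const_mul (f := fun x => ∑' k : ℤ, dyadicTerm α k (f x)) _
      (Measurable.tsum fun k => (measurable_dyadicTerm α k).comp hf)]
  exact lintegral_mono fun x => rpow_le_tsum_dyadicTerm hα _

/-- Dyadic layer cake, lower bound. -/
lemma tsum_le_lintegral_rpow {X : Type*} [MeasurableSpace X] (μ : Measure X) {f : X → ℝ≥0∞}
    (hf : Measurable f) {α : ℝ} (hα : 0 < α) :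
    ∑' k : ℤ, 2 ^ (k * α) * μ {x | (2 : ℝ≥0∞) ^ (k : ℝ) < f x} ≤
      geomSum α * ∫⁻ x, f x ^ α ∂μ := by
  simp only [← lintegral_dyadicTerm μ hf]
  rw [← lintegral_tsum (f := fun k x => dyadicTerm α k (f x))
      fun k => ((measurable_dyadicTerm α k).comp hf).aemeasurable,
    ← lintegral_const_mul _ (hf.pow_const _)]
  exact lintegral_mono fun x => tsum_dyadicTerm_le hα _

/-! ### Rearrangements and the Lorentz functional -/

section Rearrangement

variable {X : Type*} [MeasurableSpace X] {ε : Type*} [ENorm ε]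

/-- The Galois connection between the rearrangement and the distribution function; the direction
from right to left uses that the distribution function is right continuous. -/
lemma lt_rearrangement_iff (μ : Measure X) (f : X → ε) (t : ℝ) (s : ℝ≥0∞) :
    s < rearrangement μ f t ↔ ENNReal.ofReal t < distribution μ f s := by
  have hanti : ∀ {a b : ℝ≥0∞}, a ≤ b → distribution μ f b ≤ distribution μ f a := fun h =>
    measure_mono fun x hx => lt_of_le_of_lt h hx
  constructor
  · intro h
    by_contra! hle
    rw [rearrangement, lt_sInf_iff] at h
    obtain ⟨b, hsb, hb⟩ := h
    obtain ⟨c, hsc, hcb⟩ := exists_between hsb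
    exact absurd (hb ⟨zero_le.trans_lt hsc, (hanti hsc.le).trans hle⟩) (not_le.2 hcb)
  · intro h
    by_contra! hle
    have hs : s < ∞ := by
      by_contra hs
      rw [not_lt, top_le_iff] at hs
      simp [hs, distribution] at h
    obtain ⟨u, hu1, hu2, hu3⟩ := exists_seq_strictAnti_tendsto' hs
    have hset : {x | s < ‖f x‖ₑ} = ⋃ n, {x | u n < ‖f x‖ₑ} := by
      ext x
      simp only [mem_ofPred_eq, mem_iUnion]
      constructor
      · intro hx
        exact (hu3.eventually (gt_mem_nhds hx)).exists
      · rintro ⟨n, hn⟩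
        exact (hu2 n).1.trans hn
    have hmono : Monotone fun n => {x | u n < ‖f x‖ₑ} := fun a b hab x hx =>
      lt_of_le_of_lt (hu1.antitone hab) hx
    rw [distribution, hset, hmono.measure_iUnion] at h
    obtain ⟨n, hn⟩ := lt_iSup_iff.1 h
    have h1 : rearrangement μ f t < u n := hle.trans_lt (hu2 n).1
    rw [rearrangement, sInf_lt_iff] at h1
    obtain ⟨b, ⟨_, hb⟩, hbn⟩ := h1
    exact absurd (hn.trans_le ((hanti hbn.le).trans hb)) (lt_irrefl _)

lemma measurable_rearrangement (μ : Measure X) (f : X → ε) : Measurable (rearrangement μ f) := by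
  refine Antitone.measurable fun a b hab => ?_
  refine sInf_le_sInf fun s hs => ⟨hs.1, hs.2.trans (ENNReal.ofReal_le_ofReal hab)⟩

/-- The measure `t^{θ-1} dt` on the positive half-line. -/
noncomputable def powerMeasure (θ : ℝ) : Measure ℝ :=
  (volume.restrict (Ioi (0 : ℝ))).withDensity fun t => ENNReal.ofReal t ^ (θ - 1)

lemma powerMeasure_lt {θ : ℝ} (hθ : 0 < θ) (c : ℝ≥0∞) :
    powerMeasure θ {t | ENNReal.ofReal t < c} = c ^ θ / ENNReal.ofReal θ := by
  have key : ∀ c : ℝ≥0, powerMeasure θ {t | ENNReal.ofReal t < c} =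
      (c : ℝ≥0∞) ^ θ / ENNReal.ofReal θ := by
    intro c
    have hm : MeasurableSet {t : ℝ | ENNReal.ofReal t < c} :=
      measurableSet_lt ENNReal.measurable_ofReal measurable_const
    rw [powerMeasure, withDensity_apply _ hm, Measure.restrict_restrict hm]
    have hset : {t : ℝ | ENNReal.ofReal t < c} ∩ Ioi 0 = Ioo 0 (c : ℝ) := by
      ext t
      simp only [mem_inter_iff, mem_ofPred_eq, mem_Ioi, mem_Ioo]
      constructor
      · rintro ⟨h1, h2⟩
        rw [← ENNReal.ofReal_coe_nnreal] at h1
        exact ⟨h2, ((ENNReal.ofReal_lt_ofReal_iff_of_nonneg h2.le).1 h1)⟩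
      · rintro ⟨h1, h2⟩
        rw [← ENNReal.ofReal_coe_nnreal]
        exact ⟨((ENNReal.ofReal_lt_ofReal_iff_of_nonneg h1.le).2 h2), h1⟩
    rw [hset, setLIntegral_congr Ioo_ae_eq_Ioc]
    have h1 : ∫⁻ t in Ioc 0 (c : ℝ), ENNReal.ofReal t ^ (θ - 1) =
        ∫⁻ t in Ioc 0 (c : ℝ), ENNReal.ofReal (t ^ (θ - 1)) := by
      refine setLIntegral_congr_fun measurableSet_Ioc fun t ht => ?_
      exact ENNReal.ofReal_rpow_of_pos ht.1
    have hint : IntervalIntegrable (fun t : ℝ => t ^ (θ - 1)) volume 0 c :=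
      intervalIntegral.intervalIntegrable_rpow' (by linarith)
    rw [h1, ← ofReal_integral_eq_lintegral_ofReal (f := fun t : ℝ => t ^ (θ - 1))
      ((intervalIntegrable_iff_integrableOn_Ioc_of_le c.coe_nonneg).1 hint)
      ((ae_restrict_mem measurableSet_Ioc).mono fun t ht => Real.rpow_nonneg ht.1.le _),
      ← intervalIntegral.integral_of_le c.coe_nonneg, integral_rpow (Or.inl (by linarith))]
    rw [sub_add_cancel, Real.zero_rpow hθ.ne', sub_zero, ENNReal.ofReal_div_of_pos hθ,
      ← ENNReal.ofReal_rpow_of_nonneg c.coe_nonneg hθ.le, ENNReal.ofReal_coe_nnreal]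
  rcases eq_or_ne c ∞ with rfl | hc
  · rw [ENNReal.top_rpow_of_pos hθ, ENNReal.top_div_of_ne_top ENNReal.ofReal_ne_top]
    refine ENNReal.eq_top_of_forall_nnreal_le fun r => ?_
    set c : ℝ≥0 := (r * θ.toNNReal) ^ θ⁻¹
    have h1 := key c
    have h2 : (c : ℝ≥0∞) ^ θ / ENNReal.ofReal θ = r := by
      rw [← ENNReal.coe_rpow_of_nonneg _ hθ.le, ← NNReal.rpow_mul, inv_mul_cancel₀ hθ.ne',
        NNReal.rpow_one, ENNReal.coe_mul, ENNReal.ofReal,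
        ENNReal.mul_div_cancel_right (by simpa using hθ) ENNReal.coe_ne_top]
    rw [← h2, ← h1]
    exact measure_mono fun t ht => lt_trans ht ENNReal.coe_lt_top
  · lift c to ℝ≥0 using hc
    exact key c

lemma lorentzNorm_rpow (μ : Measure X) {p q : ℝ} (hp : 0 < p) (hq : 0 < q) (f : X → ε) :
    lorentzNorm μ p q f ^ q =
      ENNReal.ofReal (q / p) * ∫⁻ t, rearrangement μ f t ^ q ∂powerMeasure (q / p) := by
  rw [lorentzNorm, ← ENNReal.rpow_mul, one_div_mul_cancel hq.ne', ENNReal.rpow_one]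
  congr 1
  rw [powerMeasure, lintegral_withDensity_eq_lintegral_mul _
    (ENNReal.measurable_ofReal.pow_const _) ((measurable_rearrangement μ f).pow_const _)]
  refine setLIntegral_congr_fun measurableSet_Ioi fun t ht => ?_
  have h0 : ENNReal.ofReal t ≠ 0 := by simpa using ht
  simp only [Pi.mul_apply]
  rw [ENNReal.mul_rpow_of_nonneg _ _ hq.le, ← ENNReal.rpow_mul, ENNReal.div_eq_inv_mul,
    ← ENNReal.rpow_neg_one, ← mul_assoc, ← ENNReal.rpow_add _ _ h0 ENNReal.ofReal_ne_top]
  congr 2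
  field_simp
  ring

lemma powerMeasure_lt_rearrangement (μ : Measure X) (f : X → ε) {θ : ℝ} (hθ : 0 < θ) (s : ℝ≥0∞) :
    powerMeasure θ {t | s < rearrangement μ f t} =
      distribution μ f s ^ θ / ENNReal.ofReal θ := by
  rw [← powerMeasure_lt hθ]
  simp only [lt_rearrangement_iff]

/-- The dyadic description of the Lorentz functional, upper bound. -/
lemma lorentzNorm_rpow_le_tsum (μ : Measure X) {p q : ℝ} (hp : 0 < p) (hq : 0 < q) (f : X → ε) :
    lorentzNorm μ p q f ^ q ≤
      2 ^ q * ∑' k : ℤ, 2 ^ (k * q) * distribution μ f (2 ^ (k : ℝ)) ^ (q / p) := by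
  have hθ : 0 < q / p := by positivity
  rw [lorentzNorm_rpow μ hp hq]
  refine (mul_le_mul_right (lintegral_rpow_le_tsum _ (measurable_rearrangement μ f) hq) _).trans ?_
  rw [mul_left_comm, ← ENNReal.tsum_mul_left]
  refine mul_le_mul_right (ENNReal.tsum_le_tsum fun k => ?_) _
  rw [powerMeasure_lt_rearrangement μ f hθ, mul_left_comm,
    ENNReal.mul_div_cancel (by simpa using hθ) ENNReal.ofReal_ne_top]

/-- The dyadic description of the Lorentz functional, lower bound. -/
lemma tsum_le_lorentzNorm_rpow (μ : Measure X) {p q : ℝ} (hp : 0 < p) (hq : 0 < q) (f : X → ε) :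
    ∑' k : ℤ, 2 ^ (k * q) * distribution μ f (2 ^ (k : ℝ)) ^ (q / p) ≤
      geomSum q * lorentzNorm μ p q f ^ q := by
  have hθ : 0 < q / p := by positivity
  rw [lorentzNorm_rpow μ hp hq, mul_left_comm]
  refine le_trans ?_ (mul_le_mul_right
    (tsum_le_lintegral_rpow _ (measurable_rearrangement μ f) hq) _)
  rw [← ENNReal.tsum_mul_left]
  refine ENNReal.tsum_le_tsum fun k => ?_
  rw [powerMeasure_lt_rearrangement μ f hθ, mul_left_comm,
    ENNReal.mul_div_cancel (by simpa using hθ) ENNReal.ofReal_ne_top]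

/-- The Lorentz functional of the characteristic function of `s` is `μ(s)^{1/p}`. -/
lemma lorentzNorm_indicator_one (μ : Measure X) {p q : ℝ} (hp : 0 < p) (hq : 0 < q) (s : Set X) :
    lorentzNorm μ p q (s.indicator fun _ => (1 : ℝ≥0∞)) = μ s ^ (1 / p) := by
  have hθ : 0 < q / p := by positivity
  have hd : ∀ u : ℝ≥0∞, distribution μ (s.indicator fun _ => (1 : ℝ≥0∞)) u =
      if u < 1 then μ s else 0 := by
    intro u
    unfold distribution
    split_ifs with hu
    · congr 1
      ext x
      by_cases hx : x ∈ s <;> simp [hx, hu]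
    · convert measure_empty (μ := μ)
      ext x
      by_cases hx : x ∈ s <;> simp [hx, not_lt.1 hu]
  have hr : ∀ t : ℝ, rearrangement μ (s.indicator fun _ => (1 : ℝ≥0∞)) t =
      {t : ℝ | ENNReal.ofReal t < μ s}.indicator (fun _ => (1 : ℝ≥0∞)) t := by
    intro t
    refine eq_of_forall_lt_iff fun u => ?_
    rw [lt_rearrangement_iff, hd]
    by_cases ht : ENNReal.ofReal t < μ s <;> by_cases hu : u < 1 <;> simp [ht, hu]
  have h1 : lorentzNorm μ p q (s.indicator fun _ => (1 : ℝ≥0∞)) ^ q = μ s ^ (q / p) := by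
    rw [lorentzNorm_rpow μ hp hq]
    simp only [hr]
    have : ∀ t : ℝ, ({t : ℝ | ENNReal.ofReal t < μ s}.indicator (fun _ => (1 : ℝ≥0∞)) t) ^ q =
        {t : ℝ | ENNReal.ofReal t < μ s}.indicator 1 t := by
      intro t
      by_cases ht : ENNReal.ofReal t < μ s <;> simp [ht, hq]
    simp only [this]
    rw [lintegral_indicator_one (measurableSet_lt ENNReal.measurable_ofReal measurable_const),
      powerMeasure_lt hθ, ENNReal.mul_div_cancel (by simpa using hθ) ENNReal.ofReal_ne_top]
  have h2 := congrArg (fun y : ℝ≥0∞ => y ^ (1 / q)) h1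
  simp only [← ENNReal.rpow_mul] at h2
  rw [mul_one_div_cancel hq.ne', ENNReal.rpow_one] at h2
  rw [h2]; congr 1; field_simp

end Rearrangement

/-- The Hardy–Littlewood inequality `∫_s h dμ ≤ C ∫_0^{μ(s)} h^*(t) dt`. -/
lemma setLIntegral_le_rearrangement {X : Type*} [MeasurableSpace X] (μ : Measure X)
    {h : X → ℝ≥0∞} (hh : Measurable h) (s : Set X) :
    ∫⁻ x in s, h x ∂μ ≤ 2 * geomSum 1 * ∫⁻ t in Ioi (0 : ℝ), rearrangement μ h t *
      {t | ENNReal.ofReal t < μ s}.indicator 1 t := by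
  have hm : MeasurableSet {t : ℝ | ENNReal.ofReal t < μ s} :=
    measurableSet_lt ENNReal.measurable_ofReal measurable_const
  have h1 := lintegral_rpow_le_tsum (μ.restrict s) hh one_pos
  have h2 := tsum_le_lintegral_rpow ((volume.restrict (Ioi 0)).restrict
    {t : ℝ | ENNReal.ofReal t < μ s}) (measurable_rearrangement μ h) one_pos
  simp only [ENNReal.rpow_one, mul_one] at h1 h2
  have h3 : ∫⁻ t in Ioi (0 : ℝ), rearrangement μ h t *
      {t | ENNReal.ofReal t < μ s}.indicator 1 t =
      ∫⁻ t, rearrangement μ h t ∂((volume.restrict (Ioi 0)).restrict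
        {t : ℝ | ENNReal.ofReal t < μ s}) := by
    rw [← lintegral_indicator hm]
    congr 1; ext t
    by_cases ht : t ∈ {t : ℝ | ENNReal.ofReal t < μ s} <;> simp [ht]
  rw [h3, mul_assoc]
  refine h1.trans (mul_le_mul_right (le_trans (ENNReal.tsum_le_tsum fun k => ?_) h2) _)
  gcongr
  -- Both sides are distribution functions: the left one is at most `min (d_h(2^k)) (μ s)`.
  have h4 : ∀ c : ℝ≥0∞, volume.restrict (Ioi 0) {t : ℝ | ENNReal.ofReal t < c} = c := by
    intro c
    have := powerMeasure_lt one_pos c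
    simpa [powerMeasure] using this
  have h5 : ((volume.restrict (Ioi 0)).restrict {t : ℝ | ENNReal.ofReal t < μ s})
      {x | (2 : ℝ≥0∞) ^ (k : ℝ) < rearrangement μ h x} =
      min (distribution μ h (2 ^ (k : ℝ))) (μ s) := by
    rw [Measure.restrict_apply' hm, ← h4 (min _ _)]
    congr 1
    ext t
    simp [lt_rearrangement_iff]
  rw [h5]
  refine le_min ?_ ?_
  · exact Measure.restrict_apply_le _ _
  · exact (measure_mono (subset_univ _)).trans (by simp)

/-- Hölder's inequality for the pairing of a rearrangement with a function on the half-line. -/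
lemma lintegral_rearrangement_mul_le {X : Type*} [MeasurableSpace X] (μ : Measure X)
    (h : X → ℝ≥0∞) {F : ℝ → ℝ≥0∞} (hF : Measurable F) {p q : ℝ} (hp : 1 < p) (hq : 1 < q) :
    ∫⁻ t in Ioi (0 : ℝ), rearrangement μ h t * F t ≤
      (ENNReal.ofReal (q.conjExponent / p.conjExponent))⁻¹ ^ (1 / q.conjExponent) *
        lorentzNorm μ p.conjExponent q.conjExponent h *
        (∫⁻ t, F t ^ q ∂powerMeasure (q / p)) ^ (1 / q) := by
  have hq' := Real.HolderConjugate.conjExponent hq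
  have hp' := Real.HolderConjugate.conjExponent hp
  set q' := q.conjExponent
  set p' := p.conjExponent
  have hR := measurable_rearrangement μ h
  have key := ENNReal.lintegral_mul_le_Lp_mul_Lq (volume.restrict (Ioi (0 : ℝ))) hq'.symm
    (f := fun t => rearrangement μ h t * ENNReal.ofReal t ^ (1 / p' - 1 / q'))
    (g := fun t => F t * ENNReal.ofReal t ^ (1 / p - 1 / q))
    (hR.mul (ENNReal.measurable_ofReal.pow_const _)).aemeasurable
    (hF.mul (ENNReal.measurable_ofReal.pow_const _)).aemeasurable
  have e0 : ∫⁻ t in Ioi (0 : ℝ), rearrangement μ h t * F t =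
      ∫⁻ t in Ioi (0 : ℝ), ((fun t => rearrangement μ h t * ENNReal.ofReal t ^ (1 / p' - 1 / q')) *
        fun t => F t * ENNReal.ofReal t ^ (1 / p - 1 / q)) t := by
    refine setLIntegral_congr_fun measurableSet_Ioi fun t ht => ?_
    have h0 : ENNReal.ofReal t ≠ 0 := by simpa using ht
    simp only [Pi.mul_apply]
    have : ENNReal.ofReal t ^ (1 / p' - 1 / q') * ENNReal.ofReal t ^ (1 / p - 1 / q) = 1 := by
      rw [← ENNReal.rpow_add _ _ h0 ENNReal.ofReal_ne_top]
      have h1 := hp'.inv_add_inv_eq_one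
      have h2 := hq'.inv_add_inv_eq_one
      have : 1 / p' - 1 / q' + (1 / p - 1 / q) = 0 := by
        simp only [one_div]; linarith
      rw [this, ENNReal.rpow_zero]
    rw [mul_mul_mul_comm, this, mul_one]
  have e1 : ∀ (G : ℝ → ℝ≥0∞), Measurable G → ∀ a b : ℝ, 0 < a → 0 < b →
      ∫⁻ t in Ioi (0 : ℝ), (G t * ENNReal.ofReal t ^ (1 / a - 1 / b)) ^ b =
        ∫⁻ t, G t ^ b ∂powerMeasure (b / a) := by
    intro G hG a b ha hb
    rw [powerMeasure, lintegral_withDensity_eq_lintegral_mul _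
      (ENNReal.measurable_ofReal.pow_const _) (hG.pow_const _)]
    congr 1; ext t
    simp only [Pi.mul_apply]
    rw [ENNReal.mul_rpow_of_nonneg _ _ hb.le, ← ENNReal.rpow_mul, mul_comm]
    congr 2; field_simp
  have hq0 : 0 < q := by linarith
  have hp0 : 0 < p := by linarith
  have hq0' : 0 < q' := hq'.symm.pos
  have hp0' : 0 < p' := hp'.symm.pos
  rw [e0]
  refine key.trans ?_
  rw [e1 _ hR _ _ hp0' hq0', e1 _ hF _ _ hp0 hq0]
  gcongr
  have h3 := lorentzNorm_rpow μ hp0' hq0' h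
  have hc : ENNReal.ofReal (q' / p') ≠ 0 := by
    simpa using div_pos hq0' hp0'
  have h4 : ∫⁻ t, rearrangement μ h t ^ q' ∂powerMeasure (q' / p') =
      (ENNReal.ofReal (q' / p'))⁻¹ * lorentzNorm μ p' q' h ^ q' := by
    rw [h3, ← mul_assoc, ENNReal.inv_mul_cancel hc ENNReal.ofReal_ne_top, one_mul]
  rw [h4, ENNReal.mul_rpow_of_nonneg _ _ (by positivity), ← ENNReal.rpow_mul,
    mul_one_div_cancel hq0'.ne', ENNReal.rpow_one]

variable {n : ℕ}

/-! ### Centred maximal functions with respect to a measure -/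

/-- The cube with centre `x` and half side length `2^k`, that is, the closed ball for the sup
norm. -/
def dyadicCube (x : Fin n → ℝ) (k : ℤ) : Set (Fin n → ℝ) := Metric.closedBall x ((2 : ℝ) ^ k)

/-- The centred maximal function with respect to the measure `μ`, over cubes of half side length
`2^k`, `k ∈ ℤ`. -/
noncomputable def dyadicMax (μ : Measure (Fin n → ℝ)) (f : (Fin n → ℝ) → ℝ≥0∞)
    (x : Fin n → ℝ) : ℝ≥0∞ :=
  ⨆ k : ℤ, (μ (dyadicCube x k))⁻¹ * ∫⁻ y in dyadicCube x k, f y ∂μ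

lemma measurableSet_dyadicCube (x : Fin n → ℝ) (k : ℤ) : MeasurableSet (dyadicCube x k) :=
  Metric.isClosed_closedBall.measurableSet

lemma measurable_measure_closedBall (μ : Measure (Fin n → ℝ)) [SFinite μ] (r : ℝ) :
    Measurable fun x => μ (Metric.closedBall x r) := by
  have hs : MeasurableSet {z : (Fin n → ℝ) × (Fin n → ℝ) | dist z.2 z.1 ≤ r} :=
    (isClosed_le (by fun_prop) continuous_const).measurableSet
  exact measurable_measure_prodMk_left hs

/-- Measurability in the centre holds for every `f`, measurable or not, because `μ.withDensity f`
is an s-finite measure in any case. -/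
lemma measurable_setLIntegral_closedBall (μ : Measure (Fin n → ℝ)) [SFinite μ]
    (f : (Fin n → ℝ) → ℝ≥0∞) (r : ℝ) :
    Measurable fun x => ∫⁻ y in Metric.closedBall x r, f y ∂μ := by
  have := measurable_measure_closedBall (μ.withDensity f) r
  simpa only [withDensity_apply f Metric.isClosed_closedBall.measurableSet] using this

lemma measurable_dyadicMax (μ : Measure (Fin n → ℝ)) [SFinite μ]
    (f : (Fin n → ℝ) → ℝ≥0∞) : Measurable (dyadicMax μ f) :=
  Measurable.iSup fun _ =>
    (measurable_measure_closedBall μ _).inv.mul (measurable_setLIntegral_closedBall μ f _)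

lemma dyadicMax_mono (μ : Measure (Fin n → ℝ)) {f g : (Fin n → ℝ) → ℝ≥0∞} (h : f ≤ᵐ[μ] g) :
    dyadicMax μ f ≤ dyadicMax μ g := fun _ =>
  iSup_mono fun _ => mul_le_mul_right (lintegral_mono_ae (ae_restrict_of_ae h)) _

lemma dyadicMax_congr (μ : Measure (Fin n → ℝ)) {f g : (Fin n → ℝ) → ℝ≥0∞} (h : f =ᵐ[μ] g) :
    dyadicMax μ f = dyadicMax μ g :=
  le_antisymm (dyadicMax_mono μ h.le) (dyadicMax_mono μ h.symm.le)

lemma dyadicMax_add_le (μ : Measure (Fin n → ℝ)) {f g : (Fin n → ℝ) → ℝ≥0∞} (hf : Measurable f)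
    (x : Fin n → ℝ) :
    dyadicMax μ (fun y => f y + g y) x ≤ dyadicMax μ f x + dyadicMax μ g x := by
  refine iSup_le fun k => ?_
  rw [lintegral_add_left hf, mul_add]
  exact add_le_add
    (le_iSup (fun k : ℤ => (μ (dyadicCube x k))⁻¹ * ∫⁻ y in dyadicCube x k, f y ∂μ) k)
    (le_iSup (fun k : ℤ => (μ (dyadicCube x k))⁻¹ * ∫⁻ y in dyadicCube x k, g y ∂μ) k)

lemma dyadicMax_tsum_le (μ : Measure (Fin n → ℝ)) {f : ℕ → (Fin n → ℝ) → ℝ≥0∞}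
    (hf : ∀ j, Measurable (f j)) (x : Fin n → ℝ) :
    dyadicMax μ (fun y => ∑' j, f j y) x ≤ ∑' j, dyadicMax μ (f j) x := by
  refine iSup_le fun k => ?_
  rw [lintegral_tsum fun j => (hf j).aemeasurable, ← ENNReal.tsum_mul_left]
  exact ENNReal.tsum_le_tsum fun j =>
    le_iSup (fun k : ℤ => (μ (dyadicCube x k))⁻¹ * ∫⁻ y in dyadicCube x k, f j y ∂μ) k

lemma dyadicMax_const_mul (μ : Measure (Fin n → ℝ)) {f : (Fin n → ℝ) → ℝ≥0∞}
    (hf : Measurable f) (c : ℝ≥0∞) (x : Fin n → ℝ) :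
    dyadicMax μ (fun y => c * f y) x = c * dyadicMax μ f x := by
  unfold dyadicMax
  rw [ENNReal.mul_iSup]
  congr 1; ext k
  rw [lintegral_const_mul _ hf, mul_left_comm]

lemma dyadicMax_const_le (μ : Measure (Fin n → ℝ)) (c : ℝ≥0∞) (x : Fin n → ℝ) :
    dyadicMax μ (fun _ => c) x ≤ c := by
  refine iSup_le fun k => ?_
  rw [setLIntegral_const, mul_left_comm]
  calc c * ((μ (dyadicCube x k))⁻¹ * μ (dyadicCube x k)) ≤ c * 1 := by
        gcongr; exact ENNReal.inv_mul_le_one _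
    _ = c := mul_one c

/-- The covering theorem of Besicovitch for cubes: the centres in a set `A` can be covered by
selected cubes whose overlap is bounded by a dimensional constant. The overlap is expressed by
comparing the sum of the measures with the measure of the union. -/
lemma exists_besicovitch (n : ℕ) : ∃ N : ℕ, ∀ (A : Set (Fin n → ℝ)) (k : (Fin n → ℝ) → ℤ) (K : ℤ),
    (∀ x ∈ A, k x ≤ K) → ∃ t : Set (Fin n → ℝ), t ⊆ A ∧ t.Countable ∧
      A ⊆ ⋃ x ∈ t, dyadicCube x (k x) ∧
      ∀ μ : Measure (Fin n → ℝ), ∑' x : t, μ (dyadicCube x (k x)) ≤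
        N * μ (⋃ x ∈ t, dyadicCube x (k x)) := by
  obtain ⟨N, τ, hτ, hN⟩ :=
    HasBesicovitchCovering.no_satelliteConfig (α := Fin n → ℝ)
  refine ⟨N, fun A k K hK => ?_⟩
  let q : Besicovitch.BallPackage A (Fin n → ℝ) :=
    { c := fun x => x
      r := fun x => (2 : ℝ) ^ k x
      rpos := fun x => by positivity
      r_bound := (2 : ℝ) ^ K
      r_le := fun x => zpow_le_zpow_right₀ (by norm_num) (hK x x.2) }
  obtain ⟨s, hs1, hs2⟩ := Besicovitch.exist_disjoint_covering_families hτ hN q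
  have hd : ∀ i, ((fun x : A => (x : Fin n → ℝ)) '' s i).PairwiseDisjoint
      fun x => dyadicCube x (k x) := by
    rintro i _ ⟨x, hx, rfl⟩ _ ⟨y, hy, rfl⟩ hne
    exact hs1 i hx hy fun h => hne (by rw [h])
  have hc : ∀ i, ((fun x : A => (x : Fin n → ℝ)) '' s i).Countable := fun i =>
    (hd i).countable_of_nonempty_interior fun x _ => by
      refine ⟨x, interior_mono Metric.ball_subset_closedBall ?_⟩
      rw [Metric.isOpen_ball.interior_eq]
      exact Metric.mem_ball_self (by positivity)
  refine ⟨⋃ i, (fun x : A => (x : Fin n → ℝ)) '' s i, ?_, countable_iUnion hc, ?_, ?_⟩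
  · refine iUnion_subset fun i => ?_
    rintro _ ⟨x, _, rfl⟩
    exact x.2
  · intro x hx
    have := hs2 ⟨⟨x, hx⟩, rfl⟩
    simp only [mem_iUnion] at this
    obtain ⟨i, j, hj, hxj⟩ := this
    simp only [mem_iUnion]
    exact ⟨j, ⟨i, j, hj, rfl⟩, Metric.ball_subset_closedBall hxj⟩
  · intro μ
    refine (ENNReal.tsum_iUnion_le (fun x : Fin n → ℝ => μ (dyadicCube x (k x))) _).trans ?_
    calc ∑ i, ∑' x : ((fun x : A => (x : Fin n → ℝ)) '' s i), μ (dyadicCube x (k x))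
        ≤ ∑ _i : Fin N, μ (⋃ x ∈ ⋃ i, (fun x : A => (x : Fin n → ℝ)) '' s i,
            dyadicCube x (k x)) := by
          refine Finset.sum_le_sum fun i _ => ?_
          rw [← measure_biUnion (hc i) (hd i) fun x _ => measurableSet_dyadicCube _ _]
          refine measure_mono (biUnion_subset_biUnion_left ?_)
          exact subset_iUnion (fun i => (fun x : A => (x : Fin n → ℝ)) '' s i) i
      _ = _ := by simp

/-- The overlap constant of Besicovitch's covering theorem in dimension `n`. -/
noncomputable def besicovitchConst (n : ℕ) : ℕ := (exists_besicovitch n).choose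

lemma besicovitchConst_spec (A : Set (Fin n → ℝ)) (k : (Fin n → ℝ) → ℤ) (K : ℤ)
    (hK : ∀ x ∈ A, k x ≤ K) : ∃ t : Set (Fin n → ℝ), t ⊆ A ∧ t.Countable ∧
      A ⊆ ⋃ x ∈ t, dyadicCube x (k x) ∧
      ∀ μ : Measure (Fin n → ℝ), ∑' x : t, μ (dyadicCube x (k x)) ≤
        besicovitchConst n * μ (⋃ x ∈ t, dyadicCube x (k x)) :=
  (exists_besicovitch n).choose_spec A k K hK

/-- The weak type `(1,1)` inequality for the centred maximal function, valid for every measure. -/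
lemma measure_lt_dyadicMax_le (μ : Measure (Fin n → ℝ)) (f : (Fin n → ℝ) → ℝ≥0∞) {c : ℝ≥0∞}
    (hc : c ≠ 0) (hc' : c ≠ ∞) :
    μ {x | c < dyadicMax μ f x} ≤ besicovitchConst n * (c⁻¹ * ∫⁻ x, f x ∂μ) := by
  set A : ℕ → Set (Fin n → ℝ) := fun K =>
    {x | ∃ k : ℤ, k ≤ K ∧ c < (μ (dyadicCube x k))⁻¹ * ∫⁻ y in dyadicCube x k, f y ∂μ} with hA
  have hU : {x | c < dyadicMax μ f x} = ⋃ K, A K := by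
    ext x
    simp only [mem_ofPred_eq, mem_iUnion, hA, dyadicMax, lt_iSup_iff]
    constructor
    · rintro ⟨k, hk⟩
      exact ⟨k.toNat, k, Int.self_le_toNat k, hk⟩
    · rintro ⟨_, k, _, hk⟩
      exact ⟨k, hk⟩
  have hmono : Monotone A := fun a b hab x ⟨k, h1, h2⟩ =>
    ⟨k, h1.trans (by exact_mod_cast hab), h2⟩
  rw [hU, hmono.measure_iUnion]
  refine iSup_le fun K => ?_
  have hch : ∀ x : Fin n → ℝ, ∃ k : ℤ, x ∈ A K →
      k ≤ K ∧ c < (μ (dyadicCube x k))⁻¹ * ∫⁻ y in dyadicCube x k, f y ∂μ := by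
    intro x
    by_cases hx : x ∈ A K
    · obtain ⟨k, hk⟩ := hx
      exact ⟨k, fun _ => hk⟩
    · exact ⟨0, fun h => absurd h hx⟩
  choose k hk using hch
  obtain ⟨t, ht1, ht2, ht3, ht4⟩ := besicovitchConst_spec (A K) k K fun x hx => (hk x hx).1
  have hle : ∀ x ∈ A K, μ (dyadicCube x (k x)) ≤ c⁻¹ * ∫⁻ y in dyadicCube x (k x), f y ∂μ := by
    intro x hx
    have h := (hk x hx).2
    rw [← ENNReal.div_eq_inv_mul] at h ⊢
    rcases eq_or_ne (μ (dyadicCube x (k x))) 0 with h0 | h0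
    · rw [h0]; exact zero_le
    rcases eq_or_ne (μ (dyadicCube x (k x))) ∞ with h1 | h1
    · rw [h1] at h; simp at h
    rw [ENNReal.le_div_iff_mul_le (Or.inl hc) (Or.inl hc'), mul_comm]
    exact ((ENNReal.lt_div_iff_mul_lt (Or.inl h0) (Or.inl h1)).1 h).le
  calc μ (A K) ≤ μ (⋃ x ∈ t, dyadicCube x (k x)) := measure_mono ht3
    _ ≤ ∑' x : t, μ (dyadicCube x (k x)) := measure_biUnion_le μ ht2 _
    _ ≤ ∑' x : t, c⁻¹ * (μ.withDensity f) (dyadicCube x (k x)) := by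
        refine ENNReal.tsum_le_tsum fun x => ?_
        rw [withDensity_apply f (measurableSet_dyadicCube _ _)]
        exact hle x (ht1 x.2)
    _ = c⁻¹ * ∑' x : t, (μ.withDensity f) (dyadicCube x (k x)) := ENNReal.tsum_mul_left
    _ ≤ c⁻¹ * (besicovitchConst n * (μ.withDensity f) univ) := by
        gcongr
        exact (ht4 _).trans (by gcongr; exact subset_univ _)
    _ = besicovitchConst n * (c⁻¹ * ∫⁻ x, f x ∂μ) := by
        rw [withDensity_apply _ MeasurableSet.univ, Measure.restrict_univ, mul_left_comm]

/-- The constant in the strong type `(α, α)` inequality for centred maximal functions. -/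
noncomputable def strongConst (n : ℕ) (α : ℝ) : ℝ≥0∞ :=
  2 ^ (2 * α) * (besicovitchConst n * geomSum (α - 1))

lemma strongConst_ne_top (n : ℕ) {α : ℝ} (hα : 1 < α) : strongConst n α ≠ ∞ :=
  ENNReal.mul_ne_top (two_rpow_ne_top _)
    (ENNReal.mul_ne_top (ENNReal.natCast_ne_top _) (geomSum_ne_top (by linarith)))

/-- The strong type `(α, α)` inequality, by interpolation between the weak type `(1,1)` inequality
and the trivial bound on `L^∞`. The constant does not depend on the measure. -/
lemma lintegral_dyadicMax_rpow_le (μ : Measure (Fin n → ℝ)) [SFinite μ]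
    {f : (Fin n → ℝ) → ℝ≥0∞} (hf : Measurable f) {α : ℝ} (hα : 1 < α) :
    ∫⁻ x, dyadicMax μ f x ^ α ∂μ ≤ strongConst n α * ∫⁻ x, f x ^ α ∂μ := by
  have hα0 : 0 < α := by linarith
  refine (lintegral_rpow_le_tsum μ (measurable_dyadicMax μ f) hα0).trans ?_
  have hg : ∀ k : ℤ, Measurable fun x =>
      (Ioi ((2 : ℝ≥0∞) ^ (k : ℝ))).indicator (fun y => y) (f x) := fun k =>
    (measurable_id.indicator measurableSet_Ioi).comp hf
  have hlev : ∀ k : ℤ, μ {x | (2 : ℝ≥0∞) ^ (((k + 1 : ℤ) : ℝ)) < dyadicMax μ f x} ≤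
      besicovitchConst n * ((2 : ℝ≥0∞) ^ (-(k : ℝ)) *
        ∫⁻ x, (Ioi ((2 : ℝ≥0∞) ^ (k : ℝ))).indicator (fun y => y) (f x) ∂μ) := by
    intro k
    rw [ENNReal.rpow_neg]
    refine le_trans (measure_mono fun x hx => ?_)
      (measure_lt_dyadicMax_le μ _ (two_rpow_ne_zero k) (two_rpow_ne_top k))
    have h1 : f ≤ fun x => (Ioi ((2 : ℝ≥0∞) ^ (k : ℝ))).indicator (fun y => y) (f x) +
        2 ^ (k : ℝ) := by
      intro x
      by_cases h : f x ∈ Ioi ((2 : ℝ≥0∞) ^ (k : ℝ))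
      · simp only [indicator_of_mem h]; exact le_self_add
      · simp only [indicator_of_notMem h, zero_add]; exact not_lt.1 h
    have h2 := (dyadicMax_mono μ (Filter.Eventually.of_forall h1) x).trans
      (dyadicMax_add_le μ (hg k) x)
    have h3 := dyadicMax_const_le μ (2 ^ (k : ℝ)) x
    have hx' : (2 : ℝ≥0∞) ^ (((k + 1 : ℤ) : ℝ)) < dyadicMax μ f x := hx
    have h4 := hx'.trans_le (h2.trans (add_le_add_right h3 _))
    push_cast at h4
    rw [two_rpow_add, ENNReal.rpow_one, mul_two] at h4
    exact (ENNReal.add_lt_add_iff_right (two_rpow_ne_top _)).1 h4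
  rw [← (Equiv.addRight (1 : ℤ)).tsum_eq]
  calc 2 ^ α * ∑' k : ℤ, 2 ^ (((Equiv.addRight (1 : ℤ)) k : ℝ) * α) *
        μ {x | (2 : ℝ≥0∞) ^ (((Equiv.addRight (1 : ℤ)) k : ℝ)) < dyadicMax μ f x}
      ≤ 2 ^ α * ∑' k : ℤ, 2 ^ α * (besicovitchConst n *
        ∫⁻ x, f x * dyadicTerm (α - 1) k (f x) ∂μ) := by
        refine mul_le_mul_right (ENNReal.tsum_le_tsum fun k => ?_) _
        refine (mul_le_mul_right (hlev k) _).trans_eq ?_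
        have h5 : ∫⁻ x, f x * dyadicTerm (α - 1) k (f x) ∂μ = 2 ^ (k * (α - 1)) *
            ∫⁻ x, (Ioi ((2 : ℝ≥0∞) ^ (k : ℝ))).indicator (fun y => y) (f x) ∂μ := by
          rw [← lintegral_const_mul _ (hg k)]
          congr 1; ext x
          by_cases h : f x ∈ Ioi ((2 : ℝ≥0∞) ^ (k : ℝ))
          · rw [dyadicTerm_of_lt h, indicator_of_mem h, mul_comm]
          · rw [dyadicTerm_of_le (not_lt.1 h), indicator_of_notMem h]; simp
        have h6 : (2 : ℝ≥0∞) ^ (((Equiv.addRight (1 : ℤ)) k : ℝ) * α) =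
            2 ^ α * (2 ^ (k * (α - 1)) * 2 ^ (k : ℝ)) := by
          rw [← two_rpow_add, ← two_rpow_add]
          congr 1
          simp; ring
        have h7 : (2 : ℝ≥0∞) ^ (k : ℝ) * 2 ^ (-(k : ℝ)) = 1 := by
          rw [← two_rpow_add]; simp
        rw [h5, h6]
        calc _ = 2 ^ α * (besicovitchConst n * (2 ^ (k * (α - 1)) *
              ∫⁻ x, (Ioi ((2 : ℝ≥0∞) ^ (k : ℝ))).indicator (fun y => y) (f x) ∂μ)) *
              ((2 : ℝ≥0∞) ^ (k : ℝ) * 2 ^ (-(k : ℝ))) := by ring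
          _ = _ := by rw [h7, mul_one]
    _ = 2 ^ (2 * α) * (besicovitchConst n *
        ∫⁻ x, f x * ∑' k : ℤ, dyadicTerm (α - 1) k (f x) ∂μ) := by
        simp only [← ENNReal.tsum_mul_left]
        rw [lintegral_tsum (f := fun (k : ℤ) x => f x * dyadicTerm (α - 1) k (f x)) fun k =>
          (hf.mul ((measurable_dyadicTerm _ k).comp hf)).aemeasurable]
        simp only [← ENNReal.tsum_mul_left]
        congr 1; ext k
        rw [← mul_assoc, ← two_rpow_add, two_mul]
    _ ≤ 2 ^ (2 * α) * (besicovitchConst n *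
        ∫⁻ x, geomSum (α - 1) * f x ^ α ∂μ) := by
        refine mul_le_mul_right (mul_le_mul_right (lintegral_mono fun x => ?_) _) _
        refine (mul_le_mul_right (tsum_dyadicTerm_le (by linarith) (f x)) _).trans_eq ?_
        have : f x ^ α = f x * f x ^ (α - 1) := by
          conv_rhs => enter [1]; rw [← ENNReal.rpow_one (f x)]
          rw [← ENNReal.rpow_add_of_nonneg _ _ zero_le_one (by linarith), add_sub_cancel]
        rw [this, mul_left_comm]
    _ = _ := by
        rw [lintegral_const_mul _ (hf.pow_const _), strongConst]
        ring

/-! ### Geometry of dyadic cubes -/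

lemma volume_dyadicCube (x : Fin n → ℝ) (k : ℤ) :
    volume (dyadicCube x k) = ENNReal.ofReal ((2 * (2 : ℝ) ^ k) ^ n) := by
  rw [dyadicCube, Real.volume_pi_closedBall _ (by positivity), Fintype.card_fin]

lemma volume_dyadicCube_ne_zero (x : Fin n → ℝ) (k : ℤ) : volume (dyadicCube x k) ≠ 0 := by
  rw [volume_dyadicCube]
  have : (0 : ℝ) < (2 * (2 : ℝ) ^ k) ^ n := by positivity
  simpa using this

lemma volume_dyadicCube_ne_top (x : Fin n → ℝ) (k : ℤ) : volume (dyadicCube x k) ≠ ∞ := by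
  rw [volume_dyadicCube]; exact ENNReal.ofReal_ne_top

lemma volume_dyadicCube_add_one (x y : Fin n → ℝ) (k : ℤ) :
    volume (dyadicCube x (k + 1)) = 2 ^ n * volume (dyadicCube y k) := by
  rw [volume_dyadicCube, volume_dyadicCube, zpow_add_one₀ (by norm_num), ← mul_assoc,
    mul_pow, ENNReal.ofReal_mul (by positivity), mul_comm, ENNReal.ofReal_pow (by norm_num)]
  norm_num

lemma volume_dyadicCube_eq (x y : Fin n → ℝ) (k : ℤ) :
    volume (dyadicCube x k) = volume (dyadicCube y k) := by
  rw [volume_dyadicCube, volume_dyadicCube]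

lemma dyadicCube_subset_of_dist_le {x y : Fin n → ℝ} {j k l : ℤ} (hxy : dist x y ≤ 2 ^ k)
    (hj : j < l) (hk : k < l) : dyadicCube x j ⊆ dyadicCube y l := by
  refine Metric.closedBall_subset_closedBall' ?_
  have h1 : (2 : ℝ) ^ j ≤ 2 ^ (l - 1) := zpow_le_zpow_right₀ (by norm_num) (by omega)
  have h2 : (2 : ℝ) ^ k ≤ 2 ^ (l - 1) := zpow_le_zpow_right₀ (by norm_num) (by omega)
  have h3 : (2 : ℝ) ^ l = 2 ^ (l - 1) + 2 ^ (l - 1) := by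
    rw [← two_mul, ← zpow_one_add₀ (by norm_num)]; congr 1; ring
  linarith

lemma dyadicCube_mono (x : Fin n → ℝ) {j k : ℤ} (h : j ≤ k) : dyadicCube x j ⊆ dyadicCube x k :=
  Metric.closedBall_subset_closedBall (zpow_le_zpow_right₀ (by norm_num) h)

lemma setLIntegral_dyadicCube_le (μ : Measure (Fin n → ℝ)) (f : (Fin n → ℝ) → ℝ≥0∞)
    (x : Fin n → ℝ) (k : ℤ) (h : μ (dyadicCube x k) ≠ ∞) :
    ∫⁻ y in dyadicCube x k, f y ∂μ ≤ μ (dyadicCube x k) * dyadicMax μ f x := by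
  have h1 : (μ (dyadicCube x k))⁻¹ * ∫⁻ y in dyadicCube x k, f y ∂μ ≤ dyadicMax μ f x :=
    le_iSup (fun k : ℤ => (μ (dyadicCube x k))⁻¹ * ∫⁻ y in dyadicCube x k, f y ∂μ) k
  rcases eq_or_ne (μ (dyadicCube x k)) 0 with h0 | h0
  · rw [setLIntegral_measure_zero _ _ h0]; exact zero_le
  calc ∫⁻ y in dyadicCube x k, f y ∂μ = μ (dyadicCube x k) *
        ((μ (dyadicCube x k))⁻¹ * ∫⁻ y in dyadicCube x k, f y ∂μ) := by
        rw [← mul_assoc, ENNReal.mul_inv_cancel h0 h, one_mul]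
    _ ≤ _ := by gcongr

/-! ### Muckenhoupt weights and the weighted maximal inequality -/

/-- A Muckenhoupt weight `w` with its dual weight `σ = w^{1-v}`, where `v` is the exponent conjugate
to `u`: the condition `A_u` reads `w(Q)^{1/u} σ(Q)^{1/v} ≤ K |Q|`, which is symmetric in the
pair. -/
structure IsMuckenhouptPair (u v : ℝ) (K : ℝ≥0∞) (w σ : (Fin n → ℝ) → ℝ≥0∞) : Prop where
  measurable_left : Measurable w
  measurable_right : Measurable σ
  pos : ∀ᵐ x, w x ≠ 0
  lt_top : ∀ᵐ x, w x ≠ ∞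
  dual : ∀ᵐ x, σ x = w x ^ (1 - v)
  bound : ∀ (x : Fin n → ℝ) (k : ℤ), (∫⁻ y in dyadicCube x k, w y) ^ (1 / u) *
    (∫⁻ y in dyadicCube x k, σ y) ^ (1 / v) ≤ K * volume (dyadicCube x k)

lemma IsMuckenhouptPair.symm {u v : ℝ} {K : ℝ≥0∞} {w σ : (Fin n → ℝ) → ℝ≥0∞}
    (h : IsMuckenhouptPair u v K w σ) (huv : u.HolderConjugate v) :
    IsMuckenhouptPair v u K σ w where
  measurable_left := h.measurable_right
  measurable_right := h.measurable_left
  pos := by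
    filter_upwards [h.pos, h.lt_top, h.dual] with x h1 h2 h3
    rw [h3]; exact (ENNReal.rpow_pos (pos_iff_ne_zero.2 h1) h2).ne'
  lt_top := by
    filter_upwards [h.pos, h.lt_top, h.dual] with x h1 h2 h3
    rw [h3]; exact ENNReal.rpow_ne_top_of_ne_zero h1 h2
  dual := by
    filter_upwards [h.dual] with x h3
    have h4 := huv.sub_one_mul_conj
    have h5 : (1 - v) * (1 - u) = 1 := by
      have := huv.mul_eq_add
      nlinarith
    rw [h3, ← ENNReal.rpow_mul, h5, ENNReal.rpow_one]
  bound x k := by rw [mul_comm]; exact h.bound x k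

lemma setLIntegral_dyadicCube_ne_zero {w : (Fin n → ℝ) → ℝ≥0∞} (hw : Measurable w)
    (hpos : ∀ᵐ x, w x ≠ 0) (x : Fin n → ℝ) (k : ℤ) : ∫⁻ y in dyadicCube x k, w y ≠ 0 := by
  intro h
  rw [lintegral_eq_zero_iff hw] at h
  have h1 : ∀ᵐ y ∂volume.restrict (dyadicCube x k), False := by
    filter_upwards [h, ae_restrict_of_ae hpos] with y h2 h3
    exact h3 h2
  rw [ae_iff] at h1
  simp only [not_false_eq_true, ofPred_true, Measure.restrict_apply MeasurableSet.univ,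
    univ_inter] at h1
  exact volume_dyadicCube_ne_zero x k h1

lemma IsMuckenhouptPair.lintegral_right_ne_top {u v : ℝ} {K : ℝ≥0∞} {w σ : (Fin n → ℝ) → ℝ≥0∞}
    (h : IsMuckenhouptPair u v K w σ) (huv : u.HolderConjugate v) (hK : K ≠ ∞)
    (x : Fin n → ℝ) (k : ℤ) : ∫⁻ y in dyadicCube x k, σ y ≠ ∞ := by
  intro htop
  have h1 := h.bound x k
  have h2 := setLIntegral_dyadicCube_ne_zero h.measurable_left h.pos x k
  rw [htop, ENNReal.top_rpow_of_pos huv.symm.one_div_pos, ENNReal.mul_top, top_le_iff] at h1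
  · exact ENNReal.mul_ne_top hK (volume_dyadicCube_ne_top x k) h1
  · rw [Ne, ENNReal.rpow_eq_zero_iff]
    rintro (⟨h3, _⟩ | ⟨_, h3⟩)
    · exact h2 h3
    · linarith [huv.one_div_pos]

/-- The constant in the weighted maximal inequality; it depends on the weight only through its
Muckenhoupt constant `K`. -/
noncomputable def weightedConst (n : ℕ) (u v : ℝ) (K : ℝ≥0∞) : ℝ≥0∞ :=
  (K ^ u * (4 ^ n) ^ u) ^ v * (strongConst n v * strongConst n u)

lemma weightedConst_ne_top (n : ℕ) {u v : ℝ} {K : ℝ≥0∞} (huv : u.HolderConjugate v) (hK : K ≠ ∞) :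
    weightedConst n u v K ≠ ∞ := by
  refine ENNReal.mul_ne_top (ENNReal.rpow_ne_top_of_nonneg huv.symm.nonneg (ENNReal.mul_ne_top
    (ENNReal.rpow_ne_top_of_nonneg huv.nonneg hK)
    (ENNReal.rpow_ne_top_of_nonneg huv.nonneg (by simp))))
    (ENNReal.mul_ne_top (strongConst_ne_top n huv.symm.lt) (strongConst_ne_top n huv.lt))

/-- The pointwise estimate of Lerner: a power of the maximal function is controlled by the
composition of the centred maximal functions with respect to `w` and `σ`. -/
lemma IsMuckenhouptPair.dyadicMax_rpow_le {u v : ℝ} {K : ℝ≥0∞} {w σ : (Fin n → ℝ) → ℝ≥0∞}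
    (h : IsMuckenhouptPair u v K w σ) (huv : u.HolderConjugate v) (hK : K ≠ ∞)
    {g : (Fin n → ℝ) → ℝ≥0∞} (hg : Measurable g) (x : Fin n → ℝ) :
    dyadicMax volume (fun y => g y * σ y) x ^ u ≤ ((K ^ u * (4 ^ n) ^ u) *
      dyadicMax (volume.withDensity w)
        (fun y => dyadicMax (volume.withDensity σ) g y ^ (u - 1) * (w y)⁻¹) x) ^ v := by
  have hu1 : 0 < u - 1 := huv.sub_one_pos
  set m := dyadicMax (volume.withDensity σ) g with hm
  have hmm : Measurable m := measurable_dyadicMax _ _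
  have hwd : ∀ (ρ f : (Fin n → ℝ) → ℝ≥0∞), Measurable ρ → Measurable f → ∀ s, MeasurableSet s →
      ∫⁻ y in s, f y ∂volume.withDensity ρ = ∫⁻ y in s, ρ y * f y := by
    intro ρ f hρ hf s hs
    rw [restrict_withDensity hs, lintegral_withDensity_eq_lintegral_mul _ hρ hf]
    rfl
  suffices hsuff : dyadicMax volume (fun y => g y * σ y) x ≤ ((K ^ u * (4 ^ n) ^ u) *
      dyadicMax (volume.withDensity w) (fun y => m y ^ (u - 1) * (w y)⁻¹) x) ^ (1 / (u - 1)) by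
    refine (ENNReal.rpow_le_rpow hsuff huv.nonneg).trans_eq ?_
    rw [← ENNReal.rpow_mul, huv.conjugate_eq]
    congr 1; ring
  refine iSup_le fun k => ?_
  rw [one_div, ENNReal.le_rpow_inv_iff hu1]
  have hw := h.measurable_left
  have hσ := h.measurable_right
  set V := volume (dyadicCube x k) with hV
  have hV0 : V ≠ 0 := volume_dyadicCube_ne_zero x k
  have hVt : V ≠ ∞ := volume_dyadicCube_ne_top x k
  set S := ∫⁻ y in dyadicCube x (k + 2), σ y with hS
  set W := ∫⁻ y in dyadicCube x k, w y with hW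
  set I := ∫⁻ y in dyadicCube x k, g y * σ y with hI
  set J := ∫⁻ y in dyadicCube x k, m y ^ (u - 1) with hJ
  set M := dyadicMax (volume.withDensity w) (fun y => m y ^ (u - 1) * (w y)⁻¹) x with hM
  -- For `y` in the cube `Q`, compare `Q` with the cube about `y` of twice the side length.
  have hA : ∀ y ∈ dyadicCube x k, I ≤ S * m y := by
    intro y hy
    have h1 : dyadicCube x k ⊆ dyadicCube y (k + 1) := dyadicCube_subset_of_dist_le
      (k := k) (by rw [dist_comm]; exact hy) (by omega) (by omega)
    have h2 : dyadicCube y (k + 1) ⊆ dyadicCube x (k + 2) :=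
      dyadicCube_subset_of_dist_le (k := k) hy (by omega) (by omega)
    have h3 : (volume.withDensity σ) (dyadicCube y (k + 1)) ≤ S := by
      rw [withDensity_apply _ (measurableSet_dyadicCube _ _)]
      exact lintegral_mono_set h2
    calc I ≤ ∫⁻ z in dyadicCube y (k + 1), σ z * g z := by
          simp only [hI, mul_comm (g _)]
          exact lintegral_mono_set h1
      _ = ∫⁻ z in dyadicCube y (k + 1), g z ∂volume.withDensity σ :=
          (hwd _ _ hσ hg _ (measurableSet_dyadicCube _ _)).symm
      _ ≤ _ := setLIntegral_dyadicCube_le _ _ _ _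
          (ne_top_of_le_ne_top (h.lintegral_right_ne_top huv hK x (k + 2)) h3)
      _ ≤ S * m y := by gcongr
  have hB : I ^ (u - 1) * V ≤ S ^ (u - 1) * J := by
    calc I ^ (u - 1) * V = ∫⁻ _ in dyadicCube x k, I ^ (u - 1) := (setLIntegral_const _ _).symm
      _ ≤ ∫⁻ y in dyadicCube x k, S ^ (u - 1) * m y ^ (u - 1) := by
          refine setLIntegral_mono' (measurableSet_dyadicCube _ _) fun y hy => ?_
          rw [← ENNReal.mul_rpow_of_nonneg _ _ hu1.le]
          exact ENNReal.rpow_le_rpow (hA y hy) hu1.le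
      _ = _ := lintegral_const_mul _ (hmm.pow_const _)
  -- The Muckenhoupt condition on the cube of four times the side length, raised to the power `u`.
  have hC : W * S ^ (u - 1) ≤ K ^ u * (4 ^ n) ^ u * V ^ u := by
    have h1 := ENNReal.rpow_le_rpow (h.bound x (k + 2)) huv.nonneg
    have h2 : volume (dyadicCube x (k + 2)) = 4 ^ n * V := by
      rw [show k + 2 = (k + 1) + 1 by ring, volume_dyadicCube_add_one x x,
        volume_dyadicCube_add_one x x, ← mul_assoc, ← mul_pow, hV]
      norm_num
    rw [h2, ENNReal.mul_rpow_of_nonneg _ _ huv.nonneg, ENNReal.mul_rpow_of_nonneg _ _ huv.nonneg,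
      ENNReal.mul_rpow_of_nonneg _ _ huv.nonneg, ← ENNReal.rpow_mul, ← ENNReal.rpow_mul,
      one_div_mul_cancel huv.ne_zero, ENNReal.rpow_one, one_div_mul_eq_div,
      huv.div_conj_eq_sub_one, ← mul_assoc] at h1
    refine le_trans ?_ h1
    gcongr
    exact lintegral_mono_set (dyadicCube_mono x (by omega))
  have hD : J ≤ W * M := by
    have h1 : (volume.withDensity w) (dyadicCube x k) = W :=
      withDensity_apply _ (measurableSet_dyadicCube _ _)
    have h2 := setLIntegral_dyadicCube_le (volume.withDensity w)
      (fun y => m y ^ (u - 1) * (w y)⁻¹) x k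
      (by rw [h1]; exact (h.symm huv).lintegral_right_ne_top huv.symm hK x k)
    rw [h1, hwd _ (fun y => m y ^ (u - 1) * (w y)⁻¹) hw ((hmm.pow_const _).mul hw.inv) _
      (measurableSet_dyadicCube _ _)] at h2
    refine le_trans (le_of_eq ?_) h2
    refine lintegral_congr_ae (ae_restrict_of_ae ?_)
    filter_upwards [h.pos, h.lt_top] with y h3 h4
    rw [mul_left_comm, ENNReal.mul_inv_cancel h3 h4, mul_one]
  have hE : I ^ (u - 1) * V ≤ K ^ u * (4 ^ n) ^ u * M * V ^ u := by
    calc I ^ (u - 1) * V ≤ S ^ (u - 1) * (W * M) := hB.trans (by gcongr)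
      _ = W * S ^ (u - 1) * M := by ring
      _ ≤ K ^ u * (4 ^ n) ^ u * V ^ u * M := by gcongr
      _ = _ := by ring
  have hVu : V ^ (u - 1) * V = V ^ u := by
    conv_rhs => rw [← sub_add_cancel u 1, ENNReal.rpow_add _ _ hV0 hVt, ENNReal.rpow_one]
  have hVu0 : V ^ u ≠ 0 := (ENNReal.rpow_pos (pos_iff_ne_zero.2 hV0) hVt).ne'
  have hVut : V ^ u ≠ ∞ := ENNReal.rpow_ne_top_of_ne_zero hV0 hVt
  refine (ENNReal.mul_le_mul_iff_left hVu0 hVut).1 (le_trans (le_of_eq ?_) hE)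
  rw [ENNReal.mul_rpow_of_nonneg _ _ hu1.le, ← hVu, ENNReal.inv_rpow]
  calc _ = ((V ^ (u - 1))⁻¹ * V ^ (u - 1)) * (I ^ (u - 1) * V) := by ring
    _ = _ := by
      rw [ENNReal.inv_mul_cancel (ENNReal.rpow_pos (pos_iff_ne_zero.2 hV0) hVt).ne'
        (ENNReal.rpow_ne_top_of_ne_zero hV0 hVt), one_mul]

/-- The two-weight form of the weighted maximal inequality, from the pointwise estimate and the
strong type inequalities with respect to the measures `w dx` and `σ dx`. -/
theorem IsMuckenhouptPair.lintegral_dyadicMax_le {u v : ℝ} {K : ℝ≥0∞} {w σ : (Fin n → ℝ) → ℝ≥0∞}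
    (h : IsMuckenhouptPair u v K w σ) (huv : u.HolderConjugate v) (hK : K ≠ ∞)
    {g : (Fin n → ℝ) → ℝ≥0∞} (hg : Measurable g) :
    ∫⁻ x, w x * dyadicMax volume (fun y => g y * σ y) x ^ u ≤
      weightedConst n u v K * ∫⁻ x, σ x * g x ^ u := by
  have hw := h.measurable_left
  have hσ := h.measurable_right
  set m := dyadicMax (volume.withDensity σ) g with hm
  have hmm : Measurable m := measurable_dyadicMax _ _
  set H : (Fin n → ℝ) → ℝ≥0∞ := fun y => m y ^ (u - 1) * (w y)⁻¹ with hH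
  have hHm : Measurable H := (hmm.pow_const _).mul hw.inv
  have hwd : ∀ (ρ f : (Fin n → ℝ) → ℝ≥0∞), Measurable ρ → Measurable f →
      ∫⁻ y, f y ∂volume.withDensity ρ = ∫⁻ y, ρ y * f y := by
    intro ρ f hρ hf
    rw [lintegral_withDensity_eq_lintegral_mul _ hρ hf]
    rfl
  calc ∫⁻ x, w x * dyadicMax volume (fun y => g y * σ y) x ^ u
      ≤ ∫⁻ x, w x * ((K ^ u * (4 ^ n) ^ u) * dyadicMax (volume.withDensity w) H x) ^ v := by
        refine lintegral_mono fun x => mul_le_mul_right (h.dyadicMax_rpow_le huv hK hg x) _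
    _ = (K ^ u * (4 ^ n) ^ u) ^ v *
        ∫⁻ x, dyadicMax (volume.withDensity w) H x ^ v ∂volume.withDensity w := by
        rw [hwd _ _ hw ((measurable_dyadicMax _ _).pow_const _),
          ← lintegral_const_mul (f := fun y => w y * dyadicMax (volume.withDensity w) H y ^ v) _
            (hw.mul ((measurable_dyadicMax (volume.withDensity w) H).pow_const v))]
        congr 1; ext x
        rw [ENNReal.mul_rpow_of_nonneg _ _ huv.symm.nonneg, mul_left_comm]
    _ ≤ (K ^ u * (4 ^ n) ^ u) ^ v * (strongConst n v *
        ∫⁻ x, H x ^ v ∂volume.withDensity w) := by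
        gcongr
        exact lintegral_dyadicMax_rpow_le _ hHm huv.symm.lt
    _ = (K ^ u * (4 ^ n) ^ u) ^ v * (strongConst n v *
        ∫⁻ x, m x ^ u ∂volume.withDensity σ) := by
        congr 2
        rw [hwd _ _ hw (hHm.pow_const _), hwd _ _ hσ (hmm.pow_const _)]
        refine lintegral_congr_ae ?_
        filter_upwards [h.pos, h.lt_top, h.dual] with x h1 h2 h3
        have h4 : (u - 1) * v = u := huv.sub_one_mul_conj
        rw [hH, h3]
        simp only
        rw [ENNReal.mul_rpow_of_nonneg _ _ huv.symm.nonneg, ← ENNReal.rpow_mul, h4,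
          ← ENNReal.rpow_neg_one, ← ENNReal.rpow_mul, ENNReal.rpow_sub _ _ h1 h2,
          ENNReal.rpow_one, ENNReal.div_eq_inv_mul, ← ENNReal.rpow_neg]
        simp only [neg_mul, one_mul]
        ring
    _ ≤ (K ^ u * (4 ^ n) ^ u) ^ v * (strongConst n v * (strongConst n u *
        ∫⁻ x, g x ^ u ∂volume.withDensity σ)) := by
        gcongr
        exact lintegral_dyadicMax_rpow_le _ hg huv.lt
    _ = _ := by
        rw [hwd _ _ hσ (hg.pow_const _), weightedConst]
        ring

/-- One-weight form of the weighted maximal inequality. -/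
lemma IsMuckenhouptPair.lintegral_mul_dyadicMax_le {u v : ℝ} {K : ℝ≥0∞}
    {w σ : (Fin n → ℝ) → ℝ≥0∞} (h : IsMuckenhouptPair u v K w σ) (huv : u.HolderConjugate v)
    (hK : K ≠ ∞) {f : (Fin n → ℝ) → ℝ≥0∞} (hf : Measurable f) :
    ∫⁻ x, w x * dyadicMax volume f x ^ u ≤ weightedConst n u v K * ∫⁻ x, w x * f x ^ u := by
  have h1 := h.lintegral_dyadicMax_le huv hK (hf.mul h.measurable_right.inv)
  have h2 : dyadicMax volume (fun y => f y * (σ y)⁻¹ * σ y) = dyadicMax volume f := by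
    refine dyadicMax_congr _ ?_
    filter_upwards [(h.symm huv).pos, (h.symm huv).lt_top] with x h3 h4
    rw [mul_assoc, ENNReal.inv_mul_cancel h3 h4, mul_one]
  have h3 : ∫⁻ x, σ x * (f x * (σ x)⁻¹) ^ u = ∫⁻ x, w x * f x ^ u := by
    refine lintegral_congr_ae ?_
    filter_upwards [(h.symm huv).pos, (h.symm huv).lt_top, (h.symm huv).dual] with x h3 h4 h5
    rw [h5, ENNReal.mul_rpow_of_nonneg _ _ huv.nonneg, ENNReal.rpow_sub _ _ h3 h4,
      ENNReal.rpow_one, ENNReal.inv_rpow, ENNReal.div_eq_inv_mul]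
    ring
  simp only [Pi.mul_apply, Pi.inv_apply] at h1
  rw [h2, h3] at h1
  exact h1

/-! ### The Rubio de Francia algorithm -/

/-- Convexity of `t ↦ t ^ v` along the geometric weights `2^{-j}`. -/
lemma tsum_geometric_mul_rpow_le {v : ℝ} (hv : 1 < v) (h : ℕ → ℝ≥0∞) :
    (∑' j, 2⁻¹ ^ j * h j) ^ v ≤ 2 ^ (v - 1) * ∑' j, 2⁻¹ ^ j * h j ^ v := by
  have hc := Real.HolderConjugate.conjExponent hv
  set v' := v.conjExponent
  have key := ENNReal.lintegral_mul_le_Lp_mul_Lq (Measure.count : Measure ℕ) hc.symm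
    (f := fun j => (2⁻¹ ^ j : ℝ≥0∞) ^ (1 / v')) (g := fun j => (2⁻¹ ^ j : ℝ≥0∞) ^ (1 / v) * h j)
    (Measurable.of_discrete).aemeasurable (Measurable.of_discrete).aemeasurable
  simp only [lintegral_count, Pi.mul_apply] at key
  have e1 : ∀ j : ℕ, (2⁻¹ ^ j : ℝ≥0∞) ^ (1 / v') * ((2⁻¹ ^ j : ℝ≥0∞) ^ (1 / v) * h j) =
      2⁻¹ ^ j * h j := by
    intro j
    have := hc.inv_add_inv_eq_one
    rw [← mul_assoc, ← ENNReal.rpow_add_of_nonneg _ _ hc.symm.one_div_nonneg hc.one_div_nonneg,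
      one_div, one_div, add_comm, this, ENNReal.rpow_one]
  have e2 : ∀ j : ℕ, ((2⁻¹ ^ j : ℝ≥0∞) ^ (1 / v')) ^ v' = 2⁻¹ ^ j := by
    intro j
    rw [← ENNReal.rpow_mul, one_div_mul_cancel hc.symm.ne_zero, ENNReal.rpow_one]
  have e3 : ∀ j : ℕ, ((2⁻¹ ^ j : ℝ≥0∞) ^ (1 / v) * h j) ^ v = 2⁻¹ ^ j * h j ^ v := by
    intro j
    rw [ENNReal.mul_rpow_of_nonneg _ _ hc.nonneg, ← ENNReal.rpow_mul,
      one_div_mul_cancel hc.ne_zero, ENNReal.rpow_one]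
  simp only [e1, e2, e3, ENNReal.tsum_geometric, ENNReal.one_sub_inv_two, inv_inv] at key
  refine (ENNReal.rpow_le_rpow key hc.nonneg).trans_eq ?_
  rw [ENNReal.mul_rpow_of_nonneg _ _ hc.nonneg, ← ENNReal.rpow_mul, ← ENNReal.rpow_mul,
    one_div_mul_cancel hc.ne_zero, ENNReal.rpow_one, one_div_mul_eq_div, hc.div_conj_eq_sub_one]

/-- Given a countably subadditive operator `S` bounded on `L^v(ν)`, every function `g` has a
majorant `a` of comparable norm with `S a ≤ 2 A a`, namely `a = ∑ⱼ (2A)^{-j} S^j g`. -/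
lemma exists_rubioDeFrancia {X : Type*} [MeasurableSpace X] (ν : Measure X)
    (S : (X → ℝ≥0∞) → X → ℝ≥0∞) (hmeas : ∀ g, Measurable g → Measurable (S g))
    (hsub : ∀ g : ℕ → X → ℝ≥0∞, (∀ j, Measurable (g j)) → ∀ x,
      S (fun y => ∑' j, g j y) x ≤ ∑' j, S (g j) x)
    (hhom : ∀ (c : ℝ≥0∞) (g : X → ℝ≥0∞), Measurable g → ∀ x,
      S (fun y => c * g y) x = c * S g x)
    {v : ℝ} (hv : 1 < v) {A : ℝ≥0∞} (hA0 : A ≠ 0) (hA : A ≠ ∞)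
    (hbound : ∀ g, Measurable g → ∫⁻ x, S g x ^ v ∂ν ≤ A ^ v * ∫⁻ x, g x ^ v ∂ν)
    {g : X → ℝ≥0∞} (hg : Measurable g) :
    ∃ a : X → ℝ≥0∞, Measurable a ∧ (∀ x, g x ≤ a x) ∧ (∀ x, S a x ≤ 2 * A * a x) ∧
      ∫⁻ x, a x ^ v ∂ν ≤ 2 ^ v * ∫⁻ x, g x ^ v ∂ν := by
  have hv0 : 0 < v := by linarith
  have hm : ∀ j, Measurable (S^[j] g) := by
    intro j
    induction j with
    | zero => exact hg
    | succ j ih => rw [Function.iterate_succ_apply']; exact hmeas _ ih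
  have hb : ∀ j, ∫⁻ x, ((A⁻¹) ^ j * S^[j] g x) ^ v ∂ν ≤ ∫⁻ x, g x ^ v ∂ν := by
    intro j
    induction j with
    | zero => simp
    | succ j ih =>
      refine le_trans ?_ ih
      have h1 : ∀ x, ((A⁻¹) ^ (j + 1) * S^[j + 1] g x) ^ v =
          (A⁻¹) ^ v * S (fun y => (A⁻¹) ^ j * S^[j] g y) x ^ v := by
        intro x
        rw [hhom _ _ (hm j), Function.iterate_succ_apply', ← ENNReal.mul_rpow_of_nonneg _ _ hv0.le,
          pow_succ']
        ring_nf
      simp only [h1]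
      rw [lintegral_const_mul _ ((hmeas _ ((hm j).const_mul _)).pow_const _)]
      refine (mul_le_mul_right (hbound _ ((hm j).const_mul _)) _).trans_eq ?_
      rw [← mul_assoc, ← ENNReal.mul_rpow_of_nonneg _ _ hv0.le, ENNReal.inv_mul_cancel hA0 hA,
        ENNReal.one_rpow, one_mul]
  have hpow : ∀ j : ℕ, ((2 * A)⁻¹) ^ j = 2⁻¹ ^ j * (A⁻¹) ^ j := by
    intro j
    rw [ENNReal.mul_inv (Or.inl (by norm_num)) (Or.inl (by norm_num)), mul_pow]
  refine ⟨fun x => ∑' j, ((2 * A)⁻¹) ^ j * S^[j] g x,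
    Measurable.tsum fun j => (hm j).const_mul _, ?_, ?_, ?_⟩
  · intro x
    refine le_trans (by simp) (ENNReal.le_tsum 0)
  · intro x
    refine (hsub _ (fun j => (hm j).const_mul _) x).trans ?_
    rw [← ENNReal.tsum_mul_left]
    have h2A : 2 * A ≠ 0 := mul_ne_zero (by norm_num) hA0
    have h2A' : 2 * A ≠ ∞ := ENNReal.mul_ne_top (by norm_num) hA
    refine le_trans (ENNReal.tsum_le_tsum (g := fun j => 2 * A * (((2 * A)⁻¹) ^ (j + 1) *
      S^[j + 1] g x)) fun j => ?_)
      (ENNReal.tsum_comp_le_tsum_of_injective (add_left_injective 1)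
        (fun j => 2 * A * (((2 * A)⁻¹) ^ j * S^[j] g x)))
    rw [hhom _ _ (hm j), Function.iterate_succ_apply', pow_succ', ← mul_assoc, ← mul_assoc,
      ENNReal.mul_inv_cancel h2A h2A', one_mul]
  · calc ∫⁻ x, (∑' j, ((2 * A)⁻¹) ^ j * S^[j] g x) ^ v ∂ν
        ≤ ∫⁻ x, 2 ^ (v - 1) * ∑' j, 2⁻¹ ^ j * ((A⁻¹) ^ j * S^[j] g x) ^ v ∂ν := by
          refine lintegral_mono fun x => ?_
          simp only [hpow, mul_assoc]
          exact tsum_geometric_mul_rpow_le hv _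
      _ = 2 ^ (v - 1) * ∑' j, 2⁻¹ ^ j * ∫⁻ x, ((A⁻¹) ^ j * S^[j] g x) ^ v ∂ν := by
          have hm' : ∀ j, Measurable fun x => ((A⁻¹) ^ j * S^[j] g x) ^ v := fun j =>
            ((hm j).const_mul _).pow_const _
          rw [lintegral_const_mul _ (Measurable.tsum fun j => (hm' j).const_mul _),
            lintegral_tsum fun j => ((hm' j).const_mul _).aemeasurable]
          congr 2; ext j
          rw [lintegral_const_mul _ (hm' j)]
      _ ≤ 2 ^ (v - 1) * ∑' j : ℕ, 2⁻¹ ^ j * ∫⁻ x, g x ^ v ∂ν := by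
          exact mul_le_mul_right (ENNReal.tsum_le_tsum fun j => mul_le_mul_right (hb j) _) _
      _ = 2 ^ v * ∫⁻ x, g x ^ v ∂ν := by
          rw [ENNReal.tsum_mul_right, ENNReal.tsum_geometric, ENNReal.one_sub_inv_two, inv_inv,
            ← mul_assoc]
          congr 1
          conv_lhs => enter [2]; rw [← ENNReal.rpow_one 2]
          rw [← two_rpow_add, sub_add_cancel]

/-- Every cube is contained in a cube centred at `x`, so the maximal function of a nonzero function
vanishes nowhere. -/
lemma dyadicMax_pos {g : (Fin n → ℝ) → ℝ≥0∞} (hg : Measurable g) (h : ¬ g =ᵐ[volume] 0)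
    (x : Fin n → ℝ) : dyadicMax volume g x ≠ 0 := by
  intro h0
  apply h
  have h1 : ∀ k : ℕ, ∀ᵐ y ∂volume.restrict (dyadicCube x k), g y = 0 := by
    intro k
    have h2 := setLIntegral_dyadicCube_le volume g x k (volume_dyadicCube_ne_top _ _)
    rw [h0, mul_zero, le_zero_iff, lintegral_eq_zero_iff hg] at h2
    exact h2
  have h3 : (⋃ k : ℕ, dyadicCube x k) = univ := by
    refine eq_univ_of_forall fun y => mem_iUnion.2 ?_
    obtain ⟨k, hk⟩ := pow_unbounded_of_one_lt (dist y x) (one_lt_two)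
    exact ⟨k, by rw [dyadicCube, zpow_natCast]; exact hk.le⟩
  have h4 := ae_restrict_iUnion_iff (μ := volume) (fun k : ℕ => dyadicCube x k)
    (fun y => g y = 0)
  rw [h3, Measure.restrict_univ] at h4
  exact h4.2 h1

/-- The easy half of the factorization of Muckenhoupt weights: `a^{1-r} b` is an `A_r` weight if `a`
and `b` are `A_1` weights. -/
lemma isMuckenhouptPair_of_factors {r r' : ℝ} (hr : r.HolderConjugate r')
    {a b : (Fin n → ℝ) → ℝ≥0∞} (ha : Measurable a) (hb : Measurable b)
    (ha0 : ∀ᵐ x, a x ≠ 0) (hat : ∀ᵐ x, a x ≠ ∞) (hb0 : ∀ᵐ x, b x ≠ 0) (hbt : ∀ᵐ x, b x ≠ ∞)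
    {A B : ℝ≥0∞} (hA : A ≠ ∞) (hB : B ≠ ∞)
    (hMa : ∀ᵐ x, dyadicMax volume a x ≤ A * a x) (hMb : ∀ᵐ x, dyadicMax volume b x ≤ B * b x) :
    IsMuckenhouptPair r r' ((2 ^ n * A) ^ (1 / r') * (2 ^ n * B) ^ (1 / r))
      (fun x => a x ^ (1 - r) * b x) (fun x => b x ^ (1 - r') * a x) where
  measurable_left := (ha.pow_const _).mul hb
  measurable_right := (hb.pow_const _).mul ha
  pos := by
    filter_upwards [ha0, hat, hb0] with x h1 h2 h3
    exact mul_ne_zero (ENNReal.rpow_pos (pos_iff_ne_zero.2 h1) h2).ne' h3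
  lt_top := by
    filter_upwards [ha0, hat, hbt] with x h1 h2 h3
    exact ENNReal.mul_ne_top (ENNReal.rpow_ne_top_of_ne_zero h1 h2) h3
  dual := by
    filter_upwards [ha0, hat, hb0, hbt] with x h1 h2 h3 h4
    have h5 : (1 - r) * (1 - r') = 1 := by
      have := hr.mul_eq_add
      nlinarith
    rw [ENNReal.mul_rpow_of_ne_top (ENNReal.rpow_ne_top_of_ne_zero h1 h2) h4, ← ENNReal.rpow_mul,
      h5, ENNReal.rpow_one, mul_comm]
  bound x k := by
    set V := volume (dyadicCube x k) with hV
    have hV0 : V ≠ 0 := volume_dyadicCube_ne_zero x k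
    have hVt : V ≠ ∞ := volume_dyadicCube_ne_top x k
    -- On each cube, an `A_1` weight is bounded below by a multiple of its average.
    have low : ∀ (f : (Fin n → ℝ) → ℝ≥0∞) (D : ℝ≥0∞),
        (∀ᵐ x, dyadicMax volume f x ≤ D * f x) →
        ∀ᵐ y ∂volume.restrict (dyadicCube x k),
          ∫⁻ z in dyadicCube x k, f z ≤ 2 ^ n * D * V * f y := by
      intro f D hD
      filter_upwards [ae_restrict_of_ae hD, ae_restrict_mem (measurableSet_dyadicCube x k)]
        with y h1 h2
      have h3 : dyadicCube x k ⊆ dyadicCube y (k + 1) := dyadicCube_subset_of_dist_le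
        (k := k) (by rw [dist_comm]; exact h2) (by omega) (by omega)
      calc ∫⁻ z in dyadicCube x k, f z ≤ ∫⁻ z in dyadicCube y (k + 1), f z :=
            lintegral_mono_set h3
        _ ≤ volume (dyadicCube y (k + 1)) * dyadicMax volume f y :=
            setLIntegral_dyadicCube_le _ _ _ _ (volume_dyadicCube_ne_top _ _)
        _ ≤ 2 ^ n * V * (D * f y) := by
            rw [volume_dyadicCube_add_one y x]; gcongr
        _ = _ := by ring
    have upper : ∀ (f g : (Fin n → ℝ) → ℝ≥0∞) (D : ℝ≥0∞) (s : ℝ), Measurable f → Measurable g →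
        D ≠ ∞ → (∀ᵐ x, f x ≠ ∞) → (∀ᵐ x, f x ≠ 0) →
        (∀ᵐ x, dyadicMax volume f x ≤ D * f x) → 1 < s →
        (∫⁻ z in dyadicCube x k, f z) ≠ ∞ ∧
        ∫⁻ y in dyadicCube x k, f y ^ (1 - s) * g y ≤ (2 ^ n * D * V) ^ (s - 1) *
          (∫⁻ z in dyadicCube x k, f z) ^ (1 - s) * ∫⁻ y in dyadicCube x k, g y := by
      intro f g D s hf hg hDt hft hf0 hD hs
      have h1 := low f D hD
      have hI0 := setLIntegral_dyadicCube_ne_zero hf hf0 x k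
      have hc : 2 ^ n * D * V ≠ ∞ := ENNReal.mul_ne_top (ENNReal.mul_ne_top (by simp) hDt) hVt
      have hIt : (∫⁻ z in dyadicCube x k, f z) ≠ ∞ := by
        have hne : (volume.restrict (dyadicCube x k)) ≠ 0 := by
          rw [Ne, Measure.restrict_eq_zero]; exact hV0
        have : (ae (volume.restrict (dyadicCube x k))).NeBot := ae_neBot.2 hne
        obtain ⟨y, h2, h3⟩ := (h1.and (ae_restrict_of_ae hft)).exists
        exact ne_top_of_le_ne_top (ENNReal.mul_ne_top hc h3) h2
      refine ⟨hIt, ?_⟩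
      rw [← lintegral_const_mul _ hg]
      refine lintegral_mono_ae ?_
      filter_upwards [h1, ae_restrict_of_ae hf0, ae_restrict_of_ae hft] with y h2 h3 h4
      refine mul_le_mul_left ?_ _
      have hs0 : 0 < s - 1 := by linarith
      have e : ∀ z : ℝ≥0∞, z ^ (1 - s) = (z ^ (s - 1))⁻¹ := fun z => by
        rw [← ENNReal.rpow_neg, neg_sub]
      have h5 := ENNReal.rpow_le_rpow h2 hs0.le
      rw [ENNReal.mul_rpow_of_nonneg _ _ hs0.le] at h5
      have hf0 : f y ^ (s - 1) ≠ 0 := (ENNReal.rpow_pos (pos_iff_ne_zero.2 h3) h4).ne'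
      have hft : f y ^ (s - 1) ≠ ∞ := ENNReal.rpow_ne_top_of_ne_zero h3 h4
      rw [e, e, ← div_eq_mul_inv, ENNReal.le_div_iff_mul_le
        (Or.inl (ENNReal.rpow_pos (pos_iff_ne_zero.2 hI0) hIt).ne')
        (Or.inl (ENNReal.rpow_ne_top_of_ne_zero hI0 hIt))]
      refine (mul_le_mul_right h5 _).trans_eq ?_
      rw [mul_left_comm, ENNReal.inv_mul_cancel hf0 hft, mul_one]
    obtain ⟨hIA, h1⟩ := upper a b A r ha hb hA hat ha0 hMa hr.lt
    obtain ⟨hIB, h2⟩ := upper b a B r' hb ha hB hbt hb0 hMb hr.symm.lt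
    have hIA0 := setLIntegral_dyadicCube_ne_zero ha ha0 x k
    have hIB0 := setLIntegral_dyadicCube_ne_zero hb hb0 x k
    set IA := ∫⁻ z in dyadicCube x k, a z
    set IB := ∫⁻ z in dyadicCube x k, b z
    have e1 : (r - 1) * (1 / r) = 1 / r' := by
      rw [mul_one_div, div_eq_div_iff hr.ne_zero hr.symm.ne_zero, hr.sub_one_mul_conj, one_mul]
    have e2 : (r' - 1) * (1 / r') = 1 / r := by
      rw [mul_one_div, div_eq_div_iff hr.symm.ne_zero hr.ne_zero, hr.symm.sub_one_mul_conj, one_mul]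
    have e1' : (1 - r) * (1 / r) = -(1 / r') := by rw [← e1]; ring
    have e2' : (1 - r') * (1 / r') = -(1 / r) := by rw [← e2]; ring
    have hr0 := hr.one_div_nonneg
    have hr0' := hr.symm.one_div_nonneg
    calc _ ≤ ((2 ^ n * A * V) ^ (r - 1) * IA ^ (1 - r) * IB) ^ (1 / r) *
          ((2 ^ n * B * V) ^ (r' - 1) * IB ^ (1 - r') * IA) ^ (1 / r') := by gcongr
      _ = ((2 ^ n * A) ^ (1 / r') * (2 ^ n * B) ^ (1 / r)) * (V ^ (1 / r') * V ^ (1 / r)) *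
          (IA ^ (-(1 / r')) * IA ^ (1 / r')) * (IB ^ (-(1 / r)) * IB ^ (1 / r)) := by
          simp only [ENNReal.mul_rpow_of_nonneg _ _ hr0, ENNReal.mul_rpow_of_nonneg _ _ hr0',
            ← ENNReal.rpow_mul, e1, e2, e1', e2']
          ring
      _ = _ := by
          have h3 := hr.inv_add_inv_eq_one
          rw [← ENNReal.rpow_add _ _ hIA0 hIA, ← ENNReal.rpow_add _ _ hIB0 hIB,
            ← ENNReal.rpow_add _ _ hV0 hVt, add_comm (1 / r'), one_div, one_div, h3]
          simp

/-! ### Extrapolation to vector-valued functions -/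

lemma seqNorm_ennreal {X : Type*} (r : ℝ) (g : ℕ → X → ℝ≥0∞) (x : X) :
    seqNorm r g x = (∑' k, g k x ^ r) ^ (1 / r) := by
  simp [seqNorm]

lemma seqNorm_rpow {X : Type*} {r : ℝ} (hr : 0 < r) (g : ℕ → X → ℝ≥0∞) (x : X) :
    seqNorm r g x ^ r = ∑' k, g k x ^ r := by
  rw [seqNorm_ennreal, ← ENNReal.rpow_mul, one_div_mul_cancel hr.ne', ENNReal.rpow_one]

lemma measurable_seqNorm {X : Type*} [MeasurableSpace X] (r : ℝ) {g : ℕ → X → ℝ≥0∞}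
    (hg : ∀ k, Measurable (g k)) : Measurable (seqNorm r g) := by
  have : seqNorm r g = fun x => (∑' k, g k x ^ r) ^ (1 / r) := funext (seqNorm_ennreal r g)
  rw [this]
  exact (Measurable.tsum fun k => (hg k).pow_const _).pow_const _

/-- The bilinear form of the vector-valued inequality for `A_u` weights. Rubio de Francia majorants
`a` of `|g|_r` and `b / ω` of `h` reduce it to the scalar inequality for the `A_r` weight
`a^{1-r} b`, where the sum over the sequence may be taken inside the integral. -/
lemma IsMuckenhouptPair.exists_lintegral_seqNorm_mul_le {u v : ℝ} {K : ℝ≥0∞}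
    {w σ : (Fin n → ℝ) → ℝ≥0∞} (hwσ : IsMuckenhouptPair u v K w σ) (huv : u.HolderConjugate v)
    (hK : K ≠ ∞) {r : ℝ} (hr : 1 < r) :
    ∃ C : ℝ≥0∞, C ≠ ∞ ∧ ∀ g : ℕ → (Fin n → ℝ) → ℝ≥0∞, (∀ k, Measurable (g k)) →
      ∫⁻ x, w x * seqNorm r g x ^ u ≠ ∞ →
      ∀ h : (Fin n → ℝ) → ℝ≥0∞, Measurable h → ∫⁻ x, w x * h x ^ v ≠ ∞ →
      ∫⁻ x, w x * (seqNorm r (fun k => dyadicMax volume (g k)) x * h x) ≤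
        C * ((∫⁻ x, w x * seqNorm r g x ^ u) ^ (1 / u) * (∫⁻ x, w x * h x ^ v) ^ (1 / v)) := by
  have hrr := Real.HolderConjugate.conjExponent hr
  set r' := r.conjExponent
  have hw := hwσ.measurable_left
  set A : ℝ≥0∞ := weightedConst n u v K ^ (1 / u) + 1 with hA
  set B : ℝ≥0∞ := weightedConst n v u K ^ (1 / v) + 1 with hB
  have hA0 : A ≠ 0 := by simp [hA]
  have hB0 : B ≠ 0 := by simp [hB]
  have hAt : A ≠ ∞ := ENNReal.add_ne_top.2
    ⟨ENNReal.rpow_ne_top_of_nonneg huv.one_div_nonneg (weightedConst_ne_top n huv hK), by simp⟩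
  have hBt : B ≠ ∞ := ENNReal.add_ne_top.2
    ⟨ENNReal.rpow_ne_top_of_nonneg huv.symm.one_div_nonneg
      (weightedConst_ne_top n huv.symm hK), by simp⟩
  have hAu : weightedConst n u v K ≤ A ^ u := by
    calc weightedConst n u v K = (weightedConst n u v K ^ (1 / u)) ^ u := by
          rw [← ENNReal.rpow_mul, one_div_mul_cancel huv.ne_zero, ENNReal.rpow_one]
      _ ≤ A ^ u := ENNReal.rpow_le_rpow le_self_add huv.nonneg
  have hBv : weightedConst n v u K ≤ B ^ v := by
    calc weightedConst n v u K = (weightedConst n v u K ^ (1 / v)) ^ v := by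
          rw [← ENNReal.rpow_mul, one_div_mul_cancel huv.symm.ne_zero, ENNReal.rpow_one]
      _ ≤ B ^ v := ENNReal.rpow_le_rpow le_self_add huv.symm.nonneg
  have hwd : ∀ f : (Fin n → ℝ) → ℝ≥0∞, Measurable f →
      ∫⁻ y, f y ∂volume.withDensity w = ∫⁻ y, w y * f y := fun f hf => by
    rw [lintegral_withDensity_eq_lintegral_mul _ hw hf]
    rfl
  set Kr := (2 ^ n * (2 * A)) ^ (1 / r') * (2 ^ n * (2 * B)) ^ (1 / r) with hKr
  have hKrt : Kr ≠ ∞ := by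
    refine ENNReal.mul_ne_top (ENNReal.rpow_ne_top_of_nonneg hrr.symm.one_div_nonneg ?_)
      (ENNReal.rpow_ne_top_of_nonneg hrr.one_div_nonneg ?_)
    · exact ENNReal.mul_ne_top (by simp) (ENNReal.mul_ne_top (by simp) hAt)
    · exact ENNReal.mul_ne_top (by simp) (ENNReal.mul_ne_top (by simp) hBt)
  set D := weightedConst n r r' Kr with hD
  have hDt : D ≠ ∞ := weightedConst_ne_top n hrr hKrt
  refine ⟨D ^ (1 / r) * 4, ENNReal.mul_ne_top
    (ENNReal.rpow_ne_top_of_nonneg hrr.one_div_nonneg hDt) (by simp), ?_⟩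
  intro g hg hGfin h hh hhfin
  set G := seqNorm r g with hG
  set F := seqNorm r (fun k => dyadicMax volume (g k)) with hF
  have hGm : Measurable G := measurable_seqNorm r hg
  have hFm : Measurable F := measurable_seqNorm r fun k => measurable_dyadicMax _ _
  by_cases hG0 : G =ᵐ[volume] 0
  · have h1 : ∀ k, g k =ᵐ[volume] fun _ => 0 := by
      intro k
      filter_upwards [hG0] with x hx
      have h2 := seqNorm_rpow hrr.pos g x
      rw [← hG, hx, Pi.zero_apply, ENNReal.zero_rpow_of_pos hrr.pos, eq_comm,
        ENNReal.tsum_eq_zero] at h2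
      exact (ENNReal.rpow_eq_zero_iff_of_pos hrr.pos).1 (h2 k)
    have h2 : ∀ x, F x = 0 := by
      intro x
      have h3 : ∀ k, dyadicMax volume (g k) x = 0 := fun k => by
        rw [dyadicMax_congr volume (h1 k)]
        exact le_zero_iff.1 (dyadicMax_const_le _ _ _)
      rw [hF, seqNorm_ennreal]
      simp [h3, hrr.pos]
    simp [h2]
  by_cases hh0 : h =ᵐ[volume] 0
  · have h1 : ∫⁻ x, w x * (F x * h x) = 0 := by
      rw [lintegral_eq_zero_iff (hw.fun_mul (hFm.fun_mul hh))]
      filter_upwards [hh0] with x hx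
      simp [hx]
    rw [h1]; exact zero_le
  obtain ⟨a, ham, hGa, hMa, haint⟩ := exists_rubioDeFrancia (volume.withDensity w)
    (dyadicMax volume) (fun g _ => measurable_dyadicMax _ _)
    (fun g hg x => dyadicMax_tsum_le _ hg x) (fun c g hg x => dyadicMax_const_mul _ hg c x)
    huv.lt hA0 hAt (fun f hf => by
      rw [hwd _ ((measurable_dyadicMax _ _).pow_const _), hwd _ (hf.pow_const _)]
      exact (hwσ.lintegral_mul_dyadicMax_le huv hK hf).trans (by gcongr)) hGm
  -- By duality, `f ↦ M(f w) / w` is bounded on `L^v(w)`.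
  obtain ⟨b, hbm, hhb, hMb, hbint⟩ := exists_rubioDeFrancia (volume.withDensity w)
    (fun f x => dyadicMax volume (fun y => f y * w y) x * (w x)⁻¹)
    (fun g _ => (measurable_dyadicMax _ _).mul hw.inv)
    (fun g hg x => by
      rw [ENNReal.tsum_mul_right]
      refine mul_le_mul_left ?_ _
      simp only [← ENNReal.tsum_mul_right]
      exact dyadicMax_tsum_le _ (fun j => (hg j).mul hw) x)
    (fun c g hg x => by
      simp only [mul_assoc]
      rw [dyadicMax_const_mul _ (hg.fun_mul hw), mul_assoc])
    huv.symm.lt hB0 hBt (fun f hf => by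
      rw [hwd _ (((measurable_dyadicMax _ _).fun_mul hw.fun_inv).pow_const _),
        hwd _ (hf.pow_const _)]
      have h1 := (hwσ.symm huv).lintegral_dyadicMax_le huv.symm hK hf
      refine le_trans (le_of_eq ?_) (h1.trans (by gcongr))
      refine lintegral_congr_ae ?_
      filter_upwards [hwσ.pos, hwσ.lt_top, hwσ.dual] with x h2 h3 h4
      rw [h4, ENNReal.mul_rpow_of_nonneg _ _ huv.symm.nonneg, ENNReal.rpow_sub _ _ h2 h3,
        ENNReal.rpow_one, ENNReal.inv_rpow, div_eq_mul_inv]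
      ring) hh
  rw [hwd _ (ham.pow_const _), hwd _ (hGm.pow_const _)] at haint
  rw [hwd _ (hbm.pow_const _), hwd _ (hh.pow_const _)] at hbint
  have hfin : ∀ (f : (Fin n → ℝ) → ℝ≥0∞) (s : ℝ), Measurable f → 0 < s →
      ∫⁻ x, w x * f x ^ s ≠ ∞ → ∀ᵐ x, f x ≠ ∞ := by
    intro f s hf hs hne
    filter_upwards [ae_lt_top (hw.mul (hf.pow_const _)) hne, hwσ.pos] with x h1 h2 h3
    simp only [Pi.mul_apply] at h1
    rw [h3, ENNReal.top_rpow_of_pos hs, ENNReal.mul_top h2] at h1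
    exact lt_irrefl _ h1
  have hat : ∀ᵐ x, a x ≠ ∞ := hfin a u ham huv.pos
    (ne_top_of_le_ne_top (ENNReal.mul_ne_top (two_rpow_ne_top _) hGfin) haint)
  have hbt : ∀ᵐ x, b x ≠ ∞ := hfin b v hbm huv.symm.pos
    (ne_top_of_le_ne_top (ENNReal.mul_ne_top (two_rpow_ne_top _) hhfin) hbint)
  have ha0 : ∀ x, a x ≠ 0 := by
    intro x h0
    have h1 := hMa x
    rw [h0, mul_zero] at h1
    refine dyadicMax_pos ham (fun h2 => hG0 ?_) x (le_zero_iff.1 h1)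
    filter_upwards [h2] with y hy
    exact le_zero_iff.1 ((hGa y).trans_eq hy)
  set b' : (Fin n → ℝ) → ℝ≥0∞ := fun x => b x * w x with hb'
  have hbm' : Measurable b' := hbm.mul hw
  have hMb' : ∀ᵐ x, dyadicMax volume b' x ≤ 2 * B * b' x := by
    filter_upwards [hwσ.pos, hwσ.lt_top] with x h1 h2
    have h3 := mul_le_mul_left (hMb x) (w x)
    rw [mul_assoc, ENNReal.inv_mul_cancel h1 h2, mul_one] at h3
    exact h3.trans_eq (mul_assoc _ _ _)
  have hbt' : ∀ᵐ x, b' x ≠ ∞ := by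
    filter_upwards [hbt, hwσ.lt_top] with x h1 h2
    exact ENNReal.mul_ne_top h1 h2
  have hb0' : ∀ᵐ x, b' x ≠ 0 := by
    filter_upwards [hMb'] with x h1 h0
    rw [h0, mul_zero] at h1
    refine dyadicMax_pos hbm' (fun h2 => hh0 ?_) x (le_zero_iff.1 h1)
    filter_upwards [h2, hwσ.pos] with y hy h3
    have h4 : b y = 0 := by
      rcases mul_eq_zero.1 hy with h | h
      · exact h
      · exact absurd h h3
    exact le_zero_iff.1 ((hhb y).trans_eq h4)
  have hpair := isMuckenhouptPair_of_factors hrr ham hbm' (Filter.Eventually.of_forall ha0) hat hb0'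
    hbt' (ENNReal.mul_ne_top (by simp) hAt) (ENNReal.mul_ne_top (by simp) hBt)
    (Filter.Eventually.of_forall hMa) hMb'
  set W : (Fin n → ℝ) → ℝ≥0∞ := fun x => a x ^ (1 - r) * b' x with hW
  have hWm : Measurable W := hpair.measurable_left
  -- The scalar `L^r(W)` inequality, summed over the sequence.
  have hab : ∫⁻ x, W x * F x ^ r ≤ D * ∫⁻ x, a x * b' x := by
    calc ∫⁻ x, W x * F x ^ r = ∑' k, ∫⁻ x, W x * dyadicMax volume (g k) x ^ r := by
          rw [← lintegral_tsum fun k =>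
            (hWm.fun_mul ((measurable_dyadicMax volume (g k)).pow_const r)).aemeasurable]
          congr 1; ext x
          rw [hF, seqNorm_rpow hrr.pos]
          exact ENNReal.tsum_mul_left.symm
      _ ≤ ∑' k, D * ∫⁻ x, W x * g k x ^ r :=
          ENNReal.tsum_le_tsum fun k => hpair.lintegral_mul_dyadicMax_le hrr hKrt (hg k)
      _ = D * ∫⁻ x, W x * G x ^ r := by
          rw [ENNReal.tsum_mul_left, ← lintegral_tsum fun k =>
            (hWm.fun_mul ((hg k).pow_const r)).aemeasurable]
          congr 2; ext x
          rw [hG, seqNorm_rpow hrr.pos]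
          exact ENNReal.tsum_mul_left
      _ ≤ D * ∫⁻ x, a x * b' x := by
          refine mul_le_mul_right (lintegral_mono_ae ?_) _
          filter_upwards [hat] with x h1
          calc W x * G x ^ r ≤ a x ^ (1 - r) * b' x * a x ^ r := by
                refine mul_le_mul_right ?_ _
                exact ENNReal.rpow_le_rpow (hGa x) hrr.nonneg
            _ = (a x ^ (1 - r) * a x ^ r) * b' x := by ring
            _ = a x * b' x := by
                rw [← ENNReal.rpow_add _ _ (ha0 x) h1, sub_add_cancel, ENNReal.rpow_one]
  have hab2 : ∫⁻ x, a x * b' x ≤ 4 * ((∫⁻ x, w x * G x ^ u) ^ (1 / u) *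
      (∫⁻ x, w x * h x ^ v) ^ (1 / v)) := by
    have h1 := ENNReal.lintegral_mul_le_Lp_mul_Lq (volume.withDensity w) huv ham.aemeasurable
      hbm.aemeasurable
    rw [hwd _ (ham.mul hbm), hwd _ (ham.pow_const _), hwd _ (hbm.pow_const _)] at h1
    calc ∫⁻ x, a x * b' x = ∫⁻ x, w x * (a * b) x := by
          congr 1; ext x
          simp only [hb', Pi.mul_apply]; ring
      _ ≤ _ := h1
      _ ≤ (2 ^ u * ∫⁻ x, w x * G x ^ u) ^ (1 / u) * (2 ^ v * ∫⁻ x, w x * h x ^ v) ^ (1 / v) := by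
          gcongr
          · exact huv.one_div_nonneg
          · exact huv.symm.one_div_nonneg
      _ = _ := by
          rw [ENNReal.mul_rpow_of_nonneg _ _ huv.one_div_nonneg,
            ENNReal.mul_rpow_of_nonneg _ _ huv.symm.one_div_nonneg, ← ENNReal.rpow_mul,
            ← ENNReal.rpow_mul, mul_one_div_cancel huv.ne_zero,
            mul_one_div_cancel huv.symm.ne_zero, ENNReal.rpow_one, mul_mul_mul_comm]
          norm_num
  calc ∫⁻ x, w x * (F x * h x)
      ≤ ∫⁻ x, ((fun x => W x ^ (1 / r) * F x) * fun x => (a x * b' x) ^ (1 / r')) x := by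
        refine lintegral_mono_ae ?_
        filter_upwards [hat, hb0', hbt'] with x h1 h2 h3
        have e1 : (1 - r) * (1 / r) = -(1 / r') := by
          have : (r - 1) * (1 / r) = 1 / r' := by
            rw [mul_one_div, div_eq_div_iff hrr.ne_zero hrr.symm.ne_zero, hrr.sub_one_mul_conj,
              one_mul]
          rw [← this]; ring
        have e2 : W x ^ (1 / r) * (a x * b' x) ^ (1 / r') = b' x := by
          rw [hW]
          simp only
          rw [ENNReal.mul_rpow_of_nonneg _ _ hrr.one_div_nonneg,
            ENNReal.mul_rpow_of_nonneg _ _ hrr.symm.one_div_nonneg, ← ENNReal.rpow_mul, e1,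
            mul_mul_mul_comm, ← ENNReal.rpow_add _ _ (ha0 x) h1, ← ENNReal.rpow_add _ _ h2 h3,
            one_div r, one_div r', hrr.inv_add_inv_eq_one]
          simp
        calc w x * (F x * h x) ≤ w x * (F x * b x) := by gcongr; exact hhb x
          _ = F x * b' x := by simp only [hb']; ring
          _ = F x * (W x ^ (1 / r) * (a x * b' x) ^ (1 / r')) := by rw [e2]
          _ = _ := by simp only [Pi.mul_apply]; ring
    _ ≤ (∫⁻ x, (W x ^ (1 / r) * F x) ^ r) ^ (1 / r) *
        (∫⁻ x, ((a x * b' x) ^ (1 / r')) ^ r') ^ (1 / r') :=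
        ENNReal.lintegral_mul_le_Lp_mul_Lq volume hrr ((hWm.pow_const _).mul hFm).aemeasurable
          ((ham.mul hbm').pow_const _).aemeasurable
    _ = (∫⁻ x, W x * F x ^ r) ^ (1 / r) * (∫⁻ x, a x * b' x) ^ (1 / r') := by
        simp only [ENNReal.mul_rpow_of_nonneg _ _ hrr.nonneg, ← ENNReal.rpow_mul,
          one_div_mul_cancel hrr.ne_zero, one_div_mul_cancel hrr.symm.ne_zero, ENNReal.rpow_one]
    _ ≤ (D * ∫⁻ x, a x * b' x) ^ (1 / r) * (∫⁻ x, a x * b' x) ^ (1 / r') := by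
        gcongr
    _ = D ^ (1 / r) * ∫⁻ x, a x * b' x := by
        rw [ENNReal.mul_rpow_of_nonneg _ _ hrr.one_div_nonneg, mul_assoc,
          ← ENNReal.rpow_add_of_nonneg _ _ hrr.one_div_nonneg hrr.symm.one_div_nonneg, one_div r,
          one_div r', hrr.inv_add_inv_eq_one, ENNReal.rpow_one]
    _ ≤ _ := by
        rw [mul_assoc]
        gcongr

/-- The vector-valued weighted maximal inequality for `A_u` weights. -/
theorem IsMuckenhouptPair.exists_lintegral_seqNorm_le {u v : ℝ} {K : ℝ≥0∞}
    {w σ : (Fin n → ℝ) → ℝ≥0∞} (hwσ : IsMuckenhouptPair u v K w σ) (huv : u.HolderConjugate v)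
    (hK : K ≠ ∞) {r : ℝ} (hr : 1 < r) :
    ∃ C : ℝ≥0∞, C ≠ ∞ ∧ ∀ g : ℕ → (Fin n → ℝ) → ℝ≥0∞, (∀ k, Measurable (g k)) →
      ∫⁻ x, w x * seqNorm r (fun k => dyadicMax volume (g k)) x ^ u ≤
        C * ∫⁻ x, w x * seqNorm r g x ^ u := by
  obtain ⟨C, hC, hbil⟩ := hwσ.exists_lintegral_seqNorm_mul_le huv hK hr
  have hw := hwσ.measurable_left
  refine ⟨C ^ u + 1, ENNReal.add_ne_top.2 ⟨ENNReal.rpow_ne_top_of_nonneg huv.nonneg hC, by simp⟩,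
    fun g hg => ?_⟩
  set G := seqNorm r g with hG
  set F := seqNorm r (fun k => dyadicMax volume (g k)) with hF
  have hFm : Measurable F := measurable_seqNorm r fun k => measurable_dyadicMax _ _
  rcases eq_or_ne (∫⁻ x, w x * G x ^ u) ∞ with hGt | hGt
  · rw [hGt, ENNReal.mul_top (by simp)]; exact le_top
  -- Test against the powers of the truncations of `F`, whose norms are finite.
  set T : ℕ → (Fin n → ℝ) → ℝ≥0∞ := fun N =>
    (dyadicCube 0 N).indicator fun x => min (F x) N with hT
  have hTm : ∀ N, Measurable (T N) := fun N =>
    (hFm.min measurable_const).indicator (measurableSet_dyadicCube _ _)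
  have hTF : ∀ N x, T N x ≤ F x := fun N x =>
    (indicator_le_self' (fun _ _ => zero_le) x).trans (min_le_left _ _)
  have hTfin : ∀ N, ∫⁻ x, w x * T N x ^ u ≠ ∞ := by
    intro N
    have h1 : ∀ x, w x * T N x ^ u ≤ (dyadicCube 0 (N : ℤ)).indicator w x * (N : ℝ≥0∞) ^ u := by
      intro x
      by_cases hx : x ∈ dyadicCube (0 : Fin n → ℝ) (N : ℤ)
      · simp only [hT, indicator_of_mem hx]
        exact mul_le_mul_right (ENNReal.rpow_le_rpow (min_le_right _ _) huv.nonneg) _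
      · simp only [hT, indicator_of_notMem hx]
        simp [huv.pos]
    refine ne_top_of_le_ne_top ?_ (lintegral_mono h1)
    rw [lintegral_mul_const _ (hw.indicator (measurableSet_dyadicCube _ _)),
      lintegral_indicator (measurableSet_dyadicCube _ _)]
    exact ENNReal.mul_ne_top ((hwσ.symm huv).lintegral_right_ne_top huv.symm hK _ _)
      (ENNReal.rpow_ne_top_of_nonneg huv.nonneg (ENNReal.natCast_ne_top N))
  have hTle : ∀ N, ∫⁻ x, w x * T N x ^ u ≤ C ^ u * ∫⁻ x, w x * G x ^ u := by
    intro N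
    set I := ∫⁻ x, w x * T N x ^ u with hI
    have e1 : ∀ x, (T N x ^ (u - 1)) ^ v = T N x ^ u := fun x => by
      rw [← ENNReal.rpow_mul, huv.sub_one_mul_conj]
    have h1 := hbil g hg hGt (fun x => T N x ^ (u - 1)) ((hTm N).pow_const _)
      (by simp only [e1]; exact hTfin N)
    simp only [e1] at h1
    have h2 : I ≤ C * ((∫⁻ x, w x * G x ^ u) ^ (1 / u) * I ^ (1 / v)) := by
      refine le_trans (lintegral_mono fun x => mul_le_mul_right ?_ _) h1
      calc T N x ^ u = T N x * T N x ^ (u - 1) := by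
            conv_rhs => enter [1]; rw [← ENNReal.rpow_one (T N x)]
            rw [← ENNReal.rpow_add_of_nonneg _ _ zero_le_one huv.sub_one_pos.le, add_sub_cancel]
        _ ≤ F x * T N x ^ (u - 1) := mul_le_mul_left (hTF N x) _
    rcases eq_or_ne I 0 with h0 | h0
    · rw [h0]; exact zero_le
    have h3 : I = I ^ (1 / u) * I ^ (1 / v) := by
      rw [← ENNReal.rpow_add _ _ h0 (hTfin N), one_div, one_div, huv.inv_add_inv_eq_one,
        ENNReal.rpow_one]
    have h4 : I ^ (1 / u) ≤ C * (∫⁻ x, w x * G x ^ u) ^ (1 / u) := by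
      refine (ENNReal.mul_le_mul_iff_left (c := I ^ (1 / v))
        (ENNReal.rpow_pos (pos_iff_ne_zero.2 h0) (hTfin N)).ne'
        (ENNReal.rpow_ne_top_of_ne_zero h0 (hTfin N))).1 ?_
      rw [← h3, mul_assoc]
      exact h2
    have h5 := ENNReal.rpow_le_rpow h4 huv.nonneg
    rwa [ENNReal.mul_rpow_of_nonneg _ _ huv.nonneg, ← ENNReal.rpow_mul, ← ENNReal.rpow_mul,
      one_div_mul_cancel huv.ne_zero, ENNReal.rpow_one, ENNReal.rpow_one] at h5
  have hlim : Filter.Tendsto (fun N => ∫⁻ x, w x * T N x ^ u) Filter.atTop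
      (nhds (∫⁻ x, w x * F x ^ u)) := by
    have hmonoT : ∀ x, Monotone fun N => T N x := by
      intro x a b hab
      have h1 : dyadicCube (0 : Fin n → ℝ) (a : ℤ) ⊆ dyadicCube 0 (b : ℤ) :=
        dyadicCube_mono _ (by exact_mod_cast hab)
      by_cases hx : x ∈ dyadicCube (0 : Fin n → ℝ) (a : ℤ)
      · simp only [hT, indicator_of_mem hx, indicator_of_mem (h1 hx)]
        exact min_le_min le_rfl (by exact_mod_cast hab)
      · simp only [hT, indicator_of_notMem hx]
        exact zero_le
    refine lintegral_tendsto_of_tendsto_of_monotone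
      (fun N => (hw.mul ((hTm N).pow_const _)).aemeasurable)
      (Filter.Eventually.of_forall fun x a b hab =>
        mul_le_mul_right (ENNReal.rpow_le_rpow (hmonoT x hab) huv.nonneg) _) ?_
    filter_upwards [hwσ.lt_top] with x hx
    have h1 : Filter.Tendsto (fun N => T N x) Filter.atTop (nhds (F x)) := by
      have h2 : Filter.Tendsto (fun N : ℕ => min (F x) (N : ℝ≥0∞)) Filter.atTop
          (nhds (min (F x) ∞)) := tendsto_const_nhds.min ENNReal.tendsto_nat_nhds_top
      rw [min_eq_left le_top] at h2
      refine h2.congr' ?_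
      obtain ⟨k, hk⟩ := pow_unbounded_of_one_lt (dist x 0) (one_lt_two)
      filter_upwards [Filter.eventually_ge_atTop k] with N hN
      have h3 : x ∈ dyadicCube (0 : Fin n → ℝ) (N : ℤ) := by
        rw [dyadicCube, zpow_natCast]
        exact hk.le.trans (pow_le_pow_right₀ (by norm_num) hN)
      simp only [hT, indicator_of_mem h3]
    exact ENNReal.Tendsto.const_mul ((ENNReal.continuous_rpow_const.tendsto _).comp h1)
      (Or.inr hx)
  refine (le_of_tendsto' hlim hTle).trans ?_
  gcongr
  exact le_self_add

/-! ### Comparison of a measure with Lebesgue measure on subsets of cubes -/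

/-- Every measurable subset `E` of a cube `Q` with `|E| ≥ t |Q|` satisfies `ν(Q) ≤ φ ν(E)`. -/
def ComparableAt (ν : Measure (Fin n → ℝ)) (t φ : ℝ≥0∞) : Prop :=
  ∀ (c : Fin n → ℝ) (k : ℤ) (E : Set (Fin n → ℝ)), MeasurableSet E → E ⊆ dyadicCube c k →
    t * volume (dyadicCube c k) ≤ volume E → ν (dyadicCube c k) ≤ φ * ν E

/-- At almost every point of a set `E` which is small compared with its cube, there is a largest
scale at which `E` has density at least `t`; there the density is at most `2^n t`, because it is
below `t` at the next scale. -/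
lemma ae_exists_stopping_scale {t : ℝ≥0∞} (ht : t < 1) {c : Fin n → ℝ} {k : ℤ}
    {E : Set (Fin n → ℝ)} (hE : MeasurableSet E)
    (hsmall : volume E < t * volume (dyadicCube c k)) :
    ∀ᵐ x, x ∈ E → ∃ j : ℤ, j < k ∧
      t * volume (dyadicCube x j) ≤ volume (E ∩ dyadicCube x j) ∧
      volume (E ∩ dyadicCube x j) ≤ 2 ^ n * t * volume (dyadicCube x j) := by
  filter_upwards [(ae_restrict_iff' hE).1 (Besicovitch.ae_tendsto_measure_inter_div volume E)]
    with x hx hxE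
  have h1 := hx hxE
  have hbig : ∀ j : ℤ, k ≤ j → volume (E ∩ dyadicCube x j) < t * volume (dyadicCube x j) := by
    intro j hj
    calc volume (E ∩ dyadicCube x j) ≤ volume E := measure_mono inter_subset_left
      _ < t * volume (dyadicCube c k) := hsmall
      _ = t * volume (dyadicCube x k) := by rw [volume_dyadicCube_eq c x]
      _ ≤ t * volume (dyadicCube x j) := by gcongr; exact dyadicCube_mono x hj
  have h2 : Filter.Tendsto (fun m : ℕ => ((2 : ℝ) ^ (-(m : ℤ)))) Filter.atTop
      (nhdsWithin 0 (Ioi 0)) := by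
    refine tendsto_nhdsWithin_iff.2 ⟨?_, Filter.Eventually.of_forall fun m => ?_⟩
    · have := tendsto_pow_atTop_nhds_zero_of_lt_one (r := (2⁻¹ : ℝ)) (by norm_num) (by norm_num)
      simpa [zpow_neg, inv_pow] using this
    · exact mem_Ioi.2 (by positivity)
  obtain ⟨m, hm⟩ := ((h1.comp h2).eventually (lt_mem_nhds ht)).exists
  have hex : ∃ j : ℤ, t * volume (dyadicCube x j) ≤ volume (E ∩ dyadicCube x j) :=
    ⟨-(m : ℤ), ((ENNReal.lt_div_iff_mul_lt (Or.inl (volume_dyadicCube_ne_zero x _))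
      (Or.inl (volume_dyadicCube_ne_top x _))).1 hm).le⟩
  obtain ⟨j, hj1, hj2⟩ := Int.exists_greatest_of_bdd
    (P := fun j : ℤ => t * volume (dyadicCube x j) ≤ volume (E ∩ dyadicCube x j))
    ⟨k, fun j hj => by
      by_contra hlt
      exact absurd hj (not_le.2 (hbig j (le_of_lt (not_le.1 hlt))))⟩ hex
  refine ⟨j, ?_, hj1, ?_⟩
  · by_contra hlt
    exact absurd hj1 (not_le.2 (hbig j (not_lt.1 hlt)))
  · have h3 : ¬ t * volume (dyadicCube x (j + 1)) ≤ volume (E ∩ dyadicCube x (j + 1)) :=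
      fun h => by have := hj2 _ h; omega
    calc volume (E ∩ dyadicCube x j) ≤ volume (E ∩ dyadicCube x (j + 1)) := by
          gcongr; exact dyadicCube_mono x (by omega)
      _ ≤ t * volume (dyadicCube x (j + 1)) := (not_le.1 h3).le
      _ = _ := by rw [volume_dyadicCube_add_one x x]; ring

/-- A stopping-time construction. Around almost every point of `E` there is a largest cube on
which `E` has density at least `t`; the union `U` of a Besicovitch subfamily of these cubes is
larger than `E` by a factor `1 / t` for Lebesgue measure but only by a factor `φ` for `ν`. -/
lemma ComparableAt.exists_enlargement {ν : Measure (Fin n → ℝ)} {t φ : ℝ≥0∞}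
    (hP : ComparableAt ν t φ) (ht : t < 1) {c : Fin n → ℝ} {k : ℤ} {E : Set (Fin n → ℝ)}
    (hE : MeasurableSet E) (hEQ : E ⊆ dyadicCube c k)
    (hsmall : volume E < t * volume (dyadicCube c k)) :
    ∃ U : Set (Fin n → ℝ), MeasurableSet U ∧ U ⊆ dyadicCube c (k + 1) ∧
      volume E ≤ 2 ^ n * t * besicovitchConst n * volume U ∧
      ν U ≤ besicovitchConst n * φ * ν E := by
  have hdens := ae_exists_stopping_scale ht hE hsmall
  set A : Set (Fin n → ℝ) := {x | x ∈ E ∧ ∃ j : ℤ, j < k ∧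
      t * volume (dyadicCube x j) ≤ volume (E ∩ dyadicCube x j) ∧
      volume (E ∩ dyadicCube x j) ≤ 2 ^ n * t * volume (dyadicCube x j)} with hA
  have hch : ∀ x : Fin n → ℝ, ∃ j : ℤ, x ∈ A → (j < k ∧
      t * volume (dyadicCube x j) ≤ volume (E ∩ dyadicCube x j) ∧
      volume (E ∩ dyadicCube x j) ≤ 2 ^ n * t * volume (dyadicCube x j)) := by
    intro x
    by_cases hx : x ∈ A
    · obtain ⟨_, j, hj⟩ := hx
      exact ⟨j, fun _ => hj⟩
    · exact ⟨0, fun h => absurd h hx⟩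
  choose j hj using hch
  obtain ⟨s, hs1, hs2, hs3, hs4⟩ := besicovitchConst_spec A j k fun x hx => (hj x hx).1.le
  set U := ⋃ x ∈ s, dyadicCube x (j x) with hU
  have hEU : E ≤ᵐ[volume] U := by
    filter_upwards [hdens] with x hx hxE
    exact hs3 ⟨hxE, hx hxE⟩
  refine ⟨U, MeasurableSet.biUnion hs2 fun x _ => measurableSet_dyadicCube _ _, ?_, ?_, ?_⟩
  · refine iUnion₂_subset fun x hx => ?_
    have h1 := hs1 hx
    exact dyadicCube_subset_of_dist_le (k := k) (hEQ h1.1) (by have := (hj x h1).1; omega)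
      (by omega)
  · calc volume E ≤ volume.restrict E U := by
          rw [Measure.restrict_apply' hE]
          refine measure_mono_ae ?_
          filter_upwards [hEU] with x hx hxE
          exact ⟨hx hxE, hxE⟩
      _ ≤ ∑' x : s, volume.restrict E (dyadicCube (x : Fin n → ℝ) (j x)) :=
          measure_biUnion_le _ hs2 _
      _ ≤ ∑' x : s, 2 ^ n * t * volume (dyadicCube (x : Fin n → ℝ) (j x)) := by
          refine ENNReal.tsum_le_tsum fun x => ?_
          rw [Measure.restrict_apply' hE, inter_comm]
          exact (hj x (hs1 x.2)).2.2
      _ = 2 ^ n * t * ∑' x : s, volume (dyadicCube (x : Fin n → ℝ) (j x)) := by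
          rw [ENNReal.tsum_mul_left]
      _ ≤ 2 ^ n * t * (besicovitchConst n * volume U) := mul_le_mul_right (hs4 volume) _
      _ = _ := by ring
  · calc ν U ≤ ∑' x : s, ν (dyadicCube (x : Fin n → ℝ) (j x)) :=
          measure_biUnion_le _ hs2 _
      _ ≤ ∑' x : s, φ * ν.restrict E (dyadicCube (x : Fin n → ℝ) (j x)) := by
          refine ENNReal.tsum_le_tsum fun x => ?_
          rw [Measure.restrict_apply' hE, inter_comm]
          exact hP x (j x) (E ∩ dyadicCube x (j x)) (hE.inter (measurableSet_dyadicCube _ _))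
            inter_subset_right (hj x (hs1 x.2)).2.1
      _ = φ * ∑' x : s, ν.restrict E (dyadicCube (x : Fin n → ℝ) (j x)) := by
          rw [ENNReal.tsum_mul_left]
      _ ≤ φ * (besicovitchConst n * ν E) := by
          refine mul_le_mul_right ((hs4 _).trans (mul_le_mul_right ?_ _)) _
          exact (measure_mono (subset_univ _)).trans (by simp)
      _ = _ := by ring

/-- The overlap constant, increased by one so that it does not vanish. -/
noncomputable def overlapConst (n : ℕ) : ℝ≥0∞ := besicovitchConst n + 1

lemma overlapConst_ne_top (n : ℕ) : overlapConst n ≠ ∞ := by simp [overlapConst]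

lemma one_le_overlapConst (n : ℕ) : 1 ≤ overlapConst n := le_add_self

lemma besicovitchConst_le (n : ℕ) : (besicovitchConst n : ℝ≥0∞) ≤ overlapConst n := le_self_add

/-- The comparison bounds are submultiplicative, up to a dimensional constant. -/
lemma ComparableAt.mul {ν : Measure (Fin n → ℝ)} {t φ t' φ' : ℝ≥0∞}
    (h : ComparableAt ν t φ) (h' : ComparableAt ν t' φ') (ht : t < 1) (ht0 : t ≠ 0) (hφ' : 1 ≤ φ') :
    ComparableAt ν (4 ^ n * overlapConst n * t * t') (overlapConst n * φ * φ') := by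
  intro c k E hE hEQ hle
  have hL0 : overlapConst n ≠ 0 := (zero_lt_one.trans_le (one_le_overlapConst n)).ne'
  rcases le_or_gt (t * volume (dyadicCube c k)) (volume E) with h1 | h1
  · calc ν (dyadicCube c k) ≤ 1 * φ * 1 * ν E := by simpa using h c k E hE hEQ h1
      _ ≤ _ := by gcongr; exact one_le_overlapConst n
  · obtain ⟨U, hU1, hU2, hU3, hU4⟩ := h.exists_enlargement ht hE hEQ h1
    have h2 : t' * volume (dyadicCube c (k + 1)) ≤ volume U := by
      have h3 : (2 ^ n * overlapConst n * t) * (t' * volume (dyadicCube c (k + 1))) ≤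
          (2 ^ n * overlapConst n * t) * volume U := by
        calc (2 ^ n * overlapConst n * t) * (t' * volume (dyadicCube c (k + 1)))
            = 4 ^ n * overlapConst n * t * t' * volume (dyadicCube c k) := by
              rw [volume_dyadicCube_add_one c c, show (4 : ℝ≥0∞) = 2 * 2 by norm_num, mul_pow]
              ring
          _ ≤ volume E := hle
          _ ≤ 2 ^ n * t * besicovitchConst n * volume U := hU3
          _ ≤ 2 ^ n * t * overlapConst n * volume U := by
              gcongr; exact besicovitchConst_le n
          _ = _ := by ring
      refine (ENNReal.mul_le_mul_iff_right ?_ ?_).1 h3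
      · exact mul_ne_zero (mul_ne_zero (by simp) hL0) ht0
      · exact ENNReal.mul_ne_top (ENNReal.mul_ne_top (by simp) (overlapConst_ne_top n))
          (ht.trans ENNReal.one_lt_top).ne
    calc ν (dyadicCube c k) ≤ ν (dyadicCube c (k + 1)) :=
          measure_mono (dyadicCube_mono c (by omega))
      _ ≤ φ' * ν U := h' c (k + 1) U hU1 hU2 h2
      _ ≤ φ' * (besicovitchConst n * φ * ν E) := by gcongr
      _ ≤ φ' * (overlapConst n * φ * ν E) := by gcongr; exact besicovitchConst_le n
      _ = _ := by ring

lemma ComparableAt.pow {ν : Measure (Fin n → ℝ)} (hν : ν ≪ volume) {t φ : ℝ≥0∞}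
    (h : ComparableAt ν t φ) (ht : t < 1) (ht0 : t ≠ 0) (hφ : 1 ≤ φ) (j : ℕ) :
    ComparableAt ν ((4 ^ n * overlapConst n * t) ^ j) ((overlapConst n * φ) ^ j) := by
  induction j with
  | zero =>
    intro c k E hE hEQ hle
    rw [pow_zero, one_mul] at hle ⊢
    have h1 : volume (dyadicCube c k \ E) = 0 := by
      rw [measure_sdiff hEQ hE.nullMeasurableSet
        (ne_top_of_le_ne_top (volume_dyadicCube_ne_top c k) (measure_mono hEQ))]
      exact tsub_eq_zero_of_le hle
    have h2 := hν h1
    calc ν (dyadicCube c k) ≤ ν (dyadicCube c k \ E) + ν E := by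
          refine (measure_mono ?_).trans (measure_union_le _ _)
          rw [sdiff_union_self]; exact subset_union_left
      _ = ν E := by rw [h2, zero_add]
  | succ j ih =>
    have h1 : 1 ≤ (overlapConst n * φ) ^ j :=
      one_le_pow₀ (one_le_mul_of_one_le_of_one_le (one_le_overlapConst n) hφ)
    rw [pow_succ', pow_succ']
    exact h.mul ih ht ht0 h1

/-- If a single comparison bound beats the power `t^{-p}` by enough, then `ν` satisfies a power
bound with an exponent `s < p`. -/
lemma ComparableAt.exists_rpow {ν : Measure (Fin n → ℝ)} (hν : ν ≪ volume) {t φ : ℝ≥0∞} {p : ℝ}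
    (hp : 1 < p) (h : ComparableAt ν t φ) (ht0 : t ≠ 0) (hφ : 1 ≤ φ)
    (ht : 4 ^ n * overlapConst n * t < 1)
    (hgain : overlapConst n * φ * (4 ^ n * overlapConst n * t) ^ p < 1) :
    ∃ s : ℝ, 1 < s ∧ s < p ∧ ∃ K : ℝ≥0∞, K ≠ ∞ ∧
      ∀ (c : Fin n → ℝ) (k : ℤ) (E : Set (Fin n → ℝ)), MeasurableSet E → E ⊆ dyadicCube c k →
        volume E ^ s * ν (dyadicCube c k) ≤ K * volume (dyadicCube c k) ^ s * ν E := by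
  set θ := 4 ^ n * overlapConst n * t with hθ
  have hL0 : overlapConst n ≠ 0 := (zero_lt_one.trans_le (one_le_overlapConst n)).ne'
  have hθ0 : θ ≠ 0 := mul_ne_zero (mul_ne_zero (by simp) hL0) ht0
  have hθt : θ ≠ ∞ := (ht.trans ENNReal.one_lt_top).ne
  have ht1 : t < 1 := by
    refine lt_of_le_of_lt ?_ ht
    calc t = 1 * 1 * t := by simp
      _ ≤ θ := by
        rw [hθ]; gcongr
        · exact one_le_pow₀ (by norm_num)
        · exact one_le_overlapConst n
  -- The strict inequality persists for exponents slightly smaller than `p`.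
  obtain ⟨s, hs1, hsp, hs⟩ : ∃ s : ℝ, 1 < s ∧ s < p ∧ overlapConst n * φ * θ ^ s < 1 := by
    have hφt : overlapConst n * φ ≠ ∞ := by
      intro htop
      rw [htop, ENNReal.top_mul (ENNReal.rpow_pos (pos_iff_ne_zero.2 hθ0) hθt).ne'] at hgain
      exact absurd hgain (by simp)
    have hcont : Filter.Tendsto (fun s : ℝ => overlapConst n * φ * θ ^ s) (nhdsWithin p (Iio p))
        (nhds (overlapConst n * φ * θ ^ p)) := by
      refine ENNReal.Tendsto.const_mul ?_ (Or.inr hφt)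
      have hr : 0 < θ.toReal := ENNReal.toReal_pos hθ0 hθt
      have h1 : ∀ s : ℝ, θ ^ s = ENNReal.ofReal (θ.toReal ^ s) := fun s => by
        rw [← ENNReal.ofReal_rpow_of_pos hr, ENNReal.ofReal_toReal hθt]
      rw [h1, show (HPow.hPow θ : ℝ → ℝ≥0∞) = fun s => ENNReal.ofReal (θ.toReal ^ s) from funext h1]
      refine ENNReal.tendsto_ofReal ?_
      exact ((Real.continuousAt_const_rpow hr.ne').tendsto).mono_left nhdsWithin_le_nhds
    have h2 := hcont.eventually (gt_mem_nhds hgain)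
    have h3 : ∀ᶠ s in nhdsWithin p (Iio p), 1 < s :=
      nhdsWithin_le_nhds (lt_mem_nhds hp)
    obtain ⟨s, hs1, hs2, hs3⟩ := (h2.and (h3.and self_mem_nhdsWithin)).exists
    exact ⟨s, hs2, hs3, hs1⟩
  have hs0 : 0 < s := by linarith
  refine ⟨s, hs1, hsp, (θ ^ s)⁻¹, ENNReal.inv_ne_top.2
    (ENNReal.rpow_pos (pos_iff_ne_zero.2 hθ0) hθt).ne', fun c k E hE hEQ => ?_⟩
  set V := volume (dyadicCube c k) with hV
  have hV0 : V ≠ 0 := volume_dyadicCube_ne_zero c k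
  have hVt : V ≠ ∞ := volume_dyadicCube_ne_top c k
  have hEV : volume E ≤ V := measure_mono hEQ
  have hEt : volume E ≠ ∞ := ne_top_of_le_ne_top hVt hEV
  rcases eq_or_ne (volume E) 0 with hE0 | hE0
  · rw [hE0, ENNReal.zero_rpow_of_pos hs0, zero_mul]; exact zero_le
  -- Locate the density of `E` between two powers of `θ`, and iterate the bound that many times.
  obtain ⟨j, hj1, hj2⟩ : ∃ j : ℕ, θ ^ (j + 1) * V ≤ volume E ∧ volume E ≤ θ ^ j * V := by
    have hρ0 : 0 < (volume E / V).toReal := ENNReal.toReal_pos (by simp [hE0, hVt])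
      (ENNReal.div_ne_top hEt hV0)
    have hρ1 : (volume E / V).toReal ≤ 1 := by
      refine ENNReal.toReal_le_of_le_ofReal zero_le_one ?_
      rw [ENNReal.ofReal_one]
      exact ENNReal.div_le_of_le_mul (by rwa [one_mul])
    obtain ⟨j, h1, h2⟩ := exists_nat_pow_near_of_lt_one hρ0 hρ1
      (ENNReal.toReal_pos hθ0 hθt) (by
        rw [← ENNReal.toReal_one]; exact (ENNReal.toReal_lt_toReal hθt (by simp)).2 ht)
    rw [← ENNReal.toReal_pow] at h1 h2
    have hd : volume E / V ≠ ∞ := ENNReal.div_ne_top hEt hV0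
    refine ⟨j, ?_, ?_⟩
    · have := (ENNReal.toReal_lt_toReal (ENNReal.pow_ne_top hθt) hd).1 h1
      exact (ENNReal.le_div_iff_mul_le (Or.inl hV0) (Or.inl hVt)).1 this.le
    · have := (ENNReal.toReal_le_toReal hd (ENNReal.pow_ne_top hθt)).1 h2
      exact (ENNReal.div_le_iff_le_mul (Or.inl hV0) (Or.inl hVt)).1 this
  have hb := h.pow hν ht1 ht0 hφ (j + 1) c k E hE hEQ hj1
  have hθs0 : θ ^ s ≠ 0 := (ENNReal.rpow_pos (pos_iff_ne_zero.2 hθ0) hθt).ne'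
  have hθst : θ ^ s ≠ ∞ := ENNReal.rpow_ne_top_of_ne_zero hθ0 hθt
  have h1 : volume E ^ s ≤ (θ ^ s) ^ j * V ^ s := by
    calc volume E ^ s ≤ (θ ^ j * V) ^ s := ENNReal.rpow_le_rpow hj2 hs0.le
      _ = _ := by
        rw [ENNReal.mul_rpow_of_nonneg _ _ hs0.le, ← ENNReal.rpow_natCast, ← ENNReal.rpow_mul,
          mul_comm (j : ℝ), ENNReal.rpow_mul, ENNReal.rpow_natCast]
  have h2 : (θ ^ s) ^ (j + 1) * (overlapConst n * φ) ^ (j + 1) ≤ 1 := by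
    rw [← mul_pow, mul_comm]
    exact pow_le_one₀ zero_le hs.le
  calc volume E ^ s * ν (dyadicCube c k)
      ≤ ((θ ^ s) ^ j * V ^ s) * ((overlapConst n * φ) ^ (j + 1) * ν E) := by gcongr
    _ = ((θ ^ s)⁻¹ * θ ^ s) * (θ ^ s) ^ j * V ^ s * ((overlapConst n * φ) ^ (j + 1) * ν E) := by
        rw [ENNReal.inv_mul_cancel hθs0 hθst, one_mul]
    _ = (θ ^ s)⁻¹ * V ^ s * ν E * ((θ ^ s) ^ (j + 1) * (overlapConst n * φ) ^ (j + 1)) := by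
        rw [pow_succ' (θ ^ s)]; ring
    _ ≤ (θ ^ s)⁻¹ * V ^ s * ν E * 1 := by gcongr
    _ = _ := mul_one _

/-! ### Self-improvement of the class `A(p,q)` -/

/-- The test functions `∑_{j < m} 2^{-j} 1_{t < a 2^{jp}}` behave like `t^{-1/p}` on `m` dyadic
scales, so that the `q`-th power of their norm grows only linearly in `m`. -/
lemma lintegral_sum_indicator_rpow_le {p q : ℝ} (hp : 0 < p) (hq : 0 < q) (a : ℝ≥0∞) (m : ℕ) :
    ∫⁻ t, (∑ j ∈ Finset.range m, 2⁻¹ ^ j *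
      {t : ℝ | ENNReal.ofReal t < a * (2 ^ j) ^ p}.indicator (1 : ℝ → ℝ≥0∞) t) ^ q
        ∂powerMeasure (q / p) ≤
      2 ^ q * (m * a ^ (q / p) / ENNReal.ofReal (q / p)) := by
  have hm : ∀ j : ℕ, MeasurableSet {t : ℝ | ENNReal.ofReal t < a * (2 ^ j) ^ p} := fun j =>
    measurableSet_lt ENNReal.measurable_ofReal measurable_const
  have hpt : ∀ t : ℝ, (∑ j ∈ Finset.range m, 2⁻¹ ^ j *
      {t : ℝ | ENNReal.ofReal t < a * (2 ^ j) ^ p}.indicator (1 : ℝ → ℝ≥0∞) t) ^ q ≤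
      2 ^ q * ∑ j ∈ Finset.range m, (2⁻¹ ^ j) ^ q *
        {t : ℝ | ENNReal.ofReal t < a * (2 ^ j) ^ p}.indicator (1 : ℝ → ℝ≥0∞) t := by
    intro t
    by_cases hex : ∃ j, j < m ∧ ENNReal.ofReal t < a * (2 ^ j) ^ p
    · classical
      set i := Nat.find hex with hi
      obtain ⟨him, hit⟩ := Nat.find_spec hex
      have h1 : ∑ j ∈ Finset.range m, 2⁻¹ ^ j *
          {t : ℝ | ENNReal.ofReal t < a * (2 ^ j) ^ p}.indicator (1 : ℝ → ℝ≥0∞) t ≤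
          2 * 2⁻¹ ^ i := by
        have h2 : ∀ j ∈ Finset.range m, 2⁻¹ ^ j *
            {t : ℝ | ENNReal.ofReal t < a * (2 ^ j) ^ p}.indicator (1 : ℝ → ℝ≥0∞) t ≤
            if i ≤ j then (2⁻¹ : ℝ≥0∞) ^ j else 0 := by
          intro j hj
          split_ifs with hij
          · calc (2⁻¹ : ℝ≥0∞) ^ j * _ ≤ 2⁻¹ ^ j * 1 := by
                  gcongr
                  exact indicator_le_self' (fun _ _ => zero_le) t
              _ = _ := mul_one _
          · have h3 : ¬ ENNReal.ofReal t < a * (2 ^ j) ^ p := fun h =>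
              hij (Nat.find_min' hex ⟨Finset.mem_range.1 hj, h⟩)
            rw [indicator_of_notMem (by exact h3), mul_zero]
        refine (Finset.sum_le_sum h2).trans ((ENNReal.sum_le_tsum _).trans ?_)
        have h3 : ∑' j : ℕ, (if i ≤ j then (2⁻¹ : ℝ≥0∞) ^ j else 0) =
            ∑' j : ℕ, (2⁻¹ : ℝ≥0∞) ^ (j + i) := by
          have hinj : Function.Injective fun j : ℕ => j + i := add_left_injective i
          rw [← hinj.tsum_eq (f := fun j : ℕ => if i ≤ j then (2⁻¹ : ℝ≥0∞) ^ j else 0)]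
          · simp
          · intro j hj
            have : i ≤ j := by
              by_contra hlt
              simp [hlt] at hj
            exact ⟨j - i, by simp [this]⟩
        rw [h3]
        simp only [pow_add]
        rw [ENNReal.tsum_mul_right, ENNReal.tsum_geometric, ENNReal.one_sub_inv_two, inv_inv]
      calc _ ≤ (2 * 2⁻¹ ^ i) ^ q := ENNReal.rpow_le_rpow h1 hq.le
        _ = 2 ^ q * ((2⁻¹ ^ i) ^ q *
          {t : ℝ | ENNReal.ofReal t < a * (2 ^ i) ^ p}.indicator (1 : ℝ → ℝ≥0∞) t) := by
            rw [indicator_of_mem (by exact hit), Pi.one_apply, mul_one,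
              ENNReal.mul_rpow_of_nonneg _ _ hq.le]
        _ ≤ _ := by
            refine mul_le_mul_right (Finset.single_le_sum (f := fun j : ℕ => (2⁻¹ ^ j) ^ q *
              {t : ℝ | ENNReal.ofReal t < a * (2 ^ j) ^ p}.indicator (1 : ℝ → ℝ≥0∞) t)
              (fun _ _ => zero_le) (Finset.mem_range.2 him)) _
    · have h1 : ∑ j ∈ Finset.range m, 2⁻¹ ^ j *
          {t : ℝ | ENNReal.ofReal t < a * (2 ^ j) ^ p}.indicator (1 : ℝ → ℝ≥0∞) t = 0 := by
        refine Finset.sum_eq_zero fun j hj => ?_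
        have h3 : ¬ ENNReal.ofReal t < a * (2 ^ j) ^ p := fun h =>
          hex ⟨j, Finset.mem_range.1 hj, h⟩
        rw [indicator_of_notMem (by exact h3), mul_zero]
      rw [h1, ENNReal.zero_rpow_of_pos hq]
      exact zero_le
  refine (lintegral_mono hpt).trans_eq ?_
  have hθ : 0 < q / p := by positivity
  rw [lintegral_const_mul _ (Finset.measurable_fun_sum _ fun j _ =>
      (measurable_one.indicator (hm j)).const_mul _),
    lintegral_finsetSum _ fun j _ => (measurable_one.indicator (hm j)).const_mul _]
  have h1 : ∀ j ∈ Finset.range m, ∫⁻ t, (2⁻¹ ^ j) ^ q *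
      {t : ℝ | ENNReal.ofReal t < a * (2 ^ j) ^ p}.indicator (1 : ℝ → ℝ≥0∞) t
        ∂powerMeasure (q / p) = a ^ (q / p) / ENNReal.ofReal (q / p) := by
    intro j _
    rw [lintegral_const_mul _ (measurable_one.indicator (hm j)), lintegral_indicator_one (hm j),
      powerMeasure_lt hθ, ENNReal.mul_rpow_of_nonneg _ _ hθ.le, ← ENNReal.rpow_mul,
      mul_div_cancel₀ _ hp.ne', ← mul_div_assoc, mul_left_comm,
      ← ENNReal.mul_rpow_of_nonneg _ _ hq.le,
      ← mul_pow, ENNReal.inv_mul_cancel (by norm_num) (by norm_num), one_pow, ENNReal.one_rpow,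
      mul_one]
  rw [Finset.sum_congr rfl h1, Finset.sum_const, Finset.card_range, nsmul_eq_mul, mul_div_assoc]

/-- The condition `A(p,q)`, for a measurable weight with values in `[0,∞]` and for cubes with
dyadic side lengths. -/
structure IsLorentzWeight (p q : ℝ) (C : ℝ≥0∞) (w : (Fin n → ℝ) → ℝ≥0∞) : Prop where
  measurable : Measurable w
  pos : ∀ᵐ x, w x ≠ 0
  lt_top : ∀ᵐ x, w x ≠ ∞
  finite : ∀ (c : Fin n → ℝ) (k : ℤ), volume.withDensity w (dyadicCube c k) ≠ ∞
  bound : ∀ (c : Fin n → ℝ) (k : ℤ), volume.withDensity w (dyadicCube c k) ^ (1 / p) *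
    lorentzNorm (volume.withDensity w) p.conjExponent q.conjExponent
      ((dyadicCube c k).indicator fun x => (w x)⁻¹) ≤ C * volume (dyadicCube c k)

/-- The condition `A(p,q)` tested against functions `∑_{j < m} 2^{-j} 1_{U_j}` for which
`ν(U_j)` grows at most like `2^{jp}`. -/
lemma IsLorentzWeight.exists_sum_volume_le {p q : ℝ} {C : ℝ≥0∞} {w : (Fin n → ℝ) → ℝ≥0∞}
    (h : IsLorentzWeight p q C w) (hp : 1 < p) (hq : 1 < q) (hC : C ≠ ∞) :
    ∃ D : ℝ≥0∞, D ≠ ∞ ∧ ∀ (c : Fin n → ℝ) (k : ℤ) (U : ℕ → Set (Fin n → ℝ)) (a : ℝ≥0∞) (m : ℕ),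
      (∀ j < m, MeasurableSet (U j)) → (∀ j < m, U j ⊆ dyadicCube c k) →
      (∀ j < m, volume.withDensity w (U j) ≤ a * (2 ^ j) ^ p) →
      volume.withDensity w (dyadicCube c k) ^ (1 / p) *
        ∑ j ∈ Finset.range m, 2⁻¹ ^ j * volume (U j) ≤
      D * volume (dyadicCube c k) * (m * a ^ (q / p)) ^ (1 / q) := by
  have hp0 : 0 < p := by linarith
  have hq0 : 0 < q := by linarith
  have hp' := Real.HolderConjugate.conjExponent hp
  have hq' := Real.HolderConjugate.conjExponent hq
  have hw := h.measurable
  have hpow : ∀ x y : ℝ, 0 < x → 0 < y → (ENNReal.ofReal (x / y))⁻¹ ≠ ∞ := fun x y hx hy => by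
    simpa using div_pos hx hy
  set D1 : ℝ≥0∞ := (ENNReal.ofReal (q.conjExponent / p.conjExponent))⁻¹ ^ (1 / q.conjExponent)
  set D2 : ℝ≥0∞ := (2 ^ q * (ENNReal.ofReal (q / p))⁻¹) ^ (1 / q)
  have hD1 : D1 ≠ ∞ := ENNReal.rpow_ne_top_of_nonneg hq'.symm.one_div_nonneg
    (hpow _ _ hq'.symm.pos hp'.symm.pos)
  have hD2 : D2 ≠ ∞ := ENNReal.rpow_ne_top_of_nonneg hq'.one_div_nonneg
    (ENNReal.mul_ne_top (two_rpow_ne_top _) (hpow _ _ hq0 hp0))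
  refine ⟨2 * geomSum 1 * D1 * D2 * C, ?_, ?_⟩
  · exact ENNReal.mul_ne_top (ENNReal.mul_ne_top (ENNReal.mul_ne_top (ENNReal.mul_ne_top (by simp)
      (geomSum_ne_top one_pos)) hD1) hD2) hC
  intro c k U a m hU hUQ hUa
  set ν := volume.withDensity w with hν
  set f : (Fin n → ℝ) → ℝ≥0∞ := (dyadicCube c k).indicator fun x => (w x)⁻¹ with hf
  have hfm : Measurable f := hw.inv.indicator (measurableSet_dyadicCube _ _)
  have hvol : ∀ j < m, volume (U j) = ∫⁻ x in U j, f x ∂ν := by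
    intro j hj
    rw [hν, restrict_withDensity (hU j hj), lintegral_withDensity_eq_lintegral_mul _ hw hfm,
      ← setLIntegral_one]
    refine lintegral_congr_ae ?_
    filter_upwards [ae_restrict_mem (hU j hj), ae_restrict_of_ae h.pos, ae_restrict_of_ae h.lt_top]
      with x h1 h2 h3
    rw [Pi.mul_apply, hf, indicator_of_mem (hUQ j hj h1), ENNReal.mul_inv_cancel h2 h3]
  have hm : ∀ b : ℝ≥0∞, Measurable ({t : ℝ | ENNReal.ofReal t < b}.indicator (1 : ℝ → ℝ≥0∞)) :=
    fun b => measurable_one.indicator (measurableSet_lt ENNReal.measurable_ofReal measurable_const)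
  set F : ℝ → ℝ≥0∞ := fun t => ∑ j ∈ Finset.range m, 2⁻¹ ^ j *
      {t : ℝ | ENNReal.ofReal t < a * (2 ^ j) ^ p}.indicator (1 : ℝ → ℝ≥0∞) t with hF
  have hFm : Measurable F := Finset.measurable_fun_sum _ fun j _ => (hm _).const_mul _
  have h1 : ∑ j ∈ Finset.range m, 2⁻¹ ^ j * volume (U j) ≤
      2 * geomSum 1 * ∫⁻ t in Ioi (0 : ℝ), rearrangement ν f t * F t := by
    have e1 : ∫⁻ t in Ioi (0 : ℝ), rearrangement ν f t * F t =
        ∑ j ∈ Finset.range m, 2⁻¹ ^ j * ∫⁻ t in Ioi (0 : ℝ), rearrangement ν f t *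
          {t : ℝ | ENNReal.ofReal t < a * (2 ^ j) ^ p}.indicator (1 : ℝ → ℝ≥0∞) t := by
      simp only [hF, Finset.mul_sum]
      have hmm : ∀ b : ℝ≥0∞, Measurable fun t => rearrangement ν f t *
          {t : ℝ | ENNReal.ofReal t < b}.indicator (1 : ℝ → ℝ≥0∞) t := fun b =>
        (measurable_rearrangement ν f).mul (hm b)
      simp only [mul_left_comm (rearrangement ν f _)]
      rw [lintegral_finsetSum _ fun j _ => (hmm _).const_mul _]
      exact Finset.sum_congr rfl fun j _ => lintegral_const_mul _ (hmm _)
    rw [e1, Finset.mul_sum]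
    refine Finset.sum_le_sum fun j hj => ?_
    have hj' := Finset.mem_range.1 hj
    rw [hvol j hj', mul_left_comm]
    refine mul_le_mul_right ((setLIntegral_le_rearrangement ν hfm (U j)).trans ?_) _
    refine mul_le_mul_right (lintegral_mono fun t => mul_le_mul_right ?_ _) _
    exact indicator_le_indicator_of_subset (fun t ht => lt_of_lt_of_le ht (hUa j hj'))
      (fun _ => zero_le) t
  have h2 := lintegral_rearrangement_mul_le ν f hFm hp hq
  have h3 : (∫⁻ t, F t ^ q ∂powerMeasure (q / p)) ^ (1 / q) ≤
      D2 * (m * a ^ (q / p)) ^ (1 / q) := by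
    rw [← ENNReal.mul_rpow_of_nonneg _ _ hq'.one_div_nonneg]
    refine ENNReal.rpow_le_rpow ((lintegral_sum_indicator_rpow_le hp0 hq0 a m).trans_eq ?_)
      hq'.one_div_nonneg
    rw [div_eq_mul_inv]; ring
  set L := lorentzNorm ν p.conjExponent q.conjExponent f with hL
  calc ν (dyadicCube c k) ^ (1 / p) * ∑ j ∈ Finset.range m, 2⁻¹ ^ j * volume (U j)
      ≤ ν (dyadicCube c k) ^ (1 / p) * (2 * geomSum 1 *
          (D1 * L * (D2 * (m * a ^ (q / p)) ^ (1 / q)))) := by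
        refine mul_le_mul_right (h1.trans (mul_le_mul_right (h2.trans ?_) _)) _
        exact mul_le_mul_right h3 _
    _ = 2 * geomSum 1 * D1 * D2 * (ν (dyadicCube c k) ^ (1 / p) * L) *
          (m * a ^ (q / p)) ^ (1 / q) := by ring
    _ ≤ 2 * geomSum 1 * D1 * D2 * (C * volume (dyadicCube c k)) *
          (m * a ^ (q / p)) ^ (1 / q) := by
        refine mul_le_mul_left (mul_le_mul_right (h.bound c k) _) _
    _ = _ := by ring

/-- The restricted condition `ν(Q) ≤ K (|Q| / |E|)^p ν(E)`, in the form of comparison bounds. -/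
lemma IsLorentzWeight.exists_comparableAt {p q : ℝ} {C : ℝ≥0∞} {w : (Fin n → ℝ) → ℝ≥0∞}
    (h : IsLorentzWeight p q C w) (hp : 1 < p) (hq : 1 < q) (hC : C ≠ ∞) :
    ∃ K : ℝ≥0∞, K ≠ ∞ ∧ ∀ t : ℝ≥0∞, t ≠ 0 → t ≠ ∞ →
      ComparableAt (volume.withDensity w) t (K * (t⁻¹) ^ p) := by
  obtain ⟨D, hD, hsum⟩ := h.exists_sum_volume_le hp hq hC
  have hp0 : 0 < p := by linarith
  have hq0 : 0 < q := by linarith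
  refine ⟨D ^ p, ENNReal.rpow_ne_top_of_nonneg hp0.le hD, fun t ht0 htt c k E hE hEQ hle => ?_⟩
  set ν := volume.withDensity w with hν
  set V := volume (dyadicCube c k) with hV
  have hV0 : V ≠ 0 := volume_dyadicCube_ne_zero c k
  have hVt : V ≠ ∞ := volume_dyadicCube_ne_top c k
  have h1 := hsum c k (fun _ => E) (ν E) 1 (fun _ _ => hE) (fun _ _ => hEQ)
    (fun j hj => by
      have : j = 0 := by omega
      simp [this])
  simp only [Finset.range_one, Finset.sum_singleton, pow_zero, one_mul, Nat.cast_one,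
    ← ENNReal.rpow_mul] at h1
  rw [show q / p * (1 / q) = 1 / p by field_simp] at h1
  have h2 : ν (dyadicCube c k) ^ (1 / p) * (t * V) ≤ D * V * ν E ^ (1 / p) :=
    (mul_le_mul_right hle _).trans h1
  have h3 : ν (dyadicCube c k) ^ (1 / p) ≤ D * t⁻¹ * ν E ^ (1 / p) := by
    refine (ENNReal.mul_le_mul_iff_left (c := t * V) (mul_ne_zero ht0 hV0)
      (ENNReal.mul_ne_top htt hVt)).1 (h2.trans_eq ?_)
    calc D * V * ν E ^ (1 / p) = D * (t⁻¹ * t) * V * ν E ^ (1 / p) := by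
          rw [ENNReal.inv_mul_cancel ht0 htt, mul_one]
      _ = _ := by ring
  have h4 := ENNReal.rpow_le_rpow h3 hp0.le
  rwa [ENNReal.mul_rpow_of_nonneg _ _ hp0.le, ENNReal.mul_rpow_of_nonneg _ _ hp0.le,
    ← ENNReal.rpow_mul, ← ENNReal.rpow_mul, one_div_mul_cancel hp0.ne', ENNReal.rpow_one,
    ENNReal.rpow_one] at h4

/-- The logarithmic gain. Since `q > 1`, the test functions carrying `m` dyadic scales improve the
restricted condition at `t = 4^{-m}` by the factor `m^{-p(1 - 1/q)}`. -/
lemma IsLorentzWeight.exists_comparableAt_gain {p q : ℝ} {C : ℝ≥0∞} {w : (Fin n → ℝ) → ℝ≥0∞}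
    (h : IsLorentzWeight p q C w) (hp : 1 < p) (hq : 1 < q) (hC : C ≠ ∞) :
    ∃ K : ℝ≥0∞, K ≠ ∞ ∧ ∀ m : ℕ, m ≠ 0 →
      ComparableAt (volume.withDensity w) (4⁻¹ ^ m)
        (1 + K * (2 ^ m) ^ p + K * (4 ^ m) ^ p * ((m : ℝ≥0∞)⁻¹) ^ (p * (1 - 1 / q))) := by
  obtain ⟨D, hD, hsum⟩ := h.exists_sum_volume_le hp hq hC
  obtain ⟨K, hK, hcomp⟩ := h.exists_comparableAt hp hq hC
  have hp0 : 0 < p := by linarith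
  have hq0 : 0 < q := by linarith
  set N : ℝ≥0∞ := (besicovitchConst n : ℝ≥0∞) with hN
  have hNt : N ≠ ∞ := ENNReal.natCast_ne_top _
  set K' : ℝ≥0∞ := (4 ^ n * N * D) ^ p * (N * (K * 2 ^ p)) with hK'
  have hK't : K' ≠ ∞ := ENNReal.mul_ne_top (ENNReal.rpow_ne_top_of_nonneg hp0.le
    (ENNReal.mul_ne_top (ENNReal.mul_ne_top (by simp) hNt) hD))
    (ENNReal.mul_ne_top hNt (ENNReal.mul_ne_top hK (two_rpow_ne_top _)))
  refine ⟨K + K', ENNReal.add_ne_top.2 ⟨hK, hK't⟩, fun m hm c k E hE hEQ hle => ?_⟩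
  set ν := volume.withDensity w with hν
  set V := volume (dyadicCube c k) with hV
  have hV0 : V ≠ 0 := volume_dyadicCube_ne_zero c k
  have hVt : V ≠ ∞ := volume_dyadicCube_ne_top c k
  have hm0 : (m : ℝ≥0∞) ≠ 0 := by exact_mod_cast hm
  have hmt : (m : ℝ≥0∞) ≠ ∞ := ENNReal.natCast_ne_top _
  -- If `E` has density at least `2^{-m}`, the restricted condition alone suffices.
  rcases le_or_gt ((2⁻¹ : ℝ≥0∞) ^ m * V) (volume E) with hbig | hsmall
  · have h1 := hcomp (2⁻¹ ^ m) (pow_ne_zero _ (by simp)) (ENNReal.pow_ne_top (by simp)) c k E hE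
      hEQ hbig
    rw [← ENNReal.inv_pow, inv_inv] at h1
    refine h1.trans (mul_le_mul_left ?_ _)
    refine le_trans ?_ le_self_add
    refine le_trans ?_ le_add_self
    gcongr
    exact le_self_add
  -- The enlargements of `E` at the levels `2^{-(j+1)}`, `j < m`.
  have hex : ∀ j : ℕ, ∃ U : Set (Fin n → ℝ), j < m → MeasurableSet U ∧
      U ⊆ dyadicCube c (k + 1) ∧ volume E ≤ 2 ^ n * N * (2⁻¹ ^ j * volume U) ∧
      ν U ≤ N * (K * 2 ^ p) * ν E * (2 ^ j) ^ p := by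
    intro j
    by_cases hj : j < m
    · have ht1 : (2⁻¹ : ℝ≥0∞) ^ (j + 1) < 1 := pow_lt_one₀ zero_le (by simp) (by omega)
      have hlt : volume E < 2⁻¹ ^ (j + 1) * V := by
        refine hsmall.trans_le (mul_le_mul_left ?_ _)
        exact pow_le_pow_right_of_le_one' (by simp) hj
      obtain ⟨U, h1, h2, h3, h4⟩ := (hcomp (2⁻¹ ^ (j + 1)) (pow_ne_zero _ (by simp))
        (ENNReal.pow_ne_top (by simp))).exists_enlargement ht1 hE hEQ hlt
      refine ⟨U, fun _ => ⟨h1, h2, h3.trans ?_, h4.trans_eq ?_⟩⟩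
      · calc 2 ^ n * 2⁻¹ ^ (j + 1) * (besicovitchConst n : ℝ≥0∞) * volume U
            ≤ 2 ^ n * 2⁻¹ ^ j * (besicovitchConst n : ℝ≥0∞) * volume U := by
              gcongr 2 ^ n * ?_ * _ * _
              exact pow_le_pow_right_of_le_one' (by simp) (by omega)
          _ = _ := by rw [hN]; ring
      · rw [← ENNReal.inv_pow, inv_inv, pow_succ, ENNReal.mul_rpow_of_nonneg _ _ hp0.le, ← hN]
        ring
    · exact ⟨∅, fun h => absurd h hj⟩
  choose U hU using hex
  have h1 := hsum c (k + 1) U (N * (K * 2 ^ p) * ν E) m (fun j hj => (hU j hj).1)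
    (fun j hj => (hU j hj).2.1) (fun j hj => (hU j hj).2.2.2)
  have h2 : m * volume E ≤ 2 ^ n * N * ∑ j ∈ Finset.range m, 2⁻¹ ^ j * volume (U j) := by
    rw [Finset.mul_sum, ← nsmul_eq_mul, ← Finset.card_range m, ← Finset.sum_const,
      Finset.card_range]
    exact Finset.sum_le_sum fun j hj => (hU j (Finset.mem_range.1 hj)).2.2.1
  set a := N * (K * 2 ^ p) * ν E with ha
  have h3 : ν (dyadicCube c k) ^ (1 / p) * (m * (4⁻¹ ^ m * V)) ≤
      4 ^ n * N * D * V * (m ^ (1 / q) * a ^ (1 / p)) := by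
    calc ν (dyadicCube c k) ^ (1 / p) * (m * (4⁻¹ ^ m * V))
        ≤ ν (dyadicCube c (k + 1)) ^ (1 / p) *
          (2 ^ n * N * ∑ j ∈ Finset.range m, 2⁻¹ ^ j * volume (U j)) := by
          refine mul_le_mul' (ENNReal.rpow_le_rpow (measure_mono (dyadicCube_mono c (by omega)))
            (by positivity)) ?_
          exact (mul_le_mul_right hle _).trans h2
      _ = 2 ^ n * N * (ν (dyadicCube c (k + 1)) ^ (1 / p) *
          ∑ j ∈ Finset.range m, 2⁻¹ ^ j * volume (U j)) := by ring
      _ ≤ 2 ^ n * N * (D * volume (dyadicCube c (k + 1)) * (m * a ^ (q / p)) ^ (1 / q)) :=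
          mul_le_mul_right h1 _
      _ = _ := by
          rw [volume_dyadicCube_add_one c c, ENNReal.mul_rpow_of_nonneg _ _ (by positivity),
            ← ENNReal.rpow_mul, show q / p * (1 / q) = 1 / p by field_simp,
            show (4 : ℝ≥0∞) = 2 * 2 by norm_num, mul_pow]
          ring
  have hm1 : (m : ℝ≥0∞) ^ (1 / q) = m * (m : ℝ≥0∞)⁻¹ ^ (1 - 1 / q) := by
    rw [ENNReal.inv_rpow, ← ENNReal.rpow_neg]
    conv_rhs => enter [1]; rw [← ENNReal.rpow_one (m : ℝ≥0∞)]
    rw [← ENNReal.rpow_add _ _ hm0 hmt]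
    congr 1; ring
  have h4 : ν (dyadicCube c k) ^ (1 / p) ≤
      4 ^ n * N * D * 4 ^ m * (m : ℝ≥0∞)⁻¹ ^ (1 - 1 / q) * a ^ (1 / p) := by
    have h40 : (4⁻¹ : ℝ≥0∞) ^ m ≠ 0 := pow_ne_zero _ (by simp)
    have h4t : (4⁻¹ : ℝ≥0∞) ^ m ≠ ∞ := ENNReal.pow_ne_top (by simp)
    refine (ENNReal.mul_le_mul_iff_left (c := m * (4⁻¹ ^ m * V))
      (mul_ne_zero hm0 (mul_ne_zero h40 hV0))
      (ENNReal.mul_ne_top hmt (ENNReal.mul_ne_top h4t hVt))).1 (h3.trans_eq ?_)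
    have h5 : (4 : ℝ≥0∞) ^ m * 4⁻¹ ^ m = 1 := by
      rw [← mul_pow, ENNReal.mul_inv_cancel (by simp) (by simp), one_pow]
    rw [hm1]
    calc _ = 4 ^ n * N * D * V * (m * (m : ℝ≥0∞)⁻¹ ^ (1 - 1 / q) * a ^ (1 / p)) * 1 := by
          rw [mul_one]
      _ = _ := by rw [← h5]; ring
  have h6 := ENNReal.rpow_le_rpow h4 hp0.le
  rw [← ENNReal.rpow_mul, one_div_mul_cancel hp0.ne', ENNReal.rpow_one] at h6
  refine h6.trans ?_
  calc (4 ^ n * N * D * 4 ^ m * (m : ℝ≥0∞)⁻¹ ^ (1 - 1 / q) * a ^ (1 / p)) ^ p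
      = K' * (4 ^ m) ^ p * ((m : ℝ≥0∞)⁻¹) ^ (p * (1 - 1 / q)) * ν E := by
        simp only [ENNReal.mul_rpow_of_nonneg _ _ hp0.le, ← ENNReal.rpow_mul]
        rw [one_div_mul_cancel hp0.ne', ENNReal.rpow_one, ha, hK', mul_comm (1 - 1 / q) p]
        simp only [ENNReal.mul_rpow_of_nonneg _ _ hp0.le]
        ring
    _ ≤ _ := by
        refine mul_le_mul_left (le_trans ?_ le_add_self) _
        gcongr
        exact le_add_self

/-- An `A(p,q)` weight satisfies the restricted condition `|E|^s ν(Q) ≤ K |Q|^s ν(E)` with an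
exponent `s < p`. -/
lemma IsLorentzWeight.exists_rpow {p q : ℝ} {C : ℝ≥0∞} {w : (Fin n → ℝ) → ℝ≥0∞}
    (h : IsLorentzWeight p q C w) (hp : 1 < p) (hq : 1 < q) (hC : C ≠ ∞) :
    ∃ s : ℝ, 1 < s ∧ s < p ∧ ∃ K : ℝ≥0∞, K ≠ ∞ ∧
      ∀ (c : Fin n → ℝ) (k : ℤ) (E : Set (Fin n → ℝ)), MeasurableSet E → E ⊆ dyadicCube c k →
        volume E ^ s * volume.withDensity w (dyadicCube c k) ≤
          K * volume (dyadicCube c k) ^ s * volume.withDensity w E := by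
  obtain ⟨K, hK, hgain⟩ := h.exists_comparableAt_gain hp hq hC
  have hp0 : 0 < p := by linarith
  set L := overlapConst n
  have hLt : L ≠ ∞ := overlapConst_ne_top n
  have hq1 : 0 < p * (1 - 1 / q) := by
    have : 1 / q < 1 := by rw [div_lt_one (by linarith)]; exact hq
    exact mul_pos hp0 (by linarith)
  have hpow : ∀ b : ℝ≥0∞, b < 1 → Filter.Tendsto (fun m : ℕ => (b ^ m) ^ p) Filter.atTop
      (nhds 0) := by
    intro b hb
    have h1 := ((ENNReal.continuous_rpow_const (y := p)).tendsto 0).comp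
      (ENNReal.tendsto_pow_atTop_nhds_zero_of_lt_one hb)
    rwa [ENNReal.zero_rpow_of_pos hp0] at h1
  have hinv : Filter.Tendsto (fun m : ℕ => ((m : ℝ≥0∞)⁻¹) ^ (p * (1 - 1 / q))) Filter.atTop
      (nhds 0) := by
    have h1 := ((ENNReal.continuous_rpow_const (y := p * (1 - 1 / q))).tendsto 0).comp
      ENNReal.tendsto_inv_nat_nhds_zero
    rwa [ENNReal.zero_rpow_of_pos hq1] at h1
  have hlim1 : Filter.Tendsto (fun m : ℕ => 4 ^ n * L * (4⁻¹ : ℝ≥0∞) ^ m) Filter.atTop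
      (nhds 0) := by
    have := ENNReal.Tendsto.const_mul (a := 4 ^ n * L)
      (ENNReal.tendsto_pow_atTop_nhds_zero_of_lt_one (r := 4⁻¹) (by simp))
      (Or.inr (ENNReal.mul_ne_top (by simp) hLt))
    simpa using this
  have hlim2 : Filter.Tendsto (fun m : ℕ => L * (4 ^ n * L) ^ p * (((4⁻¹ : ℝ≥0∞) ^ m) ^ p +
      K * ((2⁻¹ : ℝ≥0∞) ^ m) ^ p + K * ((m : ℝ≥0∞)⁻¹) ^ (p * (1 - 1 / q)))) Filter.atTop
      (nhds 0) := by
    have h1 := (hpow 4⁻¹ (by simp)).add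
      (ENNReal.Tendsto.const_mul (a := K) (hpow 2⁻¹ (by simp)) (Or.inr hK))
    have h2 := h1.add (ENNReal.Tendsto.const_mul (a := K) hinv (Or.inr hK))
    have h3 := ENNReal.Tendsto.const_mul (a := L * (4 ^ n * L) ^ p) h2 (Or.inr
      (ENNReal.mul_ne_top hLt (ENNReal.rpow_ne_top_of_nonneg hp0.le
        (ENNReal.mul_ne_top (by simp) hLt))))
    simpa using h3
  -- For large `m` the logarithmic gain absorbs the dimensional constants lost in each iteration.
  obtain ⟨m, hm1, hm2, hm0⟩ := ((hlim1.eventually (gt_mem_nhds zero_lt_one)).and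
    ((hlim2.eventually (gt_mem_nhds zero_lt_one)).and (Filter.eventually_ne_atTop 0))).exists
  refine (hgain m hm0).exists_rpow (withDensity_absolutelyContinuous _ _) hp
    (pow_ne_zero _ (by simp)) ?_ hm1 (lt_of_eq_of_lt ?_ hm2)
  · rw [add_assoc]; exact le_self_add
  · have e4 : ((4 : ℝ≥0∞) ^ m) ^ p * (4⁻¹ ^ m) ^ p = 1 := by
      rw [← ENNReal.mul_rpow_of_nonneg _ _ hp0.le, ← mul_pow,
        ENNReal.mul_inv_cancel (by simp) (by simp), one_pow, ENNReal.one_rpow]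
    have e2 : ((2 : ℝ≥0∞) ^ m) ^ p * (4⁻¹ ^ m) ^ p = (2⁻¹ ^ m) ^ p := by
      rw [← ENNReal.mul_rpow_of_nonneg _ _ hp0.le, ← mul_pow]
      congr 3
      rw [show (4 : ℝ≥0∞) = 2 * 2 by norm_num, ENNReal.mul_inv (by simp) (by simp), ← mul_assoc,
        ENNReal.mul_inv_cancel (by simp) (by simp), one_mul]
    rw [ENNReal.mul_rpow_of_nonneg (4 ^ n * L) _ hp0.le]
    calc _ = L * (4 ^ n * L) ^ p * ((4⁻¹ ^ m) ^ p + K * (((2 : ℝ≥0∞) ^ m) ^ p * (4⁻¹ ^ m) ^ p) +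
          K * (((4 : ℝ≥0∞) ^ m) ^ p * (4⁻¹ ^ m) ^ p) * ((m : ℝ≥0∞)⁻¹) ^ (p * (1 - 1 / q))) := by
          ring
      _ = _ := by rw [e4, e2, mul_one]

/-! ### Muckenhoupt conditions from the restricted condition -/

/-- The restricted condition with exponent `s` implies the condition `A_u` for every `u > s`: it
bounds the level sets of `1 / w` on a cube by a power of exponent `1 / (s - 1)`. -/
lemma exists_isMuckenhouptPair {w : (Fin n → ℝ) → ℝ≥0∞} (hw : Measurable w)
    (hw0 : ∀ᵐ x, w x ≠ 0) (hwt : ∀ᵐ x, w x ≠ ∞)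
    (hfin : ∀ (c : Fin n → ℝ) (k : ℤ), volume.withDensity w (dyadicCube c k) ≠ ∞)
    {s : ℝ} (hs : 1 < s) {K : ℝ≥0∞} (hK : K ≠ ∞)
    (hR : ∀ (c : Fin n → ℝ) (k : ℤ) (E : Set (Fin n → ℝ)), MeasurableSet E →
      E ⊆ dyadicCube c k → volume E ^ s * volume.withDensity w (dyadicCube c k) ≤
        K * volume (dyadicCube c k) ^ s * volume.withDensity w E)
    {u v : ℝ} (huv : u.HolderConjugate v) (hsu : s < u) :
    ∃ K' : ℝ≥0∞, K' ≠ ∞ ∧ IsMuckenhouptPair u v K' w (fun x => w x ^ (1 - v)) := by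
  set α := v - 1 with hα
  set β := 1 / (s - 1) with hβ
  have hs0 : 0 < s - 1 := by linarith
  have hα0 : 0 < α := huv.symm.sub_one_pos
  have hβ0 : 0 < β := by positivity
  have hαβ : α < β := by
    have h1 : α = 1 / (u - 1) := by
      rw [hα, huv.conjugate_eq]
      have := huv.sub_one_ne_zero
      field_simp
      ring
    rw [h1, hβ]
    exact one_div_lt_one_div_of_lt hs0 (by linarith)
  set δ := min α (β - α) with hδ
  have hδ0 : 0 < δ := lt_min hα0 (by linarith)
  have hδ1 : δ ≤ α := min_le_left _ _
  have hδ2 : δ ≤ β - α := min_le_right _ _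
  set C1 : ℝ≥0∞ := 2 ^ α * ((1 + K ^ β) * geomSum δ) with hC1
  have hC1t : C1 ≠ ∞ := ENNReal.mul_ne_top (two_rpow_ne_top _) (ENNReal.mul_ne_top
    (ENNReal.add_ne_top.2 ⟨by simp, ENNReal.rpow_ne_top_of_nonneg hβ0.le hK⟩)
    (geomSum_ne_top hδ0))
  refine ⟨C1 ^ (1 / v), ENNReal.rpow_ne_top_of_nonneg huv.symm.one_div_nonneg hC1t,
    hw, hw.pow_const _, hw0, hwt, Filter.Eventually.of_forall fun _ => rfl, fun c k => ?_⟩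
  set V := volume (dyadicCube c k) with hV
  have hV0 : V ≠ 0 := volume_dyadicCube_ne_zero c k
  have hVt : V ≠ ∞ := volume_dyadicCube_ne_top c k
  have hWeq : ∫⁻ y in dyadicCube c k, w y = volume.withDensity w (dyadicCube c k) :=
    (withDensity_apply _ (measurableSet_dyadicCube _ _)).symm
  set W := volume.withDensity w (dyadicCube c k) with hW
  have hWt : W ≠ ∞ := hfin c k
  have hW0 : W ≠ 0 := by
    rw [← hWeq]; exact setLIntegral_dyadicCube_ne_zero hw hw0 c k
  rw [hWeq]
  have hWV0 : W / V ≠ 0 := by simp [hW0, hVt]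
  have hWVt : W / V ≠ ∞ := ENNReal.div_ne_top hWt hV0
  -- Normalize `1 / w` by the average of `w` on the cube.
  set g : (Fin n → ℝ) → ℝ≥0∞ := fun x => (w x)⁻¹ * (W / V) with hg
  have hgm : Measurable g := hw.inv.mul_const _
  -- The restricted condition for the set where `g > 2^j`, on which `ν` has density at most
  -- `2^{-j} W / V`.
  have hlevel : ∀ j : ℤ, volume.restrict (dyadicCube c k) {x | (2 : ℝ≥0∞) ^ (j : ℝ) < g x} ≤
      (K * 2 ^ (-(j : ℝ))) ^ β * V := by
    intro j
    have hEm : MeasurableSet ({x | (2 : ℝ≥0∞) ^ (j : ℝ) < g x} ∩ dyadicCube c k) :=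
      (measurableSet_lt measurable_const hgm).inter (measurableSet_dyadicCube _ _)
    rw [Measure.restrict_apply' (measurableSet_dyadicCube _ _)]
    set E := {x | (2 : ℝ≥0∞) ^ (j : ℝ) < g x} ∩ dyadicCube c k with hE
    have h1 := hR c k E hEm inter_subset_right
    have h2 : volume.withDensity w E ≤ 2 ^ (-(j : ℝ)) * (W / V) * volume E := by
      rw [withDensity_apply _ hEm, ← setLIntegral_const]
      refine setLIntegral_mono' hEm fun x hx => ?_
      have h3 : (2 : ℝ≥0∞) ^ (j : ℝ) ≤ g x := le_of_lt hx.1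
      have h4 : w x * 2 ^ (j : ℝ) ≤ W / V := by
        calc w x * 2 ^ (j : ℝ) ≤ w x * ((w x)⁻¹ * (W / V)) := mul_le_mul_right h3 _
          _ = w x * (w x)⁻¹ * (W / V) := by ring
          _ ≤ 1 * (W / V) := by gcongr; exact ENNReal.mul_inv_le_one _
          _ = _ := one_mul _
      calc w x = 2 ^ (-(j : ℝ)) * (w x * 2 ^ (j : ℝ)) := by
            rw [mul_left_comm, ← two_rpow_add]; simp
        _ ≤ _ := by gcongr
    have hEt : volume E ≠ ∞ := ne_top_of_le_ne_top hVt (measure_mono inter_subset_right)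
    rcases eq_or_ne (volume E) 0 with h0 | h0
    · rw [h0]; exact zero_le
    have hsplit : ∀ x : ℝ≥0∞, x ≠ 0 → x ≠ ∞ → x ^ s = x ^ (s - 1) * x := fun x hx hx' => by
      conv_lhs => rw [← sub_add_cancel s 1, ENNReal.rpow_add _ _ hx hx', ENNReal.rpow_one]
    have h5 : volume E ^ (s - 1) ≤ K * 2 ^ (-(j : ℝ)) * V ^ (s - 1) := by
      refine (ENNReal.mul_le_mul_iff_left (c := volume E * W) (mul_ne_zero h0 hW0)
        (ENNReal.mul_ne_top hEt hWt)).1 ?_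
      calc volume E ^ (s - 1) * (volume E * W) = volume E ^ s * W := by
            rw [hsplit _ h0 hEt]; ring
        _ ≤ K * V ^ s * (2 ^ (-(j : ℝ)) * (W / V) * volume E) :=
            h1.trans (mul_le_mul_right h2 _)
        _ = K * 2 ^ (-(j : ℝ)) * V ^ (s - 1) * (volume E * (V * (W / V))) := by
            rw [hsplit _ hV0 hVt]; ring
        _ = _ := by rw [ENNReal.mul_div_cancel hV0 hVt]
    have h6 := ENNReal.rpow_le_rpow h5 hβ0.le
    rwa [ENNReal.mul_rpow_of_nonneg _ _ hβ0.le, ← ENNReal.rpow_mul, ← ENNReal.rpow_mul,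
      hβ, mul_one_div_cancel hs0.ne', ENNReal.rpow_one, ENNReal.rpow_one] at h6
  have hint : ∫⁻ x in dyadicCube c k, g x ^ α ≤ C1 * V := by
    refine (lintegral_rpow_le_tsum _ hgm hα0).trans ?_
    have hsum : C1 * V =
        2 ^ α * ∑' j : ℤ, (1 + K ^ β) * ((2 : ℝ≥0∞) ^ (-(δ * |(j : ℝ)|)) * V) := by
      rw [ENNReal.tsum_mul_left, ENNReal.tsum_mul_right, hC1, geomSum]
      ring
    rw [hsum]
    refine mul_le_mul_right (ENNReal.tsum_le_tsum fun j => ?_) _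
    rcases le_total 0 j with hj | hj
    · have hj' : (0 : ℝ) ≤ j := by exact_mod_cast hj
      calc _ ≤ 2 ^ (j * α) * ((K * 2 ^ (-(j : ℝ))) ^ β * V) := mul_le_mul_right (hlevel j) _
        _ = K ^ β * (2 ^ (j * α + -(j : ℝ) * β) * V) := by
            rw [ENNReal.mul_rpow_of_nonneg _ _ hβ0.le, ← ENNReal.rpow_mul, two_rpow_add]; ring
        _ ≤ (1 + K ^ β) * (2 ^ (-(δ * |(j : ℝ)|)) * V) := by
            refine mul_le_mul' le_add_self (mul_le_mul_left (two_rpow_le ?_) _)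
            rw [abs_of_nonneg hj']
            nlinarith
    · have hj' : (j : ℝ) ≤ 0 := by exact_mod_cast hj
      calc _ ≤ 2 ^ (j * α) * V := by
            refine mul_le_mul_right ((measure_mono (subset_univ _)).trans_eq ?_) _
            rw [Measure.restrict_apply_univ]
        _ = 1 * (2 ^ (j * α) * V) := (one_mul _).symm
        _ ≤ (1 + K ^ β) * (2 ^ (-(δ * |(j : ℝ)|)) * V) := by
            refine mul_le_mul' le_self_add (mul_le_mul_left (two_rpow_le ?_) _)
            rw [abs_of_nonpos hj']
            nlinarith
  have hσ : ∫⁻ x in dyadicCube c k, w x ^ (1 - v) ≤ (V / W) ^ α * (C1 * V) := by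
    refine le_trans (le_of_eq ?_) (mul_le_mul_right hint _)
    rw [← lintegral_const_mul _ (hgm.pow_const _)]
    congr 1; ext x
    rw [← ENNReal.mul_rpow_of_nonneg _ _ hα0.le, hg, ← neg_sub v 1, ENNReal.rpow_neg,
      ← ENNReal.inv_rpow]
    congr 1
    rw [mul_left_comm, ← ENNReal.inv_div (Or.inl hVt) (Or.inl hV0),
      ENNReal.inv_mul_cancel hWV0 hWVt, mul_one]
  have e1 : α * (1 / v) = 1 / u := by
    rw [hα, mul_one_div, div_eq_div_iff huv.symm.ne_zero huv.ne_zero, huv.symm.sub_one_mul_conj,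
      one_mul]
  calc W ^ (1 / u) * (∫⁻ y in dyadicCube c k, w y ^ (1 - v)) ^ (1 / v)
      ≤ W ^ (1 / u) * ((V / W) ^ α * (C1 * V)) ^ (1 / v) := by
        gcongr
        exact huv.symm.one_div_nonneg
    _ = C1 ^ (1 / v) * ((W * (V / W)) ^ (1 / u) * V ^ (1 / v)) := by
        simp only [ENNReal.mul_rpow_of_nonneg _ _ huv.symm.one_div_nonneg,
          ENNReal.mul_rpow_of_nonneg _ _ huv.one_div_nonneg, ← ENNReal.rpow_mul, e1]
        ring
    _ = _ := by
        rw [ENNReal.mul_div_cancel hW0 hWt, ← ENNReal.rpow_add _ _ hV0 hVt, one_div, one_div,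
          huv.inv_add_inv_eq_one, ENNReal.rpow_one]

/-! ### Interpolation between Lebesgue spaces -/

/-- A discrete Schur test in `ℓ^θ` for convolution with `2^{-δ|k|}`, for all `θ > 0`. -/
lemma tsum_convolution_rpow_le (δ : ℝ) {θ : ℝ} (hθ : 0 < θ) (b : ℤ → ℝ≥0∞) :
    ∑' k : ℤ, (∑' j : ℤ, 2 ^ (-(δ * |(j : ℝ) - k|)) * b j) ^ θ ≤
      geomSum (δ / 2) ^ θ * geomSum (θ * (δ / 2)) * ∑' j, b j ^ θ := by
  have h1 : ∀ k : ℤ, (∑' j : ℤ, 2 ^ (-(δ * |(j : ℝ) - k|)) * b j) ^ θ ≤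
      geomSum (δ / 2) ^ θ * ∑' j : ℤ, 2 ^ (-(θ * (δ / 2) * |(k : ℝ) - j|)) * b j ^ θ := by
    intro k
    -- Half of the decay makes the sum converge; the other half is kept in the supremum `M`.
    set M := ⨆ j : ℤ, 2 ^ (-(δ / 2 * |(j : ℝ) - k|)) * b j with hM
    have h2 : ∑' j : ℤ, 2 ^ (-(δ * |(j : ℝ) - k|)) * b j ≤ geomSum (δ / 2) * M := by
      rw [← tsum_two_rpow_abs_sub (δ / 2) k, ← ENNReal.tsum_mul_right]
      refine ENNReal.tsum_le_tsum fun j => ?_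
      calc 2 ^ (-(δ * |(j : ℝ) - k|)) * b j
          = 2 ^ (-(δ / 2 * |(j : ℝ) - k|)) * (2 ^ (-(δ / 2 * |(j : ℝ) - k|)) * b j) := by
            rw [← mul_assoc, ← two_rpow_add]; congr 2; ring
        _ ≤ _ := mul_le_mul_right
            (le_iSup (fun j : ℤ => 2 ^ (-(δ / 2 * |(j : ℝ) - k|)) * b j) j) _
    refine (ENNReal.rpow_le_rpow h2 hθ.le).trans ?_
    rw [ENNReal.mul_rpow_of_nonneg _ _ hθ.le]
    refine mul_le_mul_right ?_ _
    rw [← ENNReal.le_rpow_inv_iff hθ]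
    refine iSup_le fun j => ?_
    rw [ENNReal.le_rpow_inv_iff hθ]
    refine le_trans (le_of_eq ?_) (ENNReal.le_tsum j)
    rw [ENNReal.mul_rpow_of_nonneg _ _ hθ.le, ← ENNReal.rpow_mul, abs_sub_comm]
    congr 2; ring
  refine (ENNReal.tsum_le_tsum h1).trans_eq ?_
  rw [ENNReal.tsum_mul_left, ENNReal.tsum_comm, mul_assoc, ← ENNReal.tsum_mul_left]
  simp only [ENNReal.tsum_mul_right, tsum_two_rpow_abs_sub, ENNReal.tsum_mul_left]

/-- Marcinkiewicz interpolation, from two Lebesgue spaces to the Lorentz space `L^{p,q}`: at each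
dyadic height `2^k`, the function `F` splits into parts controlled by `G 1_{G > 2^k}` and by
`G 1_{G ≤ 2^k}`. -/
lemma exists_lorentzNorm_le_of_split {p q u₀ u₁ : ℝ} (hu₀ : 0 < u₀) (h₀ : u₀ < p) (h₁ : p < u₁)
    (hq : 0 < q) {A₀ A₁ : ℝ≥0∞} (hA₀ : A₀ ≠ ∞) (hA₁ : A₁ ≠ ∞) :
    ∃ C : ℝ≥0∞, C ≠ ∞ ∧ ∀ {X : Type} [MeasurableSpace X] (μ : Measure X) (F G : X → ℝ≥0∞),
      Measurable G →
      (∀ k : ℤ, ∃ F₀ F₁ : X → ℝ≥0∞, Measurable F₀ ∧ Measurable F₁ ∧ (∀ x, F x ≤ F₀ x + F₁ x) ∧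
        ∫⁻ x, F₀ x ^ u₀ ∂μ ≤ A₀ * ∫⁻ x, (Ioi ((2 : ℝ≥0∞) ^ (k : ℝ))).indicator id (G x) ^ u₀ ∂μ ∧
        ∫⁻ x, F₁ x ^ u₁ ∂μ ≤
          A₁ * ∫⁻ x, (Iic ((2 : ℝ≥0∞) ^ (k : ℝ))).indicator id (G x) ^ u₁ ∂μ) →
      lorentzNorm μ p q F ≤ C * lorentzNorm μ p q G := by
  have hp : 0 < p := hu₀.trans h₀
  have hu₁ : 0 < u₁ := hp.trans h₁
  have hθ : 0 < q / p := by positivity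
  set θ := q / p with hθd
  set δ := min (p - u₀) (u₁ - p) with hδ
  have hδ0 : 0 < δ := lt_min (by linarith) (by linarith)
  have hδ1 : δ ≤ p - u₀ := min_le_left _ _
  have hδ2 : δ ≤ u₁ - p := min_le_right _ _
  set B : ℝ≥0∞ := A₀ * 2 ^ u₀ * (1 + geomSum u₀) + A₁ * 2 ^ u₁ with hB
  have hBt : B ≠ ∞ := ENNReal.add_ne_top.2 ⟨ENNReal.mul_ne_top (ENNReal.mul_ne_top hA₀
    (two_rpow_ne_top _)) (ENNReal.add_ne_top.2 ⟨by simp, geomSum_ne_top hu₀⟩),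
    ENNReal.mul_ne_top hA₁ (two_rpow_ne_top _)⟩
  set C : ℝ≥0∞ := 2 ^ q * 2 ^ q * B ^ θ * (geomSum (δ / 2) ^ θ * geomSum (θ * (δ / 2)) *
    geomSum q) with hC
  have hCt : C ≠ ∞ := by
    refine ENNReal.mul_ne_top (ENNReal.mul_ne_top (ENNReal.mul_ne_top (two_rpow_ne_top _)
      (two_rpow_ne_top _)) (ENNReal.rpow_ne_top_of_nonneg hθ.le hBt)) (ENNReal.mul_ne_top
      (ENNReal.mul_ne_top (ENNReal.rpow_ne_top_of_nonneg hθ.le (geomSum_ne_top (by positivity)))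
        (geomSum_ne_top (by positivity))) (geomSum_ne_top hq))
  refine ⟨C ^ (1 / q), ENNReal.rpow_ne_top_of_nonneg (by positivity) hCt, ?_⟩
  intro X _ μ F G hG hsplit
  set b : ℤ → ℝ≥0∞ := fun k => 2 ^ (k * p) * μ {x | (2 : ℝ≥0∞) ^ (k : ℝ) < G x} with hb
  have hmarkov : ∀ (H : X → ℝ≥0∞) (u : ℝ) (k : ℤ), Measurable H → 0 < u →
      μ {x | (2 : ℝ≥0∞) ^ (k : ℝ) < H x} ≤ 2 ^ (-(k : ℝ) * u) * ∫⁻ x, H x ^ u ∂μ := by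
    intro H u k hH hu
    have h1 := mul_meas_ge_le_lintegral (μ := μ) (hH.pow_const u) (2 ^ ((k : ℝ) * u))
    have h2 : (2 : ℝ≥0∞) ^ (-(k : ℝ) * u) * 2 ^ ((k : ℝ) * u) = 1 := by
      rw [← two_rpow_add]; simp
    calc μ {x | (2 : ℝ≥0∞) ^ (k : ℝ) < H x}
        ≤ μ {x | (2 : ℝ≥0∞) ^ ((k : ℝ) * u) ≤ H x ^ u} := by
          refine measure_mono fun x hx => ?_
          have hx' : (2 : ℝ≥0∞) ^ (k : ℝ) < H x := hx
          show (2 : ℝ≥0∞) ^ ((k : ℝ) * u) ≤ H x ^ u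
          rw [ENNReal.rpow_mul]
          exact ENNReal.rpow_le_rpow hx'.le hu.le
      _ = 2 ^ (-(k : ℝ) * u) * (2 ^ ((k : ℝ) * u) *
          μ {x | (2 : ℝ≥0∞) ^ ((k : ℝ) * u) ≤ H x ^ u}) := by
          rw [← mul_assoc, h2, one_mul]
      _ ≤ _ := mul_le_mul_right h1 _
  have hG₀ : ∀ k : ℤ, 2 ^ (k * p) * (2 ^ (-(k : ℝ) * u₀) *
      ∫⁻ x, (Ioi ((2 : ℝ≥0∞) ^ (k : ℝ))).indicator id (G x) ^ u₀ ∂μ) ≤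
      2 ^ u₀ * ((1 + geomSum u₀) * ∑' j : ℤ, 2 ^ (-(δ * |(j : ℝ) - k|)) * b j) := by
    intro k
    have hm : Measurable fun x => (Ioi ((2 : ℝ≥0∞) ^ (k : ℝ))).indicator id (G x) :=
      (measurable_id.indicator measurableSet_Ioi).comp hG
    have hbk : b k ≤ ∑' j : ℤ, 2 ^ (-(δ * |(j : ℝ) - k|)) * b j := by
      refine le_trans (le_of_eq ?_) (ENNReal.le_tsum k)
      simp
    calc _ ≤ 2 ^ (k * p) * (2 ^ (-(k : ℝ) * u₀) * (2 ^ u₀ * ∑' j : ℤ, 2 ^ (j * u₀) *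
          μ {x | (2 : ℝ≥0∞) ^ (j : ℝ) <
            (Ioi ((2 : ℝ≥0∞) ^ (k : ℝ))).indicator id (G x)})) :=
          mul_le_mul_right (mul_le_mul_right (lintegral_rpow_le_tsum μ hm hu₀) _) _
      _ = 2 ^ u₀ * ∑' j : ℤ, 2 ^ (k * p + -(k : ℝ) * u₀ + j * u₀) *
          μ {x | (2 : ℝ≥0∞) ^ (j : ℝ) <
            (Ioi ((2 : ℝ≥0∞) ^ (k : ℝ))).indicator id (G x)} := by
          simp only [two_rpow_add, mul_assoc, ENNReal.tsum_mul_left]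
          ring
      _ ≤ 2 ^ u₀ * ∑' j : ℤ, (2 ^ (-(δ * |(j : ℝ) - k|)) * b j +
          2 ^ (-(u₀ * |(j : ℝ) - k|)) * b k) := by
          refine mul_le_mul_right (ENNReal.tsum_le_tsum fun j => ?_) _
          rcases le_total k j with hkj | hkj
          · have hkj' : (k : ℝ) ≤ j := by exact_mod_cast hkj
            refine le_trans ?_ le_self_add
            rw [hb, ← mul_assoc, ← two_rpow_add]
            refine mul_le_mul' (two_rpow_le ?_) (measure_mono fun x hx => ?_)
            · rw [abs_of_nonneg (by linarith)]
              nlinarith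
            · have hx3 : (2 : ℝ≥0∞) ^ (j : ℝ) <
                (Ioi ((2 : ℝ≥0∞) ^ (k : ℝ))).indicator id (G x) := hx
              exact hx3.trans_le (indicator_le_self _ _ (G x))
          · have hkj' : (j : ℝ) ≤ k := by exact_mod_cast hkj
            refine le_trans ?_ le_add_self
            rw [hb, ← mul_assoc, ← two_rpow_add]
            refine mul_le_mul' (two_rpow_le ?_) (measure_mono fun x hx => ?_)
            · rw [abs_of_nonpos (by linarith)]
              nlinarith
            · by_contra hx'
              have hx2 : G x ∉ Ioi ((2 : ℝ≥0∞) ^ (k : ℝ)) := hx'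
              have hx3 : (2 : ℝ≥0∞) ^ (j : ℝ) <
                (Ioi ((2 : ℝ≥0∞) ^ (k : ℝ))).indicator id (G x) := hx
              rw [indicator_of_notMem hx2] at hx3
              simp at hx3
      _ = 2 ^ u₀ * (∑' j : ℤ, 2 ^ (-(δ * |(j : ℝ) - k|)) * b j + geomSum u₀ * b k) := by
          rw [ENNReal.tsum_add, ENNReal.tsum_mul_right, tsum_two_rpow_abs_sub]
      _ ≤ _ := by
          rw [add_mul, one_mul]
          exact mul_le_mul_right (add_le_add_right (mul_le_mul_right hbk _) _) _
  have hG₁ : ∀ k : ℤ, 2 ^ (k * p) * (2 ^ (-(k : ℝ) * u₁) *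
      ∫⁻ x, (Iic ((2 : ℝ≥0∞) ^ (k : ℝ))).indicator id (G x) ^ u₁ ∂μ) ≤
      2 ^ u₁ * ∑' j : ℤ, 2 ^ (-(δ * |(j : ℝ) - k|)) * b j := by
    intro k
    have hm : Measurable fun x => (Iic ((2 : ℝ≥0∞) ^ (k : ℝ))).indicator id (G x) :=
      (measurable_id.indicator measurableSet_Iic).comp hG
    calc _ ≤ 2 ^ (k * p) * (2 ^ (-(k : ℝ) * u₁) * (2 ^ u₁ * ∑' j : ℤ, 2 ^ (j * u₁) *
          μ {x | (2 : ℝ≥0∞) ^ (j : ℝ) <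
            (Iic ((2 : ℝ≥0∞) ^ (k : ℝ))).indicator id (G x)})) :=
          mul_le_mul_right (mul_le_mul_right (lintegral_rpow_le_tsum μ hm hu₁) _) _
      _ = 2 ^ u₁ * ∑' j : ℤ, 2 ^ (k * p + -(k : ℝ) * u₁ + j * u₁) *
          μ {x | (2 : ℝ≥0∞) ^ (j : ℝ) <
            (Iic ((2 : ℝ≥0∞) ^ (k : ℝ))).indicator id (G x)} := by
          simp only [two_rpow_add, mul_assoc, ENNReal.tsum_mul_left]
          ring
      _ ≤ _ := by
          refine mul_le_mul_right (ENNReal.tsum_le_tsum fun j => ?_) _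
          rcases le_total k j with hkj | hkj
          · have hkj' : (k : ℝ) ≤ j := by exact_mod_cast hkj
            have hempty : {x | (2 : ℝ≥0∞) ^ (j : ℝ) <
                (Iic ((2 : ℝ≥0∞) ^ (k : ℝ))).indicator id (G x)} = ∅ := by
              refine eq_empty_of_forall_notMem fun x hx => ?_
              have hx3 : (2 : ℝ≥0∞) ^ (j : ℝ) <
                (Iic ((2 : ℝ≥0∞) ^ (k : ℝ))).indicator id (G x) := hx
              by_cases hx2 : G x ∈ Iic ((2 : ℝ≥0∞) ^ (k : ℝ))
              · rw [indicator_of_mem hx2] at hx3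
                exact absurd (hx3.trans_le (le_trans hx2 (two_rpow_le hkj'))) (lt_irrefl _)
              · rw [indicator_of_notMem hx2] at hx3
                simp at hx3
            rw [hempty, measure_empty, mul_zero]; exact zero_le
          · have hkj' : (j : ℝ) ≤ k := by exact_mod_cast hkj
            rw [hb, ← mul_assoc, ← two_rpow_add]
            refine mul_le_mul' (two_rpow_le ?_) (measure_mono fun x hx => ?_)
            · rw [abs_of_nonpos (by linarith)]
              nlinarith
            · have hx3 : (2 : ℝ≥0∞) ^ (j : ℝ) <
                (Iic ((2 : ℝ≥0∞) ^ (k : ℝ))).indicator id (G x) := hx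
              exact hx3.trans_le (indicator_le_self _ _ (G x))
  -- The level set `F > 2^{k+1}` is covered by the level sets of `F₀` and `F₁` at height `2^k`.
  have hF : ∀ k : ℤ, 2 ^ (k * p) * distribution μ F (2 ^ (((k + 1 : ℤ) : ℝ))) ≤
      B * ∑' j : ℤ, 2 ^ (-(δ * |(j : ℝ) - k|)) * b j := by
    intro k
    obtain ⟨F₀, F₁, hF₀, hF₁, hFle, hint₀, hint₁⟩ := hsplit k
    have h1 : distribution μ F (2 ^ (((k + 1 : ℤ) : ℝ))) ≤
        μ {x | (2 : ℝ≥0∞) ^ (k : ℝ) < F₀ x} + μ {x | (2 : ℝ≥0∞) ^ (k : ℝ) < F₁ x} := by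
      refine (measure_mono fun x hx => ?_).trans (measure_union_le _ _)
      have hx' : (2 : ℝ≥0∞) ^ (((k + 1 : ℤ) : ℝ)) < F x := by simpa using hx
      by_contra hnot
      simp only [mem_union, mem_ofPred_eq, not_or, not_lt] at hnot
      have h2 := hx'.trans_le ((hFle x).trans (add_le_add hnot.1 hnot.2))
      push_cast at h2
      rw [two_rpow_add, ENNReal.rpow_one, mul_two] at h2
      exact lt_irrefl _ h2
    set S := ∑' j : ℤ, 2 ^ (-(δ * |(j : ℝ) - k|)) * b j
    calc _ ≤ 2 ^ (k * p) * (2 ^ (-(k : ℝ) * u₀) * (A₀ *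
            ∫⁻ x, (Ioi ((2 : ℝ≥0∞) ^ (k : ℝ))).indicator id (G x) ^ u₀ ∂μ) +
          2 ^ (-(k : ℝ) * u₁) * (A₁ *
            ∫⁻ x, (Iic ((2 : ℝ≥0∞) ^ (k : ℝ))).indicator id (G x) ^ u₁ ∂μ)) := by
          refine mul_le_mul_right (h1.trans (add_le_add ?_ ?_)) _
          · exact (hmarkov F₀ u₀ k hF₀ hu₀).trans (mul_le_mul_right hint₀ _)
          · exact (hmarkov F₁ u₁ k hF₁ hu₁).trans (mul_le_mul_right hint₁ _)
      _ = A₀ * (2 ^ (k * p) * (2 ^ (-(k : ℝ) * u₀) *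
            ∫⁻ x, (Ioi ((2 : ℝ≥0∞) ^ (k : ℝ))).indicator id (G x) ^ u₀ ∂μ)) +
          A₁ * (2 ^ (k * p) * (2 ^ (-(k : ℝ) * u₁) *
            ∫⁻ x, (Iic ((2 : ℝ≥0∞) ^ (k : ℝ))).indicator id (G x) ^ u₁ ∂μ)) := by ring
      _ ≤ A₀ * (2 ^ u₀ * ((1 + geomSum u₀) * S)) + A₁ * (2 ^ u₁ * S) :=
          add_le_add (mul_le_mul_right (hG₀ k) _) (mul_le_mul_right (hG₁ k) _)
      _ = B * S := by rw [hB]; ring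
  have hmain : lorentzNorm μ p q F ^ q ≤ C * lorentzNorm μ p q G ^ q := by
    refine (lorentzNorm_rpow_le_tsum μ hp hq F).trans ?_
    rw [← (Equiv.addRight (1 : ℤ)).tsum_eq]
    calc _ = 2 ^ q * ∑' k : ℤ, 2 ^ q *
          (2 ^ (k * p) * distribution μ F (2 ^ (((k + 1 : ℤ) : ℝ)))) ^ θ := by
          congr 2; ext k
          rw [ENNReal.mul_rpow_of_nonneg _ _ hθ.le, ← ENNReal.rpow_mul, ← mul_assoc,
            ← two_rpow_add]
          congr 2
          simp only [Equiv.coe_addRight, hθd]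
          push_cast
          field_simp
          ring
      _ ≤ 2 ^ q * ∑' k : ℤ, 2 ^ q *
          (B * ∑' j : ℤ, 2 ^ (-(δ * |(j : ℝ) - k|)) * b j) ^ θ := by
          refine mul_le_mul_right (ENNReal.tsum_le_tsum fun k => mul_le_mul_right ?_ _) _
          exact ENNReal.rpow_le_rpow (hF k) hθ.le
      _ = 2 ^ q * 2 ^ q * B ^ θ *
          ∑' k : ℤ, (∑' j : ℤ, 2 ^ (-(δ * |(j : ℝ) - k|)) * b j) ^ θ := by
          simp only [ENNReal.mul_rpow_of_nonneg _ _ hθ.le, ENNReal.tsum_mul_left]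
          ring
      _ ≤ 2 ^ q * 2 ^ q * B ^ θ * (geomSum (δ / 2) ^ θ * geomSum (θ * (δ / 2)) *
          (geomSum q * lorentzNorm μ p q G ^ q)) := by
          refine mul_le_mul_right ((tsum_convolution_rpow_le δ hθ b).trans ?_) _
          refine mul_le_mul_right ((le_of_eq ?_).trans (tsum_le_lorentzNorm_rpow μ hp hq G)) _
          congr 1; ext k
          rw [hb, ENNReal.mul_rpow_of_nonneg _ _ hθ.le, ← ENNReal.rpow_mul]
          congr 2
          rw [hθd]; field_simp
      _ = _ := by rw [hC]; ring
  have h2 := ENNReal.rpow_le_rpow hmain (z := 1 / q) (by positivity)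
  rwa [ENNReal.mul_rpow_of_nonneg _ _ (by positivity), ← ENNReal.rpow_mul, ← ENNReal.rpow_mul,
    mul_one_div_cancel hq.ne', ENNReal.rpow_one, ENNReal.rpow_one] at h2

/-! ### Vector-valued inequality in Lorentz spaces -/

lemma lorentzNorm_congr_ae {X : Type*} [MeasurableSpace X] {ε : Type*} [ENorm ε] {μ : Measure X}
    {f g : X → ε} (h : f =ᵐ[μ] g) (p q : ℝ) : lorentzNorm μ p q f = lorentzNorm μ p q g := by
  have hd : distribution μ f = distribution μ g := by
    funext s
    refine measure_congr (h.mono fun x hx => ?_)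
    show (s < ‖f x‖ₑ) = (s < ‖g x‖ₑ)
    rw [hx]
  have hr : rearrangement μ f = rearrangement μ g := by
    funext t
    rw [rearrangement, rearrangement, hd]
  rw [lorentzNorm, lorentzNorm, hr]

lemma lorentzNorm_mono {X : Type*} [MeasurableSpace X] {μ : Measure X}
    {f g : X → ℝ≥0∞} (h : ∀ x, f x ≤ g x) {p q : ℝ} (hq : 0 < q) :
    lorentzNorm μ p q f ≤ lorentzNorm μ p q g := by
  have hd : ∀ t, rearrangement μ f t ≤ rearrangement μ g t := fun t =>
    sInf_le_sInf fun s hs => ⟨hs.1, le_trans (measure_mono fun x hx => hx.trans_le (h x)) hs.2⟩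
  unfold lorentzNorm
  gcongr
  exact hd _

lemma seqNorm_mono {X : Type*} {r : ℝ} (hr : 0 < r) {a b : ℕ → X → ℝ≥0∞} {x : X}
    (h : ∀ k, a k x ≤ b k x) : seqNorm r a x ≤ seqNorm r b x := by
  rw [seqNorm_ennreal, seqNorm_ennreal]
  exact ENNReal.rpow_le_rpow (ENNReal.tsum_le_tsum fun k => ENNReal.rpow_le_rpow (h k) hr.le)
    (by positivity)

lemma seqNorm_add_le {X : Type*} {r : ℝ} (hr : 1 < r) (a b : ℕ → X → ℝ≥0∞) (x : X) :
    seqNorm r (fun k x => a k x + b k x) x ≤ 2 * seqNorm r a x + 2 * seqNorm r b x := by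
  have hr0 : 0 < r := by linarith
  have h1r : 0 ≤ 1 / r := by positivity
  have h1 : ∑' k, (a k x + b k x) ^ r ≤ 2 ^ r * (∑' k, a k x ^ r + ∑' k, b k x ^ r) := by
    rw [← ENNReal.tsum_add, ← ENNReal.tsum_mul_left]
    refine ENNReal.tsum_le_tsum fun k => ?_
    refine (ENNReal.rpow_add_le_mul_rpow_add_rpow _ _ hr.le).trans ?_
    exact mul_le_mul_left (two_rpow_le (by linarith)) _
  simp only [seqNorm_ennreal]
  calc _ ≤ (2 ^ r * (∑' k, a k x ^ r + ∑' k, b k x ^ r)) ^ (1 / r) :=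
        ENNReal.rpow_le_rpow h1 h1r
    _ = 2 * (∑' k, a k x ^ r + ∑' k, b k x ^ r) ^ (1 / r) := by
        rw [ENNReal.mul_rpow_of_nonneg _ _ h1r, ← ENNReal.rpow_mul, mul_one_div_cancel hr0.ne',
          ENNReal.rpow_one]
    _ ≤ 2 * ((∑' k, a k x ^ r) ^ (1 / r) + (∑' k, b k x ^ r) ^ (1 / r)) := by
        refine mul_le_mul_right (ENNReal.rpow_add_le_add_rpow _ _ h1r ?_) _
        rw [div_le_one hr0]; exact hr.le
    _ = _ := mul_add _ _ _

lemma seqNorm_const_mul {X : Type*} {r : ℝ} (hr : 0 < r) (c : ℝ≥0∞) (a : ℕ → X → ℝ≥0∞) (x : X) :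
    seqNorm r (fun k x => c * a k x) x = c * seqNorm r a x := by
  have h1r : 0 ≤ 1 / r := by positivity
  simp only [seqNorm_ennreal, ENNReal.mul_rpow_of_nonneg _ _ hr.le, ENNReal.tsum_mul_left]
  rw [ENNReal.mul_rpow_of_nonneg _ _ h1r, ← ENNReal.rpow_mul, mul_one_div_cancel hr.ne',
    ENNReal.rpow_one]

lemma seqNorm_indicator {X : Type*} {r : ℝ} (hr : 0 < r) (s : Set X) (a : ℕ → X → ℝ≥0∞) (x : X) :
    seqNorm r (fun k => s.indicator (a k)) x = s.indicator (seqNorm r a) x := by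
  by_cases hx : x ∈ s
  · simp [seqNorm_ennreal, hx]
  · simp [seqNorm_ennreal, hx, hr]

/-- The vector-valued inequality for `A(p,q)` weights: both endpoints `u₀ < p < u₁` of the
interpolation lie above the exponent `s < p` of the restricted condition. The factor `a` stands
for a constant by which the maximal function may be enlarged. -/
lemma IsLorentzWeight.exists_lorentzNorm_seqNorm_le {p q : ℝ} {C : ℝ≥0∞}
    {w : (Fin n → ℝ) → ℝ≥0∞} (h : IsLorentzWeight p q C w) (hp : 1 < p) (hq : 1 < q)
    (hC : C ≠ ∞) {r : ℝ} (hr : 1 < r) {a : ℝ≥0∞} (ha : a ≠ ∞) :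
    ∃ C' : ℝ≥0∞, C' ≠ ∞ ∧ ∀ g : ℕ → (Fin n → ℝ) → ℝ≥0∞, (∀ k, Measurable (g k)) →
      lorentzNorm (volume.withDensity w) p q
          (fun x => a * seqNorm r (fun k => dyadicMax volume (g k)) x) ≤
        C' * lorentzNorm (volume.withDensity w) p q (seqNorm r g) := by
  obtain ⟨s, hs1, hsp, K, hK, hR⟩ := h.exists_rpow hp hq hC
  have hr0 : 0 < r := by linarith
  have hstrong : ∀ u : ℝ, s < u → ∃ A : ℝ≥0∞, A ≠ ∞ ∧ ∀ g : ℕ → (Fin n → ℝ) → ℝ≥0∞,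
      (∀ k, Measurable (g k)) →
      ∫⁻ x, (a * 2 * seqNorm r (fun k => dyadicMax volume (g k)) x) ^ u ∂volume.withDensity w ≤
        A * ∫⁻ x, seqNorm r g x ^ u ∂volume.withDensity w := by
    intro u hu
    have hu1 : 1 < u := hs1.trans hu
    have hu0 : 0 ≤ u := by linarith
    have huv := Real.HolderConjugate.conjExponent hu1
    obtain ⟨K', hK', hpair⟩ := exists_isMuckenhouptPair h.measurable h.pos h.lt_top h.finite hs1
      hK hR huv hu
    obtain ⟨A, hA, hbound⟩ := hpair.exists_lintegral_seqNorm_le huv hK' hr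
    refine ⟨(a * 2) ^ u * A, ENNReal.mul_ne_top (ENNReal.rpow_ne_top_of_nonneg hu0
      (ENNReal.mul_ne_top ha (by simp))) hA, fun g hg => ?_⟩
    have hm : Measurable (seqNorm r fun k => dyadicMax volume (g k)) :=
      measurable_seqNorm r fun k => measurable_dyadicMax _ _
    have hmg : Measurable (seqNorm r g) := measurable_seqNorm r hg
    rw [lintegral_withDensity_eq_lintegral_mul _ h.measurable ((hm.const_mul _).pow_const u),
      lintegral_withDensity_eq_lintegral_mul _ h.measurable (hmg.pow_const u)]
    simp only [Pi.mul_apply, ENNReal.mul_rpow_of_nonneg (a * 2) _ hu0, mul_left_comm (w _)]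
    rw [lintegral_const_mul _ (h.measurable.fun_mul (hm.pow_const u)), mul_assoc]
    exact mul_le_mul_right (hbound g hg) _
  obtain ⟨A₀, hA₀, h₀⟩ := hstrong ((s + p) / 2) (by linarith)
  obtain ⟨A₁, hA₁, h₁⟩ := hstrong (p + 1) (by linarith)
  obtain ⟨C', hC', hsplit⟩ := exists_lorentzNorm_le_of_split (p := p) (q := q)
    (u₀ := (s + p) / 2) (u₁ := p + 1) (by linarith) (by linarith) (by linarith) (by linarith)
    hA₀ hA₁
  refine ⟨C', hC', fun g hg => hsplit _ _ _ (measurable_seqNorm r hg) fun k => ?_⟩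
  have hG : Measurable (seqNorm r g) := measurable_seqNorm r hg
  set S := seqNorm r g ⁻¹' Ioi ((2 : ℝ≥0∞) ^ (k : ℝ)) with hS
  set T := seqNorm r g ⁻¹' Iic ((2 : ℝ≥0∞) ^ (k : ℝ)) with hT
  have hSm : MeasurableSet S := hG measurableSet_Ioi
  have hTm : MeasurableSet T := hG measurableSet_Iic
  have hTS : T = Sᶜ := by rw [hS, hT, ← preimage_compl, compl_Ioi]
  refine ⟨fun x => a * 2 * seqNorm r (fun k => dyadicMax volume (S.indicator (g k))) x,
    fun x => a * 2 * seqNorm r (fun k => dyadicMax volume (T.indicator (g k))) x,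
    (measurable_seqNorm r fun k => measurable_dyadicMax _ _).const_mul _,
    (measurable_seqNorm r fun k => measurable_dyadicMax _ _).const_mul _, fun x => ?_, ?_, ?_⟩
  · beta_reduce
    rw [mul_assoc, mul_assoc, ← mul_add]
    refine mul_le_mul_right ?_ _
    refine le_trans (seqNorm_mono hr0 fun k => ?_) (seqNorm_add_le hr _ _ x)
    refine le_trans (le_of_eq ?_) (dyadicMax_add_le volume ((hg k).indicator hSm) x)
    congr 1
    funext y
    rw [hTS]
    exact (indicator_self_add_compl_apply S (g k) y).symm
  · refine (h₀ _ fun k => (hg k).indicator hSm).trans_eq ?_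
    simp only [seqNorm_indicator hr0]
    rfl
  · refine (h₁ _ fun k => (hg k).indicator hTm).trans_eq ?_
    simp only [seqNorm_indicator hr0]
    rfl

/-! ### The centred maximal function over all cubes -/

lemma cube_eq_closedBall (c : Fin n → ℝ) {h : ℝ} (hh : 0 ≤ h) :
    cube c h = Metric.closedBall c h := by
  rw [closedBall_pi _ hh, cube, ← pi_univ_Icc]
  simp only [Real.closedBall_eq_Icc]

/-- A cube of half side length `h ∈ (2^k, 2^{k+1}]` is compared with the concentric dyadic cubes of
half side lengths `2^k` and `2^{k+1}`. -/
lemma maximalFunction_le (f : (Fin n → ℝ) → ℂ) (x : Fin n → ℝ) :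
    maximalFunction f x ≤ 2 ^ n * dyadicMax volume (fun y => ‖f y‖ₑ) x := by
  refine iSup₂_le fun h hh => ?_
  obtain ⟨k, hk1, hk2⟩ := exists_mem_Ioc_zpow hh (one_lt_two (α := ℝ))
  rw [cube_eq_closedBall x hh.le]
  have hsub : dyadicCube x k ⊆ Metric.closedBall x h := Metric.closedBall_subset_closedBall hk1.le
  have hsup : Metric.closedBall x h ⊆ dyadicCube x (k + 1) :=
    Metric.closedBall_subset_closedBall hk2
  calc _ ≤ (volume (dyadicCube x k))⁻¹ * ∫⁻ y in dyadicCube x (k + 1), ‖f y‖ₑ :=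
        mul_le_mul' (ENNReal.inv_le_inv.2 (measure_mono hsub)) (lintegral_mono_set hsup)
    _ ≤ (volume (dyadicCube x k))⁻¹ * (volume (dyadicCube x (k + 1)) *
          dyadicMax volume (fun y => ‖f y‖ₑ) x) :=
        mul_le_mul_right (setLIntegral_dyadicCube_le _ _ _ _ (volume_dyadicCube_ne_top _ _)) _
    _ = (volume (dyadicCube x k))⁻¹ * volume (dyadicCube x k) * (2 ^ n *
          dyadicMax volume (fun y => ‖f y‖ₑ) x) := by
        rw [volume_dyadicCube_add_one x x k]; ring
    _ = _ := by
        rw [ENNReal.inv_mul_cancel (volume_dyadicCube_ne_zero _ _) (volume_dyadicCube_ne_top _ _),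
          one_mul]

/-- The supremum over all half side lengths equals the supremum over the rational ones, since the
volume of a cube depends continuously on its side length. -/
lemma measurable_maximalFunction (f : (Fin n → ℝ) → ℂ) : Measurable (maximalFunction f) := by
  have hvol : ∀ (x : Fin n → ℝ) (h : ℝ), 0 ≤ h → volume (cube x h) = ENNReal.ofReal ((2 * h) ^ n) :=
    fun x h hh => by rw [cube_eq_closedBall x hh, Real.volume_pi_closedBall _ hh, Fintype.card_fin]
  have hrat : maximalFunction f = fun x => ⨆ (h : ℚ) (_ : 0 < h),
      (volume (Metric.closedBall x (h : ℝ)))⁻¹ * ∫⁻ y in Metric.closedBall x (h : ℝ), ‖f y‖ₑ := by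
    funext x
    refine le_antisymm (iSup₂_le fun h hh => ?_) (iSup₂_le fun h hh => ?_)
    · obtain ⟨a, -, ha, hlim⟩ := Real.exists_seq_rat_strictAnti_tendsto h
      have hV : Filter.Tendsto (fun i => (volume (cube x (a i : ℝ)))⁻¹ * ∫⁻ y in cube x h, ‖f y‖ₑ)
          Filter.atTop (nhds ((volume (cube x h))⁻¹ * ∫⁻ y in cube x h, ‖f y‖ₑ)) := by
        refine ENNReal.Tendsto.mul_const (tendsto_inv_iff.2 ?_) (Or.inl ?_)
        · rw [hvol x h hh.le]
          simp only [hvol x _ (hh.trans (ha _)).le]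
          exact ENNReal.tendsto_ofReal ((hlim.const_mul 2).pow n)
        · rw [hvol x h hh.le]
          exact ENNReal.inv_ne_zero.2 ENNReal.ofReal_ne_top
      refine le_of_tendsto' hV fun i => ?_
      have hi : (0 : ℝ) < a i := hh.trans (ha i)
      refine le_trans ?_ (le_iSup₂_of_le (a i) (by exact_mod_cast hi) le_rfl)
      rw [cube_eq_closedBall x hi.le, cube_eq_closedBall x hh.le]
      exact mul_le_mul_right (lintegral_mono_set
        (Metric.closedBall_subset_closedBall (ha i).le)) _
    · have hh' : (0 : ℝ) < h := by exact_mod_cast hh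
      refine le_iSup₂_of_le (h : ℝ) hh' ?_
      rw [cube_eq_closedBall x hh'.le]
  rw [hrat]
  exact Measurable.iSup fun h => Measurable.iSup fun _ =>
    (measurable_measure_closedBall volume _).inv.mul (measurable_setLIntegral_closedBall volume _ _)

/-! ### Boundedness of the maximal function -/

/-- The class `A(p,q)` expressed through a measurable representative of the weight. -/
lemma MemA.exists_isLorentzWeight {p q : ℝ} (hp : 1 < p) (hq : 1 < q) {ω : (Fin n → ℝ) → ℝ}
    (hω : MemA p q ω) : ∃ w : (Fin n → ℝ) → ℝ≥0∞, weightMeasure ω = volume.withDensity w ∧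
      ∃ C : ℝ≥0∞, C ≠ ∞ ∧ IsLorentzWeight p q C w := by
  obtain ⟨⟨-, hloc, hpos⟩, C, hC⟩ := hω
  have hmeas : AEMeasurable (fun x => ENNReal.ofReal (ω x)) volume :=
    hloc.aestronglyMeasurable.aemeasurable.ennreal_ofReal
  obtain ⟨w, hw, hae⟩ := hmeas
  have hν : weightMeasure ω = volume.withDensity w := withDensity_congr_ae hae
  refine ⟨w, hν, C, ENNReal.coe_ne_top, hw, ?_, ?_, fun c k => ?_, fun c k => ?_⟩
  · filter_upwards [hae, hpos] with x hx hx0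
    rw [← hx]; simpa using hx0
  · filter_upwards [hae] with x hx
    rw [← hx]; exact ENNReal.ofReal_ne_top
  · rw [← hν, weightMeasure, withDensity_apply _ (measurableSet_dyadicCube _ _)]
    exact (hloc.integrableOn_isCompact (isCompact_closedBall _ _)).lintegral_lt_top.ne
  · have h := hC c (2 ^ k) (by positivity)
    have hk : cube c ((2 : ℝ) ^ k) = dyadicCube c k := cube_eq_closedBall c (by positivity)
    rw [hk, lorentzNorm_indicator_one _ (by linarith) (by linarith), hν] at h
    refine (le_of_eq ?_).trans h
    congr 1
    refine lorentzNorm_congr_ae ?_ _ _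
    refine (withDensity_absolutelyContinuous volume w).ae_le (hae.mono fun x hx => ?_)
    simp only [indicator, hx]

end WeightedLorentz

theorem mainTheorem7 (n : ℕ) (hn : 1 ≤ n) (p q r : ℝ) (hp : 1 < p) (hq : 1 < q) (hr : 1 < r)
    (ω : (Fin n → ℝ) → ℝ) (hω : WeightedLorentz.MemA p q ω) :
    ∃ C : ℝ≥0, ∀ f : ℕ → (Fin n → ℝ) → ℂ, WeightedLorentz.MemLorentzSeq ω p q r f →
      WeightedLorentz.MemLorentzSeq ω p q r
          (fun k => WeightedLorentz.maximalFunction (f k)) ∧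
        WeightedLorentz.lorentzSeqNorm ω p q r
            (fun k => WeightedLorentz.maximalFunction (f k)) ≤
          C * WeightedLorentz.lorentzSeqNorm ω p q r f := by
  obtain ⟨w, hν, C, hC, hw⟩ := hω.exists_isLorentzWeight hp hq
  have hr0 : 0 < r := by linarith
  obtain ⟨A, hA, hbound⟩ := hw.exists_lorentzNorm_seqNorm_le hp hq hC hr
    (a := 2 ^ n) (by finiteness)
  refine ⟨A.toNNReal, fun f hf => ?_⟩
  rw [ENNReal.coe_toNNReal hA]
  have hle : WeightedLorentz.lorentzSeqNorm ω p q r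
      (fun k => WeightedLorentz.maximalFunction (f k)) ≤
        A * WeightedLorentz.lorentzSeqNorm ω p q r f := by
    have hm : ∀ k, AEMeasurable (fun x => ‖f k x‖ₑ) volume := fun k => (hf.1 k).enorm
    have hfg : WeightedLorentz.seqNorm r f =ᵐ[volume.withDensity w]
        WeightedLorentz.seqNorm r fun k => (hm k).mk := by
      have hae : ∀ᵐ x, ∀ k, ‖f k x‖ₑ = (hm k).mk _ x := ae_all_iff.2 fun k => (hm k).ae_eq_mk
      refine (withDensity_absolutelyContinuous volume w).ae_le (hae.mono fun x hx => ?_)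
      rw [WeightedLorentz.seqNorm_ennreal, WeightedLorentz.seqNorm]
      simp only [hx]
    rw [WeightedLorentz.lorentzSeqNorm, WeightedLorentz.lorentzSeqNorm, hν,
      WeightedLorentz.lorentzNorm_congr_ae hfg]
    refine le_trans (WeightedLorentz.lorentzNorm_mono (fun x => ?_) (by linarith))
      (hbound _ fun k => (hm k).measurable_mk)
    rw [← WeightedLorentz.seqNorm_const_mul hr0]
    refine WeightedLorentz.seqNorm_mono hr0 fun k => ?_
    rw [← WeightedLorentz.dyadicMax_congr volume (hm k).ae_eq_mk]
    exact WeightedLorentz.maximalFunction_le (f k) x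
  exact ⟨⟨fun k => (WeightedLorentz.measurable_maximalFunction (f k)).aestronglyMeasurable,
    hle.trans_lt (ENNReal.mul_lt_top hA.lt_top hf.2)⟩, hle⟩
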